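/- Let $F_N=F(A)$ be the free group of rank $N\ge 2$ with a fixed free basis $A$. For $u\in F_N$ let $|u|_A$ be the freely reduced length of $u$, let $\|u\|_A$ be its cyclically reduced length (which depends only on the conjugacy class $[u]$), and let ${\rm Out}(F_N)$ act on the set of conjugacy classes. A Whitehead automorphism is $\tau\in{\rm Aut}(F_N)$ that either permutes $\Sigma_A=A\sqcup A^{-1}$, or for which there is $a\in\Sigma_A$ with $\tau(x)\in\{x,xa,a^{-1}x,a^{-1}xa\}$ for all $x\in\Sigma_A$; let $\mathcal W_N$ be the finite set of nontrivial elements of ${\rm Out}(F_N)$ that are represented by Whitehead automorphisms. Let $\mathcal M([u])$ be the set of those elements of the orbit ${\rm Out}(F_N)[u]$ that have the least cyclically reduced length in the orbit. Let $M\ge 1$ be an integer, and let $\lambda>1$ and $0\le\varepsilon<\lambda-1$ be real numbers. A finite set $S$ of nontrivial conjugacy classes is $(M,\lambda,\varepsilon)$-minimizing if $\#S\le M$; all elements of $S$ lie in one ${\rm Out}(F_N)$-orbit; $1-\varepsilon\le \|u'\|_A/\|u\|_A\le 1+\varepsilon$ for all $[u],[u']\in S$; and $\|\varphi(u)\|_A/\|u\|_A\ge\lambda$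 whenever $[u]\in S$, $\varphi\in{\rm Out}(F_N)$ and $\varphi([u])\notin S$. A class is $(M,\lambda,\varepsilon)$-minimal if it belongs to an $(M,\lambda,\varepsilon)$-minimizing set. Let $U_N$ be the set of $1\ne u\in F_N$ with $[u]$ $(M,\lambda,\varepsilon)$-minimal; let $Y_N$ be the set of $1\ne u\in F_N$ such that ${\rm Out}(F_N)[u]$ contains an $(M,\lambda,\varepsilon)$-minimal class (that is, $[u]$ is $(M,\lambda,\varepsilon)$-minimizable); and for $\psi\in{\rm Out}(F_N)$ let $U_N(\psi)$ be the set of $1\ne u\in F_N$ with $\psi([u])$ $(M,\lambda,\varepsilon)$-minimal. The Whitehead minimization algorithm replaces $[w]$ by $\tau([w])$ for some $\tau\in\mathcal W_N$ with $\|\tau(w)\|_A<\|w\|_A$ as long as there is one (the moves being tried in a fixed order). The Whitehead algorithm on $(w,w')$ minimizes both to $[u]$ and $[u']$; if $\|u\|_A\ne\|u'\|_A$, it answers "no". Otherwise, with $n=\|u\|_A$, it starts with $S_1=\{[u]\}$ and puts $S_{i+1}=S_i\cup\{\tau([v]) : [v]\in S_i,\ \tau\in\mathcal W_N,\ \|\tau(v)\|_A=n\}$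 until $S_{i+1}=S_i$, and answers whether $[u']\in S_i$. The $\psi$-speed-up does the same, but minimizes each input $[w]$ by running the minimization on $[w]$ and on $\psi([w])$ in parallel until one of the two runs ends. Inputs are freely reduced words, conjugacy classes are handled as cyclically reduced words stored as linked lists, and time is the number of steps of a fixed program for the algorithm, where one step consists of boundedly many elementary operations on first cells of lists and on letters. Then there is a constant $K\ge 1$, depending only on $N$ (with the fixed list of moves), $M$, $\lambda$, $\varepsilon$, such that: (a) For every $u\in U_N$ the Whitehead minimization algorithm on $u$ terminates in time at most $K|u|_A$ and produces an element of $\mathcal M([u])$. (b) For all $u_1,u_2\in U_N$ the Whitehead algorithm on $(u_1,u_2)$ terminates in time at most $K\max\{|u_1|_A,|u_2|_A\}$. (c) For all $u_1\in Y_N$ and $1\ne u_2\in F_N$ the Whitehead algorithm on $(u_1,u_2)$ terminates in time at most $K\max\{|u_1|_A^2,|u_2|_A^2\}$. (d) For all $u_1\in U_N$ and $1\ne u_2\in F_N$ the Whitehead algorithm on $(u_1,u_2)$ terminates in time at most $K\max\{|u_1|_A,|u_2|_A^2\}$. (e) For every $\psi\in{\rm Out}(F_N)$ there is $K'\ge 1$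 such that for all $u_1,u_2\in U_N(\psi)$ the $\psi$-speed-up of the Whitehead algorithm on $(u_1,u_2)$ terminates in time at most $K'\max\{|u_1|_A,|u_2|_A\}$. (f) For every $\psi\in{\rm Out}(F_N)$ there is $K'\ge 1$ such that for all $u_1\in U_N(\psi)$ and $1\ne u_2\in F_N$ the $\psi$-speed-up of the Whitehead algorithm on $(u_1,u_2)$ terminates in time at most $K'\max\{|u_1|_A,|u_2|_A^2\}$. In (b)-(f) the answer of the algorithm is "yes" if and only if ${\rm Out}(F_N)[u_1]={\rm Out}(F_N)[u_2]$. -/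

import Mathlib

namespace Whitehead

/-! ### The free group, conjugacy classes and outer automorphisms -/

/-- The free group `F_N` with the fixed free basis `a_i = FreeGroup.of i`. -/
abbrev F (N : ℕ) : Type := FreeGroup (Fin N)

/-- The set `C_N` of conjugacy classes of `F_N`. -/
abbrev Cls (N : ℕ) : Type := ConjClasses (F N)

/-- The alphabet `Σ_A`: `(i, true)` is `a_i` and `(i, false)` is `a_i⁻¹`. -/
abbrev Letter (N : ℕ) : Type := Fin N × Bool

/-- Words over `Σ_A`. -/
abbrev Word (N : ℕ) : Type := List (Letter N)

/-- The cyclically reduced length `‖g‖_A` of an element. -/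
def cycNorm {N : ℕ} (g : F N) : ℕ := (FreeGroup.reduceCyclically g.toWord).length

theorem norm_pow_succ_eq {N : ℕ} (g : F N) (n : ℕ) :
    (g ^ (n + 1)).norm =
      2 * (FreeGroup.reduceCyclically.conjugator g.toWord).length + (n + 1) * cycNorm g := by
  have h := FreeGroup.reduceCyclically.reduce_flatten_replicate_succ
    (FreeGroup.isReduced_toWord (x := g)) n
  rw [FreeGroup.norm, FreeGroup.toWord_pow, h]
  simp [cycNorm, FreeGroup.invRev_length]
  ring

theorem cycNorm_conj_le {N : ℕ} (x g : F N) : cycNorm (x * g * x⁻¹) ≤ cycNorm g := by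
  by_contra! hlt
  set C := 2 * (FreeGroup.reduceCyclically.conjugator g.toWord).length + 2 * x.norm with hC
  have h1 := norm_pow_succ_eq (x * g * x⁻¹) C
  have h2 := norm_pow_succ_eq g C
  have h3 : ((x * g * x⁻¹) ^ (C + 1)).norm ≤ x.norm + (g ^ (C + 1)).norm + x.norm := by
    rw [conj_pow]
    calc (x * g ^ (C + 1) * x⁻¹).norm ≤ (x * g ^ (C + 1)).norm + (x⁻¹).norm :=
          FreeGroup.norm_mul_le _ _
      _ ≤ x.norm + (g ^ (C + 1)).norm + x.norm := by
          rw [FreeGroup.norm_inv_eq]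
          have := FreeGroup.norm_mul_le x (g ^ (C + 1))
          omega
  have h4 : (C + 1) * (cycNorm g + 1) ≤ (C + 1) * cycNorm (x * g * x⁻¹) :=
    Nat.mul_le_mul_left _ hlt
  rw [Nat.mul_add] at h4
  omega

theorem cycNorm_eq_of_isConj {N : ℕ} {g h : F N} (H : IsConj g h) : cycNorm g = cycNorm h := by
  obtain ⟨x, rfl⟩ := isConj_iff.1 H
  refine le_antisymm ?_ (cycNorm_conj_le x g)
  simpa [mul_assoc] using cycNorm_conj_le x⁻¹ (x * g * x⁻¹)

/-- The cyclically reduced length of a conjugacy class. -/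
def len {N : ℕ} (c : Cls N) : ℕ :=
  Quotient.liftOn c cycNorm fun _ _ h => cycNorm_eq_of_isConj h

/-- `Aut(F_N)` acts on conjugacy classes by `φ [g] = [φ g]`. -/
instance autAction (N : ℕ) : MulAction (MulAut (F N)) (Cls N) where
  smul φ c := ConjClasses.map φ.toMonoidHom c
  one_smul c := Quotient.inductionOn c fun _ => rfl
  mul_smul _ _ c := Quotient.inductionOn c fun _ => rfl

/-- The subgroup of inner automorphisms. -/
abbrev Inn (N : ℕ) : Subgroup (MulAut (F N)) := (MulAut.conj : F N →* MulAut (F N)).range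

instance innNormal (N : ℕ) : (Inn N).Normal where
  conj_mem := by
    rintro _ ⟨g, rfl⟩ φ
    refine ⟨φ g, ?_⟩
    ext x
    simp [MulAut.mul_apply, MulAut.conj_apply]

/-- `Out(F_N) = Aut(F_N) / Inn(F_N)`. -/
abbrev Out (N : ℕ) : Type := MulAut (F N) ⧸ Inn N

/-- The projection `Aut(F_N) → Out(F_N)`. -/
abbrev toOut {N : ℕ} : MulAut (F N) →* Out N := QuotientGroup.mk' (Inn N)

theorem inn_le_ker (N : ℕ) : Inn N ≤ (MulAction.toPermHom (MulAut (F N)) (Cls N)).ker := by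
  rintro _ ⟨g, rfl⟩
  rw [MonoidHom.mem_ker]
  ext c
  refine Quotient.inductionOn c fun x => ?_
  change ConjClasses.mk (g * x * g⁻¹) = ConjClasses.mk x
  exact (ConjClasses.mk_eq_mk_iff_isConj.2 (isConj_iff.2 ⟨g, rfl⟩)).symm

/-- The action of `Out(F_N)` on conjugacy classes, induced by that of `Aut(F_N)`. -/
instance outAction (N : ℕ) : MulAction (Out N) (Cls N) :=
  MulAction.compHom (Cls N)
    (QuotientGroup.lift (Inn N) (MulAction.toPermHom (MulAut (F N)) (Cls N)) (inn_le_ker N))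

/-- The conjugacy class `[g]`. -/
abbrev cls {N : ℕ} (g : F N) : Cls N := ConjClasses.mk g

/-! ### Whitehead moves and minimality -/

/-- A letter as an element of `F_N`. -/
abbrev elt {N : ℕ} (x : Letter N) : F N := FreeGroup.mk [x]

/-- Whitehead automorphisms of the first kind (relabelings). -/
def IsFirstKind {N : ℕ} (τ : MulAut (F N)) : Prop :=
  ∃ t : Equiv.Perm (Letter N), ∀ x, τ (elt x) = elt (t x)

/-- Whitehead automorphisms of the second kind, with multiplier `a`. -/
def IsSecondKind {N : ℕ} (τ : MulAut (F N)) : Prop :=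
  ∃ a : Letter N, ∀ x : Letter N,
    τ (elt x) = elt x ∨ τ (elt x) = elt x * elt a ∨ τ (elt x) = (elt a)⁻¹ * elt x ∨
      τ (elt x) = (elt a)⁻¹ * elt x * elt a

/-- Whitehead automorphisms of `F_N`. -/
def IsWhitehead {N : ℕ} (τ : MulAut (F N)) : Prop := IsFirstKind τ ∨ IsSecondKind τ

/-- The set `W_N` of nontrivial Whitehead moves in `Out(F_N)`. -/
def moveSet (N : ℕ) : Set (Out N) := {ω | ω ≠ 1 ∧ ∃ τ : MulAut (F N), IsWhitehead τ ∧ toOut τ = ω}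

/-- A finite list of Whitehead automorphisms that represents exactly the moves in `W_N`;
it fixes the order in which an algorithm tries the moves. -/
def Enumerates {N : ℕ} (moves : List (MulAut (F N))) : Prop :=
  (∀ τ ∈ moves, IsWhitehead τ) ∧ {ω | ∃ τ ∈ moves, toOut τ = ω} = moveSet N

/-- `Out(F_N)`-minimal classes. -/
def IsOutMinimal {N : ℕ} (c : Cls N) : Prop := ∀ φ : Out N, len c ≤ len (φ • c)

/-- The set `M(c)` of `Out(F_N)`-minimal classes in the orbit of `c`. -/
def minimalSet {N : ℕ} (c : Cls N) : Set (Cls N) :=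
  {d | d ∈ MulAction.orbit (Out N) c ∧ IsOutMinimal d}

/-- `(M, lam, eps)`-minimizing sets of conjugacy classes. -/
structure IsMinimizing {N : ℕ} (M : ℕ) (lam eps : ℝ) (S : Finset (Cls N)) : Prop where
  nontrivial : ∀ c ∈ S, c ≠ cls 1
  card_le : S.card ≤ M
  orbit_eq : ∀ c ∈ S, ∀ d ∈ S, MulAction.orbit (Out N) c = MulAction.orbit (Out N) d
  ratio : ∀ c ∈ S, ∀ d ∈ S,
    1 - eps ≤ (len d : ℝ) / (len c : ℝ) ∧ (len d : ℝ) / (len c : ℝ) ≤ 1 + eps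
  gap : ∀ c ∈ S, ∀ φ : Out N, φ • c ∉ S → lam ≤ (len (φ • c) : ℝ) / (len c : ℝ)

/-- `(M, lam, eps)`-minimal classes. -/
def IsMLEMinimal {N : ℕ} (M : ℕ) (lam eps : ℝ) (c : Cls N) : Prop :=
  ∃ S : Finset (Cls N), IsMinimizing M lam eps S ∧ c ∈ S

/-- The set `U_N(M, lam, eps)`. -/
def U (N M : ℕ) (lam eps : ℝ) : Set (F N) := {u | u ≠ 1 ∧ IsMLEMinimal M lam eps (cls u)}

/-- The set `Y_N(M, lam, eps)` of elements whose class is `(M, lam, eps)`-minimizable. -/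
def Y (N M : ℕ) (lam eps : ℝ) : Set (F N) :=
  {w | w ≠ 1 ∧ ∃ c ∈ MulAction.orbit (Out N) (cls w), IsMLEMinimal M lam eps c}

/-- The set `U_N(M, lam, eps; ψ)`. -/
def UPsi (N M : ℕ) (lam eps : ℝ) (ψ : Out N) : Set (F N) :=
  {w | w ≠ 1 ∧ IsMLEMinimal M lam eps (ψ • cls w)}

/-! ### Computations with a step count

Programs are first-order recursive programs over linked lists. The running time is the number
of function calls in the call-by-value evaluation, recursive calls included: the right-hand side
of every equation of every program below that handles lists is charged one step by `tick`. Apart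
from further calls, such a right-hand side performs a bounded number of elementary operations:
inspecting, building or dropping the first cell of a list, comparing two letters of the finite
alphabet `Σ_A`, or looking up a letter in a table with `2N` entries that is part of the program.
Lists are passed as pointers and never copied for free. The main programs at the end run boundedly
many such programs and loops one after the other, and their running times are added. -/

/-- The value of a terminating computation together with its number of steps. -/
structure Timed (α : Type) where
  val : α
  time : ℕ

instance : Monad Timed where
  pure a := ⟨a, 0⟩
  bind m f := ⟨(f m.val).val, m.time + (f m.val).time⟩

/-- Charge one step. -/
def tick {α : Type} (m : Timed α) : Timed α := ⟨m.val, m.time + 1⟩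

/-- A possibly nonterminating computation `m`: the proposition `m a t` says that it terminates
with the value `a` after exactly `t` steps. -/
def Comp (α : Type) : Type := α → ℕ → Prop

instance : Monad Comp where
  pure a := fun b t => b = a ∧ t = 0
  bind m f := fun b t => ∃ a t₁ t₂, m a t₁ ∧ f a b t₂ ∧ t = t₁ + t₂

/-- A terminating computation as a computation. -/
def Timed.run {α : Type} (m : Timed α) : Comp α := fun a t => a = m.val ∧ t = m.time

/-- Execution of a loop: from the state `s`, the body either yields a new state or exits the loop
with a result. Each round costs one step in addition to the body. -/
inductive Loop {σ ρ : Type} (body : σ → Timed (σ ⊕ ρ)) : σ → ρ → ℕ → Prop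
  | exit (s : σ) (r : ρ) : (body s).val = Sum.inr r → Loop body s r ((body s).time + 1)
  | next (s s' : σ) (r : ρ) (t : ℕ) : (body s).val = Sum.inl s' → Loop body s' r t →
      Loop body s r ((body s).time + 1 + t)

/-- A loop as a computation. -/
def loop {σ ρ : Type} (body : σ → Timed (σ ⊕ ρ)) (s : σ) : Comp ρ := Loop body s

/-! ### Words -/

/-- The inverse letter. -/
def inv {N : ℕ} (x : Letter N) : Letter N := (x.1, !x.2)

/-- A strict linear order on the finite alphabet. -/
def before {N : ℕ} (x y : Letter N) : Bool := x.1 < y.1 || (x.1 == y.1 && (!x.2 && y.2))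

/-- `rev w acc` is the reversal of `w` followed by `acc`. -/
def rev {N : ℕ} : Word N → Word N → Timed (Word N)
  | [], acc => tick (pure acc)
  | x :: w, acc => tick (rev w (x :: acc))

/-- Append a letter to a freely reduced word that is stored in reverse, cancelling if possible. -/
def push {N : ℕ} (x : Letter N) : Word N → Timed (Word N)
  | [] => tick (pure [x])
  | y :: acc => tick (pure (if y = inv x then acc else x :: y :: acc))

/-- Append a word to a freely reduced word that is stored in reverse. -/
def pushWord {N : ℕ} : Word N → Word N → Timed (Word N)
  | [], acc => tick (pure acc)
  | x :: v, acc => tick do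
      let acc' ← push x acc
      pushWord v acc'

/-- Append the image of a word under the substitution `f` to a freely reduced word that is stored
in reverse. -/
def subst {N : ℕ} (f : Letter N → Word N) : Word N → Word N → Timed (Word N)
  | [], acc => tick (pure acc)
  | x :: w, acc => tick do
      let acc' ← pushWord (f x) acc
      subst f w acc'

/-- Strip from `w` the letters that cancel against the last letters of `w`; the second argument
starts as the reversal of `w`, and the third one collects the stripped letters. -/
def strip {N : ℕ} : Word N → Word N → Word N → Timed (Word N × Word N)
  | x :: w, y :: r, d => tick (if y = inv x then strip w r (x :: d) else pure (x :: w, d))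
  | [], _, d => tick (pure ([], d))
  | x :: w, [], d => tick (pure (x :: w, d))

/-- Drop as many letters from the second word as the first one has. -/
def dropLen {N : ℕ} : Word N → Word N → Timed (Word N)
  | _ :: d, _ :: r => tick (dropLen d r)
  | [], r => tick (pure r)
  | _ :: _, [] => tick (pure [])

/-- The cyclically reduced form of a freely reduced word. -/
def cycReduce {N : ℕ} (w : Word N) : Timed (Word N) := tick do
  let r ← rev w []
  let p ← strip w r []
  let r' ← rev p.1 []
  let r'' ← dropLen p.2 r'
  rev r'' []

/-- The cyclically reduced form of the image of a word under the substitution `f`. -/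
def image {N : ℕ} (f : Letter N → Word N) (w : Word N) : Timed (Word N) := tick do
  let r ← subst f w []
  let w' ← rev r []
  cycReduce w'

/-- Is the first word strictly shorter than the second one? -/
def shorter {N : ℕ} : Word N → Word N → Timed Bool
  | _ :: u, _ :: v => tick (shorter u v)
  | [], _ :: _ => tick (pure true)
  | _, [] => tick (pure false)

/-- Do the two words have the same length? -/
def sameLen {N : ℕ} : Word N → Word N → Timed Bool
  | _ :: u, _ :: v => tick (sameLen u v)
  | [], [] => tick (pure true)
  | [], _ :: _ => tick (pure false)
  | _ :: _, [] => tick (pure false)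

/-- Concatenation of words. -/
def append {N : ℕ} : Word N → Word N → Timed (Word N)
  | [], v => tick (pure v)
  | x :: u, v => tick do
      let r ← append u v
      pure (x :: r)

/-- A reading position in a cyclic word `u` of length `n`. `base` is the rotation of `u` that is
being read, as a suffix of `u u`, and `scan` is its part that has not been read yet; `baseLeft`
and `scanLeft` are the corresponding suffixes of `u` itself, so that `baseLeft` is empty once all
`n` rotations have been discarded. -/
structure Cursor (N : ℕ) where
  base : Word N
  scan : Word N
  baseLeft : Word N
  scanLeft : Word N

/-- Read one letter. -/
def Cursor.read {N : ℕ} (p : Cursor N) : Cursor N :=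
  ⟨p.base, p.scan.tail, p.baseLeft, p.scanLeft.tail⟩

/-- Go back to the first letter of the present rotation. -/
def Cursor.reset {N : ℕ} (p : Cursor N) : Cursor N :=
  ⟨p.base, p.base, p.baseLeft, p.baseLeft⟩

/-- Discard all rotations that start at a letter read so far, including the present one. -/
def Cursor.skip {N : ℕ} (p : Cursor N) : Cursor N :=
  ⟨p.scan.tail, p.scan.tail, p.scanLeft.tail, p.scanLeft.tail⟩

/-- Compare two cyclic words of the same length by discarding rotations that cannot be least in the
lexicographic order. `full` is one of the words, and the list `left` has one entry for each letter
that still has to agree for the present two rotations to be equal. The first list bounds the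
number of rounds. -/
def cycEqLoop {N : ℕ} (full : Word N) :
    Word N → Word N → Cursor N → Cursor N → Timed Bool
  | [], left, _, _ => tick (pure left.isEmpty)
  | _ :: fuel, left, p, q => tick (
      if left.isEmpty then pure true
      else if p.baseLeft.isEmpty || q.baseLeft.isEmpty then pure false
      else match p.scan, q.scan with
        | x :: _, y :: _ =>
            if x = y then cycEqLoop full fuel left.tail p.read q.read
            else if before y x then cycEqLoop full fuel full p.skip q.reset
            else cycEqLoop full fuel full p.reset q.skip
        | _, _ => pure false)

/-- Are two words of the same length `n` cyclic permutations of each other? Every round of the main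
loop increases the sum of the two starting positions and of the number of agreeing letters,
so that `3 n` rounds suffice. -/
def cycEq {N : ℕ} (u v : Word N) : Timed Bool := tick do
  let uu ← append u u
  let vv ← append v v
  let uuu ← append u uu
  cycEqLoop u uuu u ⟨uu, uu, u, u⟩ ⟨vv, vv, v, v⟩

/-- Is the cyclic word `v` in a list of cyclic words of the same length? -/
def mem {N : ℕ} (v : Word N) : List (Word N) → Timed Bool
  | [] => tick (pure false)
  | u :: T => tick do
      let b ← cycEq u v
      if b then pure true else mem v T

/-! ### Whitehead's algorithm

A conjugacy class is given by a cyclically reduced word, and an automorphism by the table of the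
images of the letters. -/

/-- The table of an automorphism. -/
def table {N : ℕ} (τ : MulAut (F N)) : Letter N → Word N := fun x => (τ (elt x)).toWord

/-- Look for the first move that decreases the cyclically reduced length. -/
def findShorter {N : ℕ} (w : Word N) : List (Letter N → Word N) → Timed (Option (Word N))
  | [] => tick (pure none)
  | f :: fs => tick do
      let v ← image f w
      let b ← shorter v w
      if b then pure (some v) else findShorter w fs

/-- One round of the minimization process. -/
def minStep {N : ℕ} (fs : List (Letter N → Word N)) (w : Word N) :
    Timed (Word N ⊕ Word N) := tick do
  let r ← findShorter w fs
  match r with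
  | some v => pure (Sum.inl v)
  | none => pure (Sum.inr w)

/-- The Whitehead minimization algorithm on a freely reduced word. -/
def minimization {N : ℕ} (fs : List (Letter N → Word N)) (w : Word N) : Comp (Word N) := do
  let w₁ ← (cycReduce w).run
  loop (minStep fs) w₁

/-- Add to `T` the classes of the same length as `u` that one move makes of `u`; the Boolean
records whether a new class has been found. -/
def expandWord {N : ℕ} (u : Word N) :
    List (Letter N → Word N) → List (Word N) → Bool → Timed (List (Word N) × Bool)
  | [], T, grew => tick (pure (T, grew))
  | f :: fs, T, grew => tick do
      let v ← image f u
      let b ← sameLen v u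
      if b then
        let m ← mem v T
        if m then expandWord u fs T grew else expandWord u fs (v :: T) true
      else expandWord u fs T grew

/-- Do this for all members of a list. -/
def expand {N : ℕ} (fs : List (Letter N → Word N)) :
    List (Word N) → List (Word N) → Bool → Timed (List (Word N) × Bool)
  | [], T, grew => tick (pure (T, grew))
  | u :: us, T, grew => tick do
      let p ← expandWord u fs T grew
      expand fs us p.1 p.2

/-- One round `S_i ↦ S_{i+1}` of the stabilization process; it stops when `S_{i+1} = S_i`. -/
def stabStep {N : ℕ} (fs : List (Letter N → Word N)) (S : List (Word N)) :
    Timed (List (Word N) ⊕ List (Word N)) := tick do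
  let p ← expand fs S S false
  if p.2 then pure (Sum.inl p.1) else pure (Sum.inr S)

/-- The Whitehead stabilization algorithm. -/
def stabilization {N : ℕ} (fs : List (Letter N → Word N)) (u : Word N) : Comp (List (Word N)) :=
  loop (stabStep fs) [u]

/-- The second half of Whitehead's algorithm, on two minimized cyclic words. -/
def compareMinimal {N : ℕ} (fs : List (Letter N → Word N)) (u u' : Word N) : Comp Bool := do
  let b ← (sameLen u u').run
  if b then
    let S ← stabilization fs u
    (mem u' S).run
  else pure false

/-- Whitehead's algorithm on two freely reduced words. -/
def whitehead {N : ℕ} (fs : List (Letter N → Word N)) (w w' : Word N) : Comp Bool := do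
  let u ← minimization fs w
  let u' ← minimization fs w'
  compareMinimal fs u u'

/-- The cyclically reduced images of `w` under the auxiliary automorphisms. -/
def images {N : ℕ} (w : Word N) : List (Letter N → Word N) → Timed (List (Word N))
  | [] => tick (pure [])
  | g :: gs => tick do
      let v ← image g w
      let vs ← images w gs
      pure (v :: vs)

/-- One round of the minimization process on several cyclic words in parallel: every word is
replaced by a shorter one, until one is found that no move makes shorter. -/
def parRound {N : ℕ} (fs : List (Letter N → Word N)) :
    List (Word N) → Timed (List (Word N) ⊕ Word N)
  | [] => tick (pure (Sum.inl []))
  | w :: ws => tick do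
      let r ← findShorter w fs
      match r with
      | none => pure (Sum.inr w)
      | some v =>
          let rest ← parRound fs ws
          match rest with
          | Sum.inl vs => pure (Sum.inl (v :: vs))
          | Sum.inr u => pure (Sum.inr u)

/-- The speed-up of the minimization algorithm by the auxiliary automorphisms `gs`. -/
def minimizationSpeedUp {N : ℕ} (fs gs : List (Letter N → Word N)) (w : Word N) :
    Comp (Word N) := do
  let w₁ ← (cycReduce w).run
  let ws ← (images w₁ gs).run
  loop (parRound fs) (w₁ :: ws)

/-- The speed-up of Whitehead's algorithm by the auxiliary automorphisms `gs`. -/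
def whiteheadSpeedUp {N : ℕ} (fs gs : List (Letter N → Word N)) (w w' : Word N) :
    Comp Bool := do
  let u ← minimizationSpeedUp fs gs w
  let u' ← minimizationSpeedUp fs gs w'
  compareMinimal fs u u'

/-- The computation `m` terminates within `T` steps, with a result that satisfies `P`. -/
def TerminatesWithin {α : Type} (m : Comp α) (T : ℕ) (P : α → Prop) : Prop :=
  ∃ a t, m a t ∧ t ≤ T ∧ P a

/-- `Out(F_N)[u] = Out(F_N)[v]`. -/
def SameOrbit {N : ℕ} (u v : F N) : Prop :=
  MulAction.orbit (Out N) (cls u) = MulAction.orbit (Out N) (cls v)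

end Whitehead

/-!
# Whitehead's algorithm on minimal classes

The running time bounds rest on two theorems of Whitehead, `len_le_of_forall_whitehead` and
`exists_level_path`: a conjugacy class that no Whitehead automorphism makes shorter is shortest in
its orbit, and any two shortest classes of an orbit are connected by Whitehead automorphisms that
keep the length.

Both follow from `compare_bases`, a version of surgery on sphere systems that is carried out with
almost invariant subsets of `F_N`. The edges of the Cayley tree of a basis `α(A)` cut `F_N` into
half-spaces, and the length of a class with respect to `α(A)` is the sum of the weights of these
half-spaces, where the weight counts how often the axes of the class are cut; it is computed as a
growth rate, with a limit along an ultrafilter. A Whitehead automorphism replaces one half-space by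
a union of half-spaces at a vertex (`act_wh_H_self`), and so changes the length by a difference of two
weights (`len_wh`). If half-spaces of two bases cross, then an innermost half-space can be replaced
by a corner (`surgery_step`): depending on which of the two systems has the lightest disc, this
makes the class strictly shorter for the first basis, or removes crossings from the second basis without
making the class longer. Ties go to the second basis, so that no perturbation of the weights is
needed. If there are no crossings, half-spaces are exchanged one by one (`exchange_step`), with a
parity argument in place of a count of intersections. If all half-spaces agree, then the bases agree
up to conjugation and a permutation of the letters (`exists_firstKind`).

The gap in the definition of a minimizing set `S` shows that a class of the orbit that is not longer
than some member of `S` is itself in `S` (`IsMinimizing.smul_mem`). Hence from a class in `S` at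
most `M` successive moves can decrease the length, and the orbit has at most `M` minimal classes. Each
round of the minimization process takes linear time, so that it takes linear time in total on such
classes, and quadratic time in general, where the length bounds the number of rounds. In the
speed-up one of the two parallel runs ends after at most `M` rounds. The stabilization process takes
at most `M + 1` rounds, because every round but the last finds a new minimal class, and each round
compares boundedly many cyclic words. Such a comparison takes linear time: rotations that are not
lexicographically least are discarded (`cycEqLoop_spec`).
-/

namespace Whitehead

open Filter Topology

/-! ### Letters and reduced words -/

theorem inv_inv' {N : ℕ} (x : Letter N) : inv (inv x) = x := by simp [inv]

theorem inv_ne {N : ℕ} (x : Letter N) : inv x ≠ x := by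
  intro h
  have := congrArg Prod.snd h
  simp [inv] at this

theorem inv_injective {N : ℕ} : Function.Injective (inv : Letter N → Letter N) := fun x y h => by
  rw [← inv_inv' x, h, inv_inv']

theorem inv_eq_iff {N : ℕ} {x y : Letter N} : inv x = y ↔ x = inv y :=
  ⟨fun h => by rw [← h, inv_inv'], fun h => by rw [h, inv_inv']⟩

theorem elt_inv {N : ℕ} (x : Letter N) : elt (inv x) = (elt x)⁻¹ := by
  simp [elt, inv, FreeGroup.inv_mk, FreeGroup.invRev]

theorem toWord_elt {N : ℕ} (x : Letter N) : (elt x).toWord = [x] := by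
  simp [elt, FreeGroup.toWord_mk]

theorem elt_ne_one {N : ℕ} (x : Letter N) : elt x ≠ 1 := by
  intro h
  have := congrArg FreeGroup.toWord h
  simp at this

/-- The condition on neighbouring letters of a reduced word. -/
theorem ne_inv_iff {N : ℕ} {x y : Letter N} : y ≠ inv x ↔ (x.1 = y.1 → x.2 = y.2) := by
  obtain ⟨i, a⟩ := x
  obtain ⟨j, b⟩ := y
  cases a <;> cases b <;> simp [inv, eq_comm]

theorem isReduced_append {N : ℕ} {u v : Word N} :
    FreeGroup.IsReduced (u ++ v) ↔ FreeGroup.IsReduced u ∧ FreeGroup.IsReduced v ∧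
      ∀ x ∈ u.getLast?, ∀ y ∈ v.head?, y ≠ inv x := by
  simp only [FreeGroup.IsReduced, List.isChain_append, ne_inv_iff]

theorem toWord_mul_of {N : ℕ} (g h : F N)
    (hc : ∀ x ∈ g.toWord.getLast?, ∀ y ∈ h.toWord.head?, y ≠ inv x) :
    (g * h).toWord = g.toWord ++ h.toWord := by
  rw [FreeGroup.toWord_mul]
  exact (isReduced_append.2
    ⟨FreeGroup.isReduced_toWord, FreeGroup.isReduced_toWord, hc⟩).reduce_eq

theorem getLast?_toWord_inv {N : ℕ} (g : F N) (x : Letter N) :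
    g.toWord.getLast? = some x ↔ (g⁻¹).toWord.head? = some (inv x) := by
  rw [FreeGroup.toWord_inv, FreeGroup.invRev]
  rw [List.head?_reverse, List.getLast?_map]
  cases h : g.toWord.getLast? with
  | none => simp
  | some y =>
    simp only [Option.some.injEq, Option.map_some]
    exact (inv_injective.eq_iff (a := y) (b := x)).symm

/-! ### Half-spaces -/

/-- The half-space `H x` of the Cayley tree of `F_N`: all elements whose reduced word starts
with the letter `x`. -/
def H {N : ℕ} (x : Letter N) : Set (F N) := {g | g.toWord.head? = some x}

theorem mem_H {N : ℕ} {x : Letter N} {g : F N} : g ∈ H x ↔ g.toWord.head? = some x := Iff.rfl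

theorem one_notMem_H {N : ℕ} (x : Letter N) : (1 : F N) ∉ H x := by simp [mem_H]

theorem elt_mem_H {N : ℕ} {x y : Letter N} : elt x ∈ H y ↔ x = y := by
  rw [mem_H, toWord_elt]; simp

theorem H_disjoint {N : ℕ} {x y : Letter N} {g : F N} (hx : g ∈ H x) (hy : g ∈ H y) : x = y := by
  rw [mem_H] at hx hy
  simpa [hx] using hy

theorem exists_mem_H {N : ℕ} {g : F N} (hg : g ≠ 1) : ∃ x, g ∈ H x := by
  cases h : g.toWord with
  | nil => exact absurd (FreeGroup.toWord_eq_nil_iff.1 h) hg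
  | cons x w => exact ⟨x, by simp [mem_H, h]⟩

/-- Concatenation without cancellation. -/
theorem toWord_mul_of_H {N : ℕ} (g h : F N) (hc : ∀ x, g⁻¹ ∈ H x → h ∉ H x) :
    (g * h).toWord = g.toWord ++ h.toWord := by
  refine toWord_mul_of g h fun x hx y hy he => ?_
  rw [Option.mem_def] at hx hy
  exact hc (inv x) ((getLast?_toWord_inv g x).1 hx) (by rw [mem_H, hy, he])

theorem mul_mem_H {N : ℕ} {g h : F N} {z : Letter N} (hg : g ∈ H z)
    (hc : ∀ x, g⁻¹ ∈ H x → h ∉ H x) : g * h ∈ H z := by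
  rw [mem_H, toWord_mul_of_H g h hc, List.head?_append, mem_H.1 hg]
  rfl

theorem toWord_elt_mul {N : ℕ} {x : Letter N} {g : F N} (h : g ∉ H (inv x)) :
    (elt x * g).toWord = x :: g.toWord := by
  rw [toWord_mul_of_H, toWord_elt]
  · rfl
  · intro y hy
    rw [← elt_inv, elt_mem_H] at hy
    rwa [← hy]

theorem elt_mul_mem_H {N : ℕ} {x : Letter N} {g : F N} (h : g ∉ H (inv x)) : elt x * g ∈ H x := by
  rw [mem_H, toWord_elt_mul h]; rfl

theorem mem_H_iff {N : ℕ} {x : Letter N} {g : F N} : g ∈ H x ↔ (elt x)⁻¹ * g ∉ H (inv x) := by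
  constructor
  · intro h
    obtain ⟨w, hw⟩ : ∃ w, g.toWord = x :: w := by
      rw [mem_H] at h
      cases hg : g.toWord with
      | nil => simp [hg] at h
      | cons y w => simp [hg] at h; exact ⟨w, by rw [h]⟩
    have hr : FreeGroup.IsReduced (x :: w) := hw ▸ FreeGroup.isReduced_toWord
    have hg : g = elt x * FreeGroup.mk w := by
      rw [← FreeGroup.mk_toWord (x := g), hw]; simp [elt, FreeGroup.mul_mk]
    have hw' : (FreeGroup.mk w).toWord = w := by
      rw [FreeGroup.toWord_mk]
      exact (hr.infix ⟨[x], [], by simp⟩).reduce_eq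
    rw [hg, inv_mul_cancel_left, mem_H, hw']
    intro hh
    have := (isReduced_append (u := [x]) (v := w)).1 hr
    exact this.2.2 x (by simp) (inv x) hh rfl
  · intro h
    have := elt_mul_mem_H h
    rwa [mul_inv_cancel_left] at this

theorem inv_mul_mem_H_inv {N : ℕ} {x : Letter N} {g : F N} :
    (elt x)⁻¹ * g ∈ H (inv x) ↔ g ∉ H x := by
  rw [mem_H_iff (g := g), not_not]

theorem norm_elt_mul {N : ℕ} {x : Letter N} {g : F N} (h : g ∉ H (inv x)) :
    (elt x * g).norm = g.norm + 1 := by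
  rw [FreeGroup.norm, toWord_elt_mul h]; rfl

theorem norm_inv_elt_mul {N : ℕ} {x : Letter N} {g : F N} (h : g ∈ H x) :
    ((elt x)⁻¹ * g).norm + 1 = g.norm := by
  rw [← norm_elt_mul (mem_H_iff.1 h), mul_inv_cancel_left]

/-- Induction on reduced words by adding letters on the left. -/
theorem left_induction {N : ℕ} {p : F N → Prop} (one : p 1)
    (mul : ∀ x g, g ∉ H (inv x) → p g → p (elt x * g)) (g : F N) : p g := by
  induction hn : g.norm generalizing g with
  | zero => rwa [FreeGroup.norm_eq_zero.1 hn]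
  | succ n ih =>
    have hg : g ≠ 1 := by rintro rfl; simp at hn
    obtain ⟨x, hx⟩ := exists_mem_H hg
    have := mul x ((elt x)⁻¹ * g) (mem_H_iff.1 hx)
      (ih _ (by have := norm_inv_elt_mul hx; omega))
    rwa [mul_inv_cancel_left] at this

/-- Multiplication by a letter on the right changes the first letter only next to the root. -/
theorem mul_elt_mem_H {N : ℕ} {x z : Letter N} {g : F N} (h1 : g ≠ 1) (h2 : g * elt z ≠ 1) :
    g * elt z ∈ H x ↔ g ∈ H x := by
  by_cases hz : g⁻¹ ∈ H z
  · have h3 : ∀ y, (g * elt z)⁻¹ ∈ H y → elt (inv z) ∉ H y := by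
      intro y hy hy'
      rw [elt_mem_H] at hy'
      subst hy'
      rw [mul_inv_rev, inv_mul_mem_H_inv] at hy
      exact hy hz
    obtain ⟨y, hy⟩ := exists_mem_H h2
    have h4 := mul_mem_H hy h3
    rw [elt_inv, mul_inv_cancel_right] at h4
    constructor
    · intro hx; rwa [H_disjoint hx hy]
    · intro hx; rwa [H_disjoint hx h4]
  · have h3 : ∀ y, g⁻¹ ∈ H y → elt z ∉ H y := by
      intro y hy hy'
      rw [elt_mem_H] at hy'
      subst hy'
      exact hz hy
    obtain ⟨y, hy⟩ := exists_mem_H h1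
    have h4 := mul_mem_H hy h3
    constructor
    · intro hx; rwa [H_disjoint hx h4]
    · intro hx; rwa [H_disjoint hx hy]

/-- Almost invariant sets: right translations change only finitely many members. -/
def AI {N : ℕ} (S : Set (F N)) : Prop := ∀ k, ∀ᶠ h in cofinite, (h * k ∈ S ↔ h ∈ S)

theorem eventually_mul_right {N : ℕ} {p : F N → Prop} (k : F N) (hp : ∀ᶠ h in cofinite, p h) :
    ∀ᶠ h in cofinite, p (h * k) :=
  (mul_left_injective k).tendsto_cofinite.eventually hp

theorem AI_of_letters {N : ℕ} {S : Set (F N)}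
    (h : ∀ x : Letter N, ∀ᶠ h in cofinite, (h * elt x ∈ S ↔ h ∈ S)) : AI S := by
  intro k
  induction k using left_induction with
  | one => simp
  | mul x g _ ih =>
    filter_upwards [h x, eventually_mul_right (elt x) ih] with y h1 h2
    rw [← mul_assoc, h2, h1]

theorem AI_H {N : ℕ} (x : Letter N) : AI (H x) := by
  refine AI_of_letters fun z => ?_
  filter_upwards [(Set.finite_singleton (1 : F N)).compl_mem_cofinite,
    (Set.finite_singleton ((elt z)⁻¹)).compl_mem_cofinite] with h h1 h2
  refine mul_elt_mem_H h1 fun he => h2 ?_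
  exact eq_inv_of_mul_eq_one_left he

/-- The image `g α(S)` of a set under an automorphism and a left translation. -/
def act {N : ℕ} (α : MulAut (F N)) (g : F N) (S : Set (F N)) : Set (F N) :=
  {h | α⁻¹ (g⁻¹ * h) ∈ S}

theorem mem_act {N : ℕ} {α : MulAut (F N)} {g h : F N} {S : Set (F N)} :
    h ∈ act α g S ↔ α⁻¹ (g⁻¹ * h) ∈ S := Iff.rfl

theorem act_act {N : ℕ} (α β : MulAut (F N)) (g k : F N) (S : Set (F N)) :
    act α g (act β k S) = act (α * β) (g * α k) S := by
  ext h
  simp [mem_act, mul_assoc, MulAut.inv_def]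

theorem act_one {N : ℕ} (S : Set (F N)) : act 1 1 S = S := by
  ext h; simp [mem_act]

theorem act_compl {N : ℕ} (α : MulAut (F N)) (g : F N) (S : Set (F N)) :
    act α g Sᶜ = (act α g S)ᶜ := rfl

theorem act_inter {N : ℕ} (α : MulAut (F N)) (g : F N) (S T : Set (F N)) :
    act α g (S ∩ T) = act α g S ∩ act α g T := rfl

theorem act_inv_act {N : ℕ} (α : MulAut (F N)) (g : F N) (S : Set (F N)) :
    act α⁻¹ (α⁻¹ g⁻¹) (act α g S) = S := by
  rw [act_act]
  simp [act_one]

theorem AI.act {N : ℕ} {S : Set (F N)} (hS : AI S) (α : MulAut (F N)) (g : F N) :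
    AI (act α g S) := by
  intro k
  have hinj : Function.Injective fun h : F N => α⁻¹ (g⁻¹ * h) :=
    (α⁻¹).injective.comp (mul_right_injective _)
  filter_upwards [hinj.tendsto_cofinite.eventually (hS (α⁻¹ k))] with h hh
  rw [mem_act, mem_act, ← hh, ← map_mul, mul_assoc]

theorem AI.inter {N : ℕ} {S T : Set (F N)} (hS : AI S) (hT : AI T) : AI (S ∩ T) := fun k => by
  filter_upwards [hS k, hT k] with h hh hh'
  simp [hh, hh']

theorem eventually_act {N : ℕ} {p : F N → Prop} (α : MulAut (F N)) (g : F N) :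
    (∀ᶠ h in cofinite, p (α⁻¹ (g⁻¹ * h))) ↔ ∀ᶠ h in cofinite, p h := by
  have hinj : Function.Injective fun h : F N => α⁻¹ (g⁻¹ * h) :=
    (α⁻¹).injective.comp (mul_right_injective _)
  have hinj' : Function.Injective fun h : F N => g * α h :=
    (mul_right_injective _).comp α.injective
  constructor
  · intro h
    filter_upwards [hinj'.tendsto_cofinite.eventually h] with k hk
    simpa [MulAut.inv_def] using hk
  · intro h
    exact hinj.tendsto_cofinite.eventually h

theorem frequently_act {N : ℕ} {p : F N → Prop} (α : MulAut (F N)) (g : F N) :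
    (∃ᶠ h in cofinite, p (α⁻¹ (g⁻¹ * h))) ↔ ∃ᶠ h in cofinite, p h := by
  rw [Filter.Frequently, Filter.Frequently, eventually_act (p := fun h => ¬ p h) α g]

/-- The half-spaces `g α(H x)` of the Cayley tree of the basis `α(A)`. -/
def half {N : ℕ} (α : MulAut (F N)) : Set (Set (F N)) := {P | ∃ g x, P = act α g (H x)}

theorem act_H_mem_half {N : ℕ} (α : MulAut (F N)) (g : F N) (x : Letter N) :
    act α g (H x) ∈ half α := ⟨g, x, rfl⟩

theorem compl_act_H {N : ℕ} (α : MulAut (F N)) (g : F N) (x : Letter N) :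
    (act α g (H x))ᶜ = act α (g * α (elt x)) (H (inv x)) := by
  ext h
  have e : α⁻¹ ((g * α (elt x))⁻¹ * h) = (elt x)⁻¹ * α⁻¹ (g⁻¹ * h) := by
    simp [mul_assoc, MulAut.inv_def]
  rw [Set.mem_compl_iff, mem_act, mem_act, ← inv_mul_mem_H_inv, e]

theorem half_compl {N : ℕ} {α : MulAut (F N)} {P : Set (F N)} (hP : P ∈ half α) :
    Pᶜ ∈ half α := by
  obtain ⟨g, x, rfl⟩ := hP
  exact ⟨_, _, compl_act_H α g x⟩

theorem half_act {N : ℕ} {α : MulAut (F N)} {P : Set (F N)} (hP : P ∈ half α)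
    (β : MulAut (F N)) (g : F N) : act β g P ∈ half (β * α) := by
  obtain ⟨k, x, rfl⟩ := hP
  exact ⟨_, _, act_act _ _ _ _ _⟩

theorem half_AI {N : ℕ} {α : MulAut (F N)} {P : Set (F N)} (hP : P ∈ half α) : AI P := by
  obtain ⟨k, x, rfl⟩ := hP
  exact (AI_H x).act α k

/-- A half-space that does not contain the root lies behind one letter. -/
theorem half_subset_H {N : ℕ} {P : Set (F N)} (hP : P ∈ half (1 : MulAut (F N)))
    (h1 : (1 : F N) ∉ P) : ∃ z, P ⊆ H z := by
  obtain ⟨g, x, rfl⟩ := hP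
  have h1' : g⁻¹ ∉ H x := by simpa [mem_act] using h1
  by_cases hg : g = 1
  · subst hg
    exact ⟨x, fun h hh => by simpa [mem_act] using hh⟩
  · obtain ⟨z, hz⟩ := exists_mem_H hg
    refine ⟨z, fun h hh => ?_⟩
    have hh' : g⁻¹ * h ∈ H x := by simpa [mem_act] using hh
    have := mul_mem_H (h := g⁻¹ * h) hz (fun y hy hy' => h1' (by rwa [H_disjoint hh' hy']))
    rwa [mul_inv_cancel_left] at this

theorem frequently_H {N : ℕ} (x : Letter N) : ∃ᶠ h in cofinite, h ∈ H x := by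
  rw [frequently_cofinite_mem_iff_infinite]
  have hw (n : ℕ) : ((elt x) ^ n).toWord = List.replicate n x := by
    induction n with
    | zero => simp
    | succ n ih =>
      rw [pow_succ', toWord_elt_mul, ih, List.replicate_succ]
      rw [mem_H, ih]
      cases n with
      | zero => simp
      | succ n => simpa [List.replicate_succ] using (inv_ne x).symm
  refine Set.infinite_of_injective_forall_mem (f := fun n : ℕ => elt x ^ (n + 1)) ?_ ?_
  · intro m n h
    have := congrArg (fun g => g.toWord.length) h
    simpa [hw] using this
  · intro n
    rw [mem_H, hw]
    rfl

/-- Two sets cross if all four corners are infinite. -/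
def Cross {N : ℕ} (P Q : Set (F N)) : Prop :=
  (∃ᶠ h in cofinite, h ∈ P ∧ h ∈ Q) ∧ (∃ᶠ h in cofinite, h ∈ P ∧ h ∉ Q) ∧
    (∃ᶠ h in cofinite, h ∉ P ∧ h ∈ Q) ∧ (∃ᶠ h in cofinite, h ∉ P ∧ h ∉ Q)

theorem Cross.symm {N : ℕ} {P Q : Set (F N)} (h : Cross P Q) : Cross Q P := by
  obtain ⟨h1, h2, h3, h4⟩ := h
  exact ⟨h1.mono fun _ => And.symm, h3.mono fun _ => And.symm, h2.mono fun _ => And.symm,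
    h4.mono fun _ => And.symm⟩

theorem Cross.compl_left {N : ℕ} {P Q : Set (F N)} (h : Cross P Q) : Cross Pᶜ Q := by
  obtain ⟨h1, h2, h3, h4⟩ := h
  refine ⟨h3, h4, ?_, ?_⟩ <;> simpa

theorem Cross.compl_right {N : ℕ} {P Q : Set (F N)} (h : Cross P Q) : Cross P Qᶜ :=
  h.symm.compl_left.symm

theorem cross_act {N : ℕ} (α : MulAut (F N)) (g : F N) {P Q : Set (F N)} :
    Cross (act α g P) (act α g Q) ↔ Cross P Q := by
  simp only [Cross, mem_act]
  rw [frequently_act (p := fun h => h ∈ P ∧ h ∈ Q), frequently_act (p := fun h => h ∈ P ∧ h ∉ Q),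
    frequently_act (p := fun h => h ∉ P ∧ h ∈ Q), frequently_act (p := fun h => h ∉ P ∧ h ∉ Q)]

theorem Cross.congr {N : ℕ} {P P' Q : Set (F N)} (h : Cross P Q)
    (hP : ∀ᶠ h in cofinite, (h ∈ P ↔ h ∈ P')) : Cross P' Q := by
  obtain ⟨h1, h2, h3, h4⟩ := h
  refine ⟨(h1.and_eventually hP).mono ?_, (h2.and_eventually hP).mono ?_,
    (h3.and_eventually hP).mono ?_, (h4.and_eventually hP).mono ?_⟩ <;>
  · rintro _ ⟨⟨ha, hb⟩, hc⟩
    exact ⟨by tauto, hb⟩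

/-- Half-spaces of the same tree do not cross. -/
theorem not_cross_H {N : ℕ} {P : Set (F N)} (hP : P ∈ half (1 : MulAut (F N))) (x : Letter N) :
    ¬ Cross P (H x) := by
  have key : ∀ P ∈ half (1 : MulAut (F N)), (1 : F N) ∉ P → ¬ Cross P (H x) := by
    intro P hP h1 ⟨h1, h2, _, _⟩
    obtain ⟨z, hz⟩ := half_subset_H hP ‹_›
    by_cases hzx : z = x
    · obtain ⟨h, hh, hh'⟩ := h2.exists
      exact hh' (hzx ▸ hz hh)
    · obtain ⟨h, hh, hh'⟩ := h1.exists
      exact hzx (H_disjoint (hz hh) hh')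
  by_cases h1 : (1 : F N) ∈ P
  · intro h
    exact key _ (half_compl hP) (fun h => h h1) h.compl_left
  · exact key P hP h1

theorem not_cross_half {N : ℕ} {α : MulAut (F N)} {P Q : Set (F N)} (hP : P ∈ half α)
    (hQ : Q ∈ half α) : ¬ Cross P Q := by
  obtain ⟨g, x, rfl⟩ := hQ
  rw [← cross_act α⁻¹ (α⁻¹ g⁻¹), act_inv_act]
  have := half_act hP α⁻¹ (α⁻¹ g⁻¹)
  rw [inv_mul_cancel] at this
  exact not_cross_H this x

/-! ### Cut functions -/

/-- The elements `h` for which `S` separates the pair `(h, h k)`. -/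
def sepSet {N : ℕ} (k : F N) (S : Set (F N)) : Set (F N) := {h | ¬ (h ∈ S ↔ h * k ∈ S)}

/-- The number of pairs `(h, h k)` that `S` separates. It is finite if `S` is almost invariant. -/
noncomputable def cut {N : ℕ} (k : F N) (S : Set (F N)) : ℕ := (sepSet k S).ncard

theorem sepSet_finite {N : ℕ} {S : Set (F N)} (hS : AI S) (k : F N) : (sepSet k S).Finite := by
  have := hS k
  rw [eventually_cofinite] at this
  refine this.subset fun h hh => ?_
  simp only [sepSet, Set.mem_ofPred_eq] at hh ⊢
  tauto

theorem ncard_eq_sum {N : ℕ} {p : F N → Prop} [DecidablePred p] {T : Finset (F N)}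
    (hT : ∀ h, p h → h ∈ T) : {h | p h}.ncard = ∑ h ∈ T, if p h then 1 else 0 := by
  rw [← Finset.card_filter, ← Set.ncard_coe_finset]
  congr 1
  ext h
  simp only [Set.mem_ofPred_eq, Finset.coe_filter]
  exact ⟨fun hh => ⟨hT h hh, hh⟩, fun hh => hh.2⟩

theorem ncard_preimage_act {N : ℕ} (α : MulAut (F N)) (g : F N) (S : Set (F N)) :
    (act α g S).ncard = S.ncard := by
  have : act α g S = (fun h => g * α h) '' S := by
    ext h
    constructor
    · intro hh
      exact ⟨_, hh, by simp [MulAut.inv_def]⟩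
    · rintro ⟨k, hk, rfl⟩
      simpa [mem_act, MulAut.inv_def] using hk
  rw [this]
  exact Set.ncard_image_of_injective _ ((mul_right_injective _).comp α.injective)

theorem ncard_mul_right {N : ℕ} (k : F N) (S : Set (F N)) : {h | h * k ∈ S}.ncard = S.ncard := by
  have : {h | h * k ∈ S} = (fun h => h * k⁻¹) '' S := by
    ext h
    constructor
    · intro hh
      exact ⟨_, hh, mul_inv_cancel_right _ _⟩
    · rintro ⟨h', hh', rfl⟩
      change h' * k⁻¹ * k ∈ S
      rwa [inv_mul_cancel_right]
  rw [this, Set.ncard_image_of_injective _ (mul_left_injective _)]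

theorem act_inv_mul {N : ℕ} (α : MulAut (F N)) (g h k : F N) :
    α⁻¹ (g⁻¹ * (h * k)) = α⁻¹ (g⁻¹ * h) * α⁻¹ k := by
  rw [← map_mul, mul_assoc]

theorem cut_act {N : ℕ} (α : MulAut (F N)) (g k : F N) (S : Set (F N)) :
    cut k (act α g S) = cut (α⁻¹ k) S := by
  rw [cut, cut, ← ncard_preimage_act α g (sepSet (α⁻¹ k) S)]
  congr 1
  ext h
  simp only [sepSet, mem_act, Set.mem_ofPred_eq, act_inv_mul]

theorem cut_compl {N : ℕ} (k : F N) (S : Set (F N)) : cut k Sᶜ = cut k S := by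
  rw [cut, cut]
  congr 1
  ext h
  simp only [sepSet, Set.mem_compl_iff, Set.mem_ofPred_eq]
  tauto

theorem cut_mul_le {N : ℕ} {S : Set (F N)} (hS : AI S) (k l : F N) :
    cut (k * l) S ≤ cut k S + cut l S := by
  have e : cut l S = {h | h * k ∈ sepSet l S}.ncard := (ncard_mul_right k _).symm
  rw [e, cut, cut]
  refine le_trans (Set.ncard_le_ncard ?_ (Set.Finite.union (sepSet_finite hS k) ?_))
    (Set.ncard_union_le _ _)
  · intro h hh
    simp only [sepSet, Set.mem_union, Set.mem_ofPred_eq] at hh ⊢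
    rw [mul_assoc]
    tauto
  · exact (sepSet_finite hS l).preimage (mul_left_injective k).injOn

theorem cut_one {N : ℕ} (S : Set (F N)) : cut 1 S = 0 := by simp [cut, sepSet]

theorem cut_pow_le {N : ℕ} {S : Set (F N)} (hS : AI S) (k : F N) (n : ℕ) :
    cut (k ^ n) S ≤ n * cut k S := by
  induction n with
  | zero => simp [cut_one]
  | succ n ih =>
    rw [pow_succ, Nat.succ_mul]
    exact (cut_mul_le hS _ _).trans (by omega)

theorem sepSet_elt_H {N : ℕ} (x a : Letter N) (h : F N) :
    h ∈ sepSet (elt x) (H a) ↔ (h = 1 ∧ x = a) ∨ (h = (elt x)⁻¹ ∧ inv x = a) := by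
  simp only [sepSet, Set.mem_ofPred_eq]
  have e1 := elt_ne_one x
  have e2 := elt_mem_H (x := x) (y := a)
  have e3 := elt_mem_H (x := inv x) (y := a)
  have e4 := one_notMem_H a
  have e5 : h ≠ 1 → h * elt x ≠ 1 → (h * elt x ∈ H a ↔ h ∈ H a) := mul_elt_mem_H
  rw [elt_inv] at e3
  generalize elt x = y at *
  by_cases h1 : h = 1
  · subst h1
    simp only [e4, one_mul, e2, true_and, eq_comm (a := (1 : F N)), inv_eq_one, e1, false_and,
      or_false, false_iff, not_not]
  by_cases h2 : h = y⁻¹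
  · subst h2
    simp [e4, e3, e1]
  · rw [e5 h1 fun he => h2 (eq_inv_of_mul_eq_one_left he)]
    simp [h1, h2]

theorem cut_elt_mul_H {N : ℕ} (x a : Letter N) {g : F N} (hg : g ∉ H (inv x)) :
    cut (elt x * g) (H a) = cut g (H a) + if x.1 = a.1 then 1 else 0 := by
  have hfin : {h | h * elt x ∈ sepSet g (H a)}.Finite :=
    (sepSet_finite (AI_H a) g).preimage (mul_left_injective _).injOn
  have e : cut g (H a) = {h | h * elt x ∈ sepSet g (H a)}.ncard := (ncard_mul_right _ _).symm
  have hx : ∀ h, h ∈ sepSet (elt x) (H a) → h * elt x ∉ sepSet g (H a) := by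
    intro h hh
    rw [sepSet_elt_H] at hh
    simp only [sepSet, Set.mem_ofPred_eq, not_not]
    rcases hh with ⟨rfl, rfl⟩ | ⟨rfl, rfl⟩
    · rw [one_mul]
      exact iff_of_true (elt_mem_H.2 rfl) (elt_mul_mem_H hg)
    · rw [inv_mul_cancel, one_mul]
      exact iff_of_false (one_notMem_H _) hg
  have hu : sepSet (elt x * g) (H a) =
      sepSet (elt x) (H a) ∪ {h | h * elt x ∈ sepSet g (H a)} := by
    ext h
    have := hx h
    simp only [sepSet, Set.mem_ofPred_eq, Set.mem_union, mul_assoc] at this ⊢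
    tauto
  have hc : (sepSet (elt x) (H a)).ncard = if x.1 = a.1 then 1 else 0 := by
    split_ifs with hxa
    · rw [Set.ncard_eq_one]
      by_cases hx : x = a
      · refine ⟨1, ?_⟩
        ext h
        rw [sepSet_elt_H]
        have := inv_ne x
        simp [hx]
        intro _ h'
        exact absurd h' (inv_ne a)
      · refine ⟨(elt x)⁻¹, ?_⟩
        ext h
        rw [sepSet_elt_H]
        have : inv x = a := by
          obtain ⟨i, b⟩ := x
          obtain ⟨j, b'⟩ := a
          simp only at hxa
          subst hxa
          cases b <;> cases b' <;> simp_all [inv]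
        simp [hx, this]
    · rw [Set.ncard_eq_zero (sepSet_finite (AI_H a) _)]
      ext h
      rw [sepSet_elt_H]
      have h1 : x ≠ a := fun h => hxa (by rw [h])
      have h2 : inv x ≠ a := fun h => hxa (by rw [← h]; rfl)
      simp [h1, h2]
  rw [cut, hu, Set.ncard_union_eq (t := {h | h * elt x ∈ sepSet g (H a)}) (Set.disjoint_left.2 hx)
    (sepSet_finite (AI_H a) _) hfin, hc, e, add_comm]

/-- The number of edges on the path from `h` to `h k` in the Cayley tree. -/
theorem sum_cut_H {N : ℕ} (k : F N) : ∑ i : Fin N, cut k (H (i, true)) = k.norm := by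
  induction k using left_induction with
  | one => simp [cut_one]
  | mul x g hg ih =>
    simp only [cut_elt_mul_H x _ hg, Finset.sum_add_distrib, ih, norm_elt_mul hg]
    simp

/-- Twice the number of pairs `(h, h k)` that `Q` separates on the side `P`; pairs that are
separated by both sets count one half. -/
noncomputable def sideCut {N : ℕ} (k : F N) (P Q : Set (F N)) : ℕ :=
  2 * {h | (h ∈ P ∧ h * k ∈ P) ∧ h ∈ sepSet k Q}.ncard +
    {h | h ∈ sepSet k P ∧ h ∈ sepSet k Q}.ncard

theorem sideCut_act {N : ℕ} (α : MulAut (F N)) (g k : F N) (P Q : Set (F N)) :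
    sideCut k (act α g P) (act α g Q) = sideCut (α⁻¹ k) P Q := by
  rw [sideCut, sideCut,
    ← ncard_preimage_act α g {h | (h ∈ P ∧ h * α⁻¹ k ∈ P) ∧ h ∈ sepSet (α⁻¹ k) Q},
    ← ncard_preimage_act α g {h | h ∈ sepSet (α⁻¹ k) P ∧ h ∈ sepSet (α⁻¹ k) Q}]
  congr 3 <;> ext h <;> simp only [sepSet, mem_act, Set.mem_ofPred_eq, act_inv_mul]

theorem sideCut_compl_right {N : ℕ} (k : F N) (P Q : Set (F N)) :
    sideCut k P Qᶜ = sideCut k P Q := by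
  have : sepSet k Qᶜ = sepSet k Q := by
    ext h
    simp only [sepSet, Set.mem_compl_iff, Set.mem_ofPred_eq]
    tauto
  rw [sideCut, sideCut, this]

open Classical in
theorem sideCut_eq_sum {N : ℕ} (k : F N) {P Q : Set (F N)} {T : Finset (F N)}
    (hT : sepSet k Q ⊆ T) : sideCut k P Q =
      ∑ h ∈ T, (2 * (if (h ∈ P ∧ h * k ∈ P) ∧ h ∈ sepSet k Q then 1 else 0) +
        (if h ∈ sepSet k P ∧ h ∈ sepSet k Q then 1 else 0)) := by
  rw [sideCut, ncard_eq_sum (T := T) fun h hh => hT hh.2,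
    ncard_eq_sum (T := T) fun h hh => hT hh.2, Finset.mul_sum, Finset.sum_add_distrib]

open Classical in
theorem cut_eq_sum {N : ℕ} (k : F N) {S : Set (F N)} {T : Finset (F N)}
    (hT : sepSet k S ⊆ T) : cut k S = ∑ h ∈ T, if h ∈ sepSet k S then 1 else 0 := by
  rw [cut, ← ncard_eq_sum (p := fun h => h ∈ sepSet k S) fun h hh => hT hh]
  rfl

theorem sideCut_mono {N : ℕ} (k : F N) {P' P Q : Set (F N)} (hQ : AI Q) (hP : P' ⊆ P) :
    sideCut k P' Q ≤ sideCut k P Q := by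
  classical
  have hT : sepSet k Q ⊆ (sepSet_finite hQ k).toFinset := by simp
  rw [sideCut_eq_sum k hT, sideCut_eq_sum k hT]
  refine Finset.sum_le_sum fun h _ => ?_
  have h1 := @hP h
  have h2 := @hP (h * k)
  simp only [sepSet, Set.mem_ofPred_eq]
  by_cases a : h ∈ P <;> by_cases b : h * k ∈ P <;> by_cases c : h ∈ P' <;>
    by_cases d : h * k ∈ P' <;> by_cases e : h ∈ Q <;> by_cases f : h * k ∈ Q <;> simp_all

theorem sideCut_le {N : ℕ} (k : F N) {P Q : Set (F N)} (hQ : AI Q) :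
    sideCut k P Q ≤ 3 * cut k Q := by
  classical
  have hT : sepSet k Q ⊆ (sepSet_finite hQ k).toFinset := by simp
  rw [sideCut_eq_sum k hT, cut_eq_sum k hT, Finset.mul_sum]
  refine Finset.sum_le_sum fun h _ => ?_
  by_cases h1 : h ∈ sepSet k Q
  · simp only [h1, and_true, if_true]
    split_ifs <;> omega
  · simp [h1]

/-- A corner of two sets is separated by at most the two halves that bound it. -/
theorem two_cut_inter_le {N : ℕ} (k : F N) {P Q : Set (F N)} (hP : AI P) (hQ : AI Q) :
    2 * cut k (P ∩ Q) ≤ sideCut k P Q + sideCut k Q P := by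
  classical
  set T := (sepSet_finite hP k).toFinset ∪ (sepSet_finite hQ k).toFinset with hTdef
  have hTP : sepSet k P ⊆ T := by intro h hh; simp [hTdef, hh]
  have hTQ : sepSet k Q ⊆ T := by intro h hh; simp [hTdef, hh]
  have hTPQ : sepSet k (P ∩ Q) ⊆ T := by
    intro h hh
    by_contra hn
    have h1 : h ∉ sepSet k P := fun h' => hn (hTP h')
    have h2 : h ∉ sepSet k Q := fun h' => hn (hTQ h')
    simp only [sepSet, Set.mem_ofPred_eq, Set.mem_inter_iff] at hh h1 h2
    tauto
  rw [sideCut_eq_sum k hTQ, sideCut_eq_sum k hTP, cut_eq_sum k hTPQ, ← Finset.sum_add_distrib,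
    Finset.mul_sum]
  refine Finset.sum_le_sum fun h _ => ?_
  simp only [sepSet, Set.mem_ofPred_eq, Set.mem_inter_iff]
  by_cases a : h ∈ P <;> by_cases b : h * k ∈ P <;> by_cases e : h ∈ Q <;>
    by_cases f : h * k ∈ Q <;> simp [*]

theorem two_cut_eq {N : ℕ} (k : F N) {P : Set (F N)} (Q : Set (F N)) (hP : AI P) :
    2 * cut k P = sideCut k Q P + sideCut k Qᶜ P := by
  classical
  have hT : sepSet k P ⊆ (sepSet_finite hP k).toFinset := by simp
  rw [sideCut_eq_sum k hT, sideCut_eq_sum k hT, cut_eq_sum k hT, ← Finset.sum_add_distrib,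
    Finset.mul_sum]
  refine Finset.sum_congr rfl fun h _ => ?_
  simp only [sepSet, Set.mem_ofPred_eq, Set.mem_compl_iff]
  by_cases a : h ∈ P <;> by_cases b : h * k ∈ P <;> by_cases e : h ∈ Q <;>
    by_cases f : h * k ∈ Q <;> simp [*]

/-- A finite change of the set changes the cut function by a bounded amount. -/
theorem cut_le_add {N : ℕ} {S S' : Set (F N)} (hS : AI S)
    (h : ∀ᶠ h in cofinite, (h ∈ S ↔ h ∈ S')) : ∃ C, ∀ k, cut k S' ≤ cut k S + C := by
  have hfin : {h | ¬ (h ∈ S ↔ h ∈ S')}.Finite := by rwa [eventually_cofinite] at h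
  refine ⟨2 * {h | ¬ (h ∈ S ↔ h ∈ S')}.ncard, fun k => ?_⟩
  set E := {h | ¬ (h ∈ S ↔ h ∈ S')} with hE
  have hfin' : {h | h * k ∈ E}.Finite := hfin.preimage (mul_left_injective k).injOn
  have e : {h | h * k ∈ E}.ncard = E.ncard := ncard_mul_right k E
  have hsub : sepSet k S' ⊆ sepSet k S ∪ (E ∪ {h | h * k ∈ E}) := by
    intro h hh
    simp only [sepSet, hE, Set.mem_union, Set.mem_ofPred_eq] at hh ⊢
    tauto
  have h1 := Set.ncard_le_ncard hsub ((sepSet_finite hS k).union (hfin.union hfin'))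
  have h2 := Set.ncard_union_le (sepSet k S) (E ∪ {h | h * k ∈ E})
  have h3 := Set.ncard_union_le E {h | h * k ∈ E}
  rw [cut, cut]
  omega

/-! ### Asymptotic weights -/

/-- The limit of a bounded sequence along a fixed nonprincipal ultrafilter. -/
noncomputable def ulim (f : ℕ → ℝ) : ℝ := limUnder (hyperfilter ℕ : Filter ℕ) f

theorem tendsto_ulim {f : ℕ → ℝ} (C : ℝ) (h0 : ∀ n, 0 ≤ f n) (h1 : ∀ n, f n ≤ C) :
    Tendsto f (hyperfilter ℕ : Filter ℕ) (𝓝 (ulim f)) := by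
  obtain ⟨r, _, hr⟩ := (isCompact_Icc (a := (0 : ℝ)) (b := C)).ultrafilter_le_nhds
    ((hyperfilter ℕ).map f) (by
      rw [le_principal_iff, Ultrafilter.coe_map]
      exact mem_map.2 (univ_mem' fun n => Set.mem_Icc.2 ⟨h0 n, h1 n⟩))
  exact tendsto_nhds_limUnder ⟨r, hr⟩

/-- The weight of a set with respect to `c`: the number of translates of the axis of `c` that
the set separates, computed as the growth rate of the number of pairs `(h, h cⁿ)` that are
separated. -/
noncomputable def weight {N : ℕ} (c : F N) (S : Set (F N)) : ℝ :=
  ulim fun n => (cut (c ^ n) S : ℝ) / n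

/-- The weight of the part of the boundary of `Q` that lies on the side `P`, doubled. -/
noncomputable def sideWeight {N : ℕ} (c : F N) (P Q : Set (F N)) : ℝ :=
  ulim fun n => (sideCut (c ^ n) P Q : ℝ) / n

theorem div_le_of_le_mul {a n b : ℕ} (h : a ≤ n * b) : (a : ℝ) / n ≤ b := by
  rcases Nat.eq_zero_or_pos n with rfl | hn
  · simp
  · rw [div_le_iff₀ (by exact_mod_cast hn)]
    have : (a : ℝ) ≤ (n * b : ℕ) := by exact_mod_cast h
    push_cast at this
    linarith

theorem tendsto_weight {N : ℕ} (c : F N) {S : Set (F N)} (hS : AI S) :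
    Tendsto (fun n : ℕ => (cut (c ^ n) S : ℝ) / n) (hyperfilter ℕ : Filter ℕ)
      (𝓝 (weight c S)) :=
  tendsto_ulim (cut c S) (fun n => by positivity)
    fun n => div_le_of_le_mul (cut_pow_le hS c n)

theorem tendsto_sideWeight {N : ℕ} (c : F N) (P : Set (F N)) {Q : Set (F N)} (hQ : AI Q) :
    Tendsto (fun n : ℕ => (sideCut (c ^ n) P Q : ℝ) / n) (hyperfilter ℕ : Filter ℕ)
      (𝓝 (sideWeight c P Q)) :=
  tendsto_ulim ((3 * cut c Q : ℕ) : ℝ) (fun n => by positivity)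
    fun n => div_le_of_le_mul ((sideCut_le _ hQ).trans (by
      have := cut_pow_le hQ c n
      calc 3 * cut (c ^ n) Q ≤ 3 * (n * cut c Q) := by omega
        _ = n * (3 * cut c Q) := by ring))

theorem weight_act {N : ℕ} (α : MulAut (F N)) (g c : F N) (S : Set (F N)) :
    weight c (act α g S) = weight (α⁻¹ c) S := by
  simp only [weight, cut_act, map_pow]

theorem sideWeight_act {N : ℕ} (α : MulAut (F N)) (g c : F N) (P Q : Set (F N)) :
    sideWeight c (act α g P) (act α g Q) = sideWeight (α⁻¹ c) P Q := by
  simp only [sideWeight, sideCut_act, map_pow]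

theorem weight_compl {N : ℕ} (c : F N) (S : Set (F N)) : weight c Sᶜ = weight c S := by
  simp only [weight, cut_compl]

theorem sideWeight_compl_right {N : ℕ} (c : F N) (P Q : Set (F N)) :
    sideWeight c P Qᶜ = sideWeight c P Q := by
  simp only [sideWeight, sideCut_compl_right]

theorem sideWeight_mono {N : ℕ} (c : F N) {P' P Q : Set (F N)} (hQ : AI Q) (hP : P' ⊆ P) :
    sideWeight c P' Q ≤ sideWeight c P Q := by
  refine le_of_tendsto_of_tendsto' (tendsto_sideWeight c P' hQ) (tendsto_sideWeight c P hQ)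
    fun n => ?_
  have := sideCut_mono (c ^ n) hQ hP
  gcongr

theorem two_weight_inter_le {N : ℕ} (c : F N) {P Q : Set (F N)} (hP : AI P) (hQ : AI Q) :
    2 * weight c (P ∩ Q) ≤ sideWeight c P Q + sideWeight c Q P := by
  refine le_of_tendsto_of_tendsto' ((tendsto_weight c (hP.inter hQ)).const_mul 2)
    ((tendsto_sideWeight c P hQ).add (tendsto_sideWeight c Q hP)) fun n => ?_
  have : ((2 * cut (c ^ n) (P ∩ Q) : ℕ) : ℝ) ≤
      ((sideCut (c ^ n) P Q + sideCut (c ^ n) Q P : ℕ) : ℝ) := by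
    exact_mod_cast two_cut_inter_le (c ^ n) hP hQ
  push_cast at this
  rw [← add_div, ← mul_div_assoc]
  gcongr

theorem two_weight_eq {N : ℕ} (c : F N) {P : Set (F N)} (Q : Set (F N)) (hP : AI P) :
    2 * weight c P = sideWeight c Q P + sideWeight c Qᶜ P := by
  refine tendsto_nhds_unique ((tendsto_weight c hP).const_mul 2)
    (((tendsto_sideWeight c Q hP).add (tendsto_sideWeight c Qᶜ hP)).congr fun n => ?_)
  have : ((2 * cut (c ^ n) P : ℕ) : ℝ) =
      ((sideCut (c ^ n) Q P + sideCut (c ^ n) Qᶜ P : ℕ) : ℝ) := by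
    exact_mod_cast two_cut_eq (c ^ n) Q hP
  push_cast at this
  rw [← add_div, ← mul_div_assoc, this]

theorem tendsto_const_div_hyperfilter (C : ℝ) :
    Tendsto (fun n : ℕ => C / (n : ℝ)) (hyperfilter ℕ : Filter ℕ) (𝓝 0) :=
  (tendsto_const_div_atTop_nhds_zero_nat C).mono_left
    (by rw [← Nat.cofinite_eq_atTop]; exact hyperfilter_le_cofinite)

theorem weight_le_of_almost {N : ℕ} (c : F N) {S S' : Set (F N)} (hS : AI S) (hS' : AI S')
    (h : ∀ᶠ h in cofinite, (h ∈ S ↔ h ∈ S')) : weight c S' ≤ weight c S := by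
  obtain ⟨C, hC⟩ := cut_le_add hS h
  have := (tendsto_weight c hS).add (tendsto_const_div_hyperfilter C)
  rw [add_zero] at this
  refine le_of_tendsto_of_tendsto' (tendsto_weight c hS') this fun n => ?_
  have h1 : (cut (c ^ n) S' : ℝ) ≤ cut (c ^ n) S + C := by exact_mod_cast hC (c ^ n)
  rw [← add_div]
  gcongr

theorem weight_congr {N : ℕ} (c : F N) {S S' : Set (F N)} (hS : AI S) (hS' : AI S')
    (h : ∀ᶠ h in cofinite, (h ∈ S ↔ h ∈ S')) : weight c S = weight c S' :=
  le_antisymm (weight_le_of_almost c hS' hS (h.mono fun _ => Iff.symm))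
    (weight_le_of_almost c hS hS' h)

/-- The cyclically reduced length is the total weight of the half-spaces behind the basis. -/
theorem sum_weight_H {N : ℕ} (c : F N) :
    ∑ i : Fin N, weight c (H (i, true)) = cycNorm c := by
  have h1 : Tendsto (fun n : ℕ => ∑ i : Fin N, (cut (c ^ n) (H (i, true)) : ℝ) / n)
      (hyperfilter ℕ : Filter ℕ) (𝓝 (∑ i : Fin N, weight c (H (i, true)))) :=
    tendsto_finsetSum _ fun i _ => tendsto_weight c (AI_H _)
  set C : ℝ := 2 * (FreeGroup.reduceCyclically.conjugator c.toWord).length with hC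
  have h2 : Tendsto (fun n : ℕ => C / n + cycNorm c) (hyperfilter ℕ : Filter ℕ)
      (𝓝 (0 + cycNorm c)) := (tendsto_const_div_hyperfilter C).add_const _
  rw [zero_add] at h2
  refine tendsto_nhds_unique (h1.congr' ?_) h2
  have h3 : ∀ᶠ n : ℕ in (hyperfilter ℕ : Filter ℕ), 1 ≤ n :=
    (Nat.cofinite_eq_atTop ▸ hyperfilter_le_cofinite : (hyperfilter ℕ : Filter ℕ) ≤ atTop)
      (eventually_ge_atTop 1)
  filter_upwards [h3] with n hn
  rw [← Finset.sum_div]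
  have : ∑ i : Fin N, (cut (c ^ n) (H (i, true)) : ℝ) = C + n * cycNorm c := by
    obtain ⟨m, rfl⟩ := Nat.exists_eq_add_of_le' hn
    have := norm_pow_succ_eq c m
    rw [← sum_cut_H] at this
    have h4 : ((∑ i : Fin N, cut (c ^ (m + 1)) (H (i, true)) : ℕ) : ℝ) = _ := congrArg _ this
    push_cast at h4 ⊢
    rw [h4, hC]
  rw [this]
  have : (n : ℝ) ≠ 0 := by positivity
  field_simp

theorem len_cls {N : ℕ} (c : F N) : len (cls c) = cycNorm c := rfl

/-- The length of a conjugacy class with respect to the basis `α(A)`. -/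
theorem sum_weight_act {N : ℕ} (α : MulAut (F N)) (c : F N) :
    ∑ i : Fin N, weight c (act α 1 (H (i, true))) = len (α⁻¹ • cls c) := by
  simp only [weight_act]
  rw [sum_weight_H]
  rfl

/-! ### Whitehead automorphisms of the second kind and half-spaces -/

section

open Classical in
/-- The element `e` or `1`, according as the letter `x` belongs to `A` or not. -/
noncomputable def pick {N : ℕ} (A : Set (Letter N)) (e : F N) (x : Letter N) : F N :=
  if x ∈ A then e else 1

theorem pick_inv {N : ℕ} (A : Set (Letter N)) (e : F N) (x : Letter N) :
    pick A e⁻¹ x = (pick A e x)⁻¹ := by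
  unfold pick; split_ifs <;> simp

/-- The endomorphism that fixes the letters `a` and `a⁻¹` and maps each other letter `x` to
`p⁻¹ x q`, where `p = e` if `x ∈ A`, `q = e` if `x⁻¹ ∈ A`, and `p = 1`, `q = 1` otherwise. -/
noncomputable def whHom {N : ℕ} (A : Set (Letter N)) (a : Letter N) (e : F N) : F N →* F N :=
  FreeGroup.lift fun i => if i = a.1 then FreeGroup.of i else
    (pick A e (i, true))⁻¹ * FreeGroup.of i * pick A e (i, false)

theorem elt_true {N : ℕ} (i : Fin N) : elt (i, true) = FreeGroup.of i := rfl

theorem elt_false {N : ℕ} (i : Fin N) : elt (i, false) = (FreeGroup.of i)⁻¹ :=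
  elt_inv (i, true)

theorem whHom_elt_self {N : ℕ} (A : Set (Letter N)) {a x : Letter N} (e : F N)
    (hx : x.1 = a.1) : whHom A a e (elt x) = elt x := by
  obtain ⟨i, b⟩ := x
  simp only at hx
  cases b
  · rw [elt_false, map_inv, whHom, FreeGroup.lift_apply_of, if_pos hx]
  · rw [elt_true, whHom, FreeGroup.lift_apply_of, if_pos hx]

theorem whHom_elt {N : ℕ} (A : Set (Letter N)) {a x : Letter N} (e : F N)
    (hx : x.1 ≠ a.1) : whHom A a e (elt x) = (pick A e x)⁻¹ * elt x * pick A e (inv x) := by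
  obtain ⟨i, b⟩ := x
  simp only at hx
  cases b
  · rw [elt_false, map_inv, whHom, FreeGroup.lift_apply_of, if_neg hx]
    simp [mul_assoc, inv]
  · rw [elt_true, whHom, FreeGroup.lift_apply_of, if_neg hx]
    rfl

theorem hom_ext_elt {N : ℕ} {f g : F N →* F N} (h : ∀ x, f (elt x) = g (elt x)) : f = g :=
  FreeGroup.ext_hom _ _ fun i => h (i, true)

theorem whHom_comp {N : ℕ} (A : Set (Letter N)) (a : Letter N) {e : F N}
    (he : whHom A a e⁻¹ e = e) : (whHom A a e⁻¹).comp (whHom A a e) = MonoidHom.id _ := by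
  refine hom_ext_elt fun x => ?_
  have hp : ∀ y, whHom A a e⁻¹ (pick A e y) = pick A e y := by
    intro y
    unfold pick
    split_ifs
    · exact he
    · exact map_one _
  rw [MonoidHom.comp_apply, MonoidHom.id_apply]
  by_cases hx : x.1 = a.1
  · rw [whHom_elt_self A _ hx, whHom_elt_self A _ hx]
  · rw [whHom_elt A _ hx, map_mul, map_mul, map_inv, hp, hp, whHom_elt A _ hx, pick_inv, pick_inv]
    group

/-- The Whitehead automorphism of the second kind given by a set `A` of letters with multiplier
`a`. -/
noncomputable def wh {N : ℕ} (A : Set (Letter N)) (a : Letter N) : MulAut (F N) :=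
  MonoidHom.toMulEquiv (whHom A a (elt a)) (whHom A a (elt a)⁻¹)
    (whHom_comp A a (whHom_elt_self A _ rfl))
    (by
      have := whHom_comp A a (e := (elt a)⁻¹)
        (by rw [map_inv, inv_inv, whHom_elt_self A _ rfl])
      rwa [inv_inv] at this)

theorem wh_elt_self {N : ℕ} (A : Set (Letter N)) {a x : Letter N}
    (hx : x.1 = a.1) : wh A a (elt x) = elt x := whHom_elt_self A _ hx

theorem wh_elt {N : ℕ} (A : Set (Letter N)) {a x : Letter N}
    (hx : x.1 ≠ a.1) :
    wh A a (elt x) = (pick A (elt a) x)⁻¹ * elt x * pick A (elt a) (inv x) := whHom_elt A _ hx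

theorem isWhitehead_of_whHom {N : ℕ} (A : Set (Letter N)) (a b : Letter N) (τ : MulAut (F N))
    (hτ : ∀ x, τ x = whHom A a (elt b) x) : IsWhitehead τ := by
  refine Or.inr ⟨b, fun x => ?_⟩
  rw [hτ]
  by_cases hx : x.1 = a.1
  · exact Or.inl (whHom_elt_self A _ hx)
  · rw [whHom_elt A _ hx]
    unfold pick
    split_ifs <;> simp only [inv_one, one_mul, mul_one, true_or, or_true]

theorem isWhitehead_wh {N : ℕ} (A : Set (Letter N)) (a : Letter N) : IsWhitehead (wh A a) :=
  isWhitehead_of_whHom A a a _ fun _ => rfl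

theorem isWhitehead_wh_inv {N : ℕ} (A : Set (Letter N)) (a : Letter N) :
    IsWhitehead (wh A a)⁻¹ :=
  isWhitehead_of_whHom A a (inv a) _ fun _ => by rw [elt_inv]; rfl

/-- The union of the half-spaces behind the letters of `A`. -/
def HA {N : ℕ} (A : Set (Letter N)) : Set (F N) := {g | ∃ x ∈ A, g ∈ H x}

theorem one_notMem_HA {N : ℕ} (A : Set (Letter N)) : (1 : F N) ∉ HA A := by
  rintro ⟨x, _, hx⟩; exact one_notMem_H x hx

theorem elt_mem_HA {N : ℕ} {A : Set (Letter N)} {x : Letter N} : elt x ∈ HA A ↔ x ∈ A := by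
  constructor
  · rintro ⟨y, hy, h⟩
    rw [elt_mem_H] at h
    rwa [h]
  · exact fun h => ⟨x, h, elt_mem_H.2 rfl⟩

theorem mul_elt_mem_HA {N : ℕ} {A : Set (Letter N)} {z : Letter N} {g : F N} (h1 : g ≠ 1)
    (h2 : g * elt z ≠ 1) : g * elt z ∈ HA A ↔ g ∈ HA A := by
  constructor
  · rintro ⟨x, hx, h⟩; exact ⟨x, hx, (mul_elt_mem_H h1 h2).1 h⟩
  · rintro ⟨x, hx, h⟩; exact ⟨x, hx, (mul_elt_mem_H h1 h2).2 h⟩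

/-- A set is determined by its coboundary and one membership. -/
theorem eq_of_sepSet {N : ℕ} {S T : Set (F N)} (h1 : (1 : F N) ∈ S ↔ (1 : F N) ∈ T)
    (h : ∀ z g, g ∈ sepSet (elt z) S ↔ g ∈ sepSet (elt z) T) : S = T := by
  ext g
  suffices ∀ k : F N, ∀ g, (g ∈ S ↔ g ∈ T) → (g * k ∈ S ↔ g * k ∈ T) by
    simpa using this g 1 h1
  intro k
  induction k using left_induction with
  | one => simp
  | mul x k _ ih =>
    intro g hg
    rw [← mul_assoc]
    refine ih _ ?_
    have := h x g
    simp only [sepSet, Set.mem_ofPred_eq] at this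
    tauto

/-- The Whitehead automorphism replaces the half-space behind `a` by the union of the half-spaces
behind the letters of `A`: both sets have the one edge dual to `a` as their coboundary in the Cayley
tree of the new basis. -/
theorem act_wh_H_self {N : ℕ} {A : Set (Letter N)} {a : Letter N} (ha : a ∈ A)
    (ha' : inv a ∉ A) : act (wh A a) 1 (H a) = HA A := by
  have key : H a = {h | wh A a h ∈ HA A} := by
    refine eq_of_sepSet ?_ fun z h => ?_
    · exact iff_of_false (one_notMem_H a) (by
        change wh A a 1 ∉ HA A
        rw [map_one]; exact one_notMem_HA A)
    have hz : (h = (elt z)⁻¹) ↔ wh A a h = (wh A a (elt z))⁻¹ := by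
      rw [← map_inv]; exact (wh A a).injective.eq_iff.symm
    have h1 : (h = 1) ↔ wh A a h = 1 := by
      rw [← map_one (wh A a)]; exact (wh A a).injective.eq_iff.symm
    rw [sepSet_elt_H, hz, h1]
    simp only [sepSet, Set.mem_ofPred_eq, map_mul]
    generalize wh A a h = g
    by_cases hza : z.1 = a.1
    · rw [wh_elt_self A hza]
      by_cases hg1 : g = 1
      · subst hg1
        rw [one_mul, elt_mem_HA]
        have hne := elt_ne_one z
        have hza' : z = a ∨ inv z = a := by
          obtain ⟨i, b⟩ := z
          obtain ⟨j, b'⟩ := a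
          simp only at hza
          subst hza
          cases b <;> cases b' <;> simp [inv]
        have := one_notMem_HA A
        rcases hza' with rfl | h
        · tauto
        · have hz : z ≠ a := fun h' => inv_ne z (by rw [h, h'])
          rw [inv_eq_iff] at h
          subst h
          have : (1 : F N) ≠ (elt (inv a))⁻¹ := fun h =>
            hne (by rw [eq_comm, inv_eq_one] at h; exact h)
          tauto
      · by_cases hg2 : g = (elt z)⁻¹
        · subst hg2
          rw [inv_mul_cancel, ← elt_inv, elt_mem_HA]
          have := one_notMem_HA A
          have h4 : inv z = a ∨ inv z = inv a := by
            obtain ⟨i, b⟩ := z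
            obtain ⟨j, b'⟩ := a
            simp only at hza
            subst hza
            cases b <;> cases b' <;> simp [inv]
          rw [← elt_inv] at hg1
          rcases h4 with h | h
          · rw [h]; tauto
          · rw [h]
            have : inv a ≠ a := inv_ne a
            rw [h] at hg1
            tauto
        · rw [mul_elt_mem_HA hg1 fun he => hg2 (eq_inv_of_mul_eq_one_left he)]
          tauto
    · have hz1 : z ≠ a := fun h => hza (by rw [h])
      have hz2 : inv z ≠ a := fun h => hza (by rw [← h]; rfl)
      simp only [hz1, hz2, and_false, or_false, false_iff, not_not]
      rw [wh_elt A hza]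
      -- multiplication by the multiplier adds only the root
      have hm : ∀ k y, k * pick A (elt a) y ∈ HA A ↔ k ∈ HA A ∨ (k = 1 ∧ y ∈ A) := by
        intro k y
        unfold pick
        by_cases hy : y ∈ A
        · rw [if_pos hy]
          by_cases hk1 : k = 1
          · subst hk1
            simp [elt_mem_HA, ha, hy]
          · by_cases hk2 : k = (elt a)⁻¹
            · subst hk2
              rw [inv_mul_cancel]
              refine iff_of_false (one_notMem_HA A) ?_
              rw [← elt_inv, elt_mem_HA]
              have := elt_ne_one (inv a)
              tauto
            · rw [mul_elt_mem_HA hk1 fun he => hk2 (eq_inv_of_mul_eq_one_left he)]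
              tauto
        · rw [if_neg hy, mul_one]
          tauto
      have e1 : g * ((pick A (elt a) z)⁻¹ * elt z * pick A (elt a) (inv z)) =
          (g * (pick A (elt a) z)⁻¹) * elt z * pick A (elt a) (inv z) := by group
      obtain ⟨k, hk⟩ : ∃ k, k = g * (pick A (elt a) z)⁻¹ := ⟨_, rfl⟩
      have hg : g = k * pick A (elt a) z := by rw [hk]; group
      rw [e1, ← hk, hm, hg, hm]
      have hne := elt_ne_one z
      by_cases hk1 : k = 1
      · subst hk1
        rw [one_mul, elt_mem_HA]
        have := one_notMem_HA A
        tauto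
      · by_cases hk2 : k = (elt z)⁻¹
        · subst hk2
          rw [inv_mul_cancel, ← elt_inv, elt_mem_HA]
          have := one_notMem_HA A
          have := elt_ne_one (inv z)
          tauto
        · have hk3 : k * elt z ≠ 1 := fun he => hk2 (eq_inv_of_mul_eq_one_left he)
          rw [mul_elt_mem_HA hk1 hk3]
          tauto
  ext h
  rw [mem_act, key]
  simp [MulAut.inv_def]

/-- Up to translation, the half-spaces behind all other letters stay the same. -/
theorem act_wh_H {N : ℕ} {A : Set (Letter N)} {a x : Letter N} (hx : x.1 ≠ a.1) :
    act (wh A a) (pick A (elt a) x) (H x) = H x := by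
  have hax : a ≠ x := fun h => hx (by rw [h])
  have hax' : inv a ≠ x := fun h => hx (by rw [← h]; rfl)
  have hm : ∀ k y, k * pick A (elt a) y ∈ H x ↔ k ∈ H x := by
    intro k y
    unfold pick
    split_ifs
    · have := sepSet_elt_H a x k
      simp only [hax, hax', and_false, or_false, iff_false, sepSet, Set.mem_ofPred_eq,
        not_not] at this
      exact this.symm
    · rw [mul_one]
  have key : H x = {h | pick A (elt a) x * wh A a h ∈ H x} := by
    refine eq_of_sepSet ?_ fun z h => ?_
    · refine iff_of_false (one_notMem_H x) ?_
      change pick A (elt a) x * wh A a 1 ∉ H x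
      have := hm 1 x
      rw [one_mul] at this
      rw [map_one, mul_one, this]
      exact one_notMem_H x
    have hz : (h = (elt z)⁻¹) ↔ wh A a h = (wh A a (elt z))⁻¹ := by
      rw [← map_inv]; exact (wh A a).injective.eq_iff.symm
    have h1 : (h = 1) ↔ wh A a h = 1 := by
      rw [← map_one (wh A a)]; exact (wh A a).injective.eq_iff.symm
    rw [sepSet_elt_H, hz, h1]
    simp only [sepSet, Set.mem_ofPred_eq, map_mul]
    generalize wh A a h = g
    have hs := sepSet_elt_H z x
    simp only [sepSet, Set.mem_ofPred_eq] at hs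
    by_cases hza : z.1 = a.1
    · have hz1 : z ≠ x := fun h => hx (by rw [← h, hza])
      have hz2 : inv z ≠ x := fun h => hx (by rw [← h, ← hza]; rfl)
      rw [wh_elt_self A hza, ← mul_assoc, hs]
      simp [hz1, hz2]
    · rw [wh_elt A hza]
      have e1 : pick A (elt a) x * (g * ((pick A (elt a) z)⁻¹ * elt z * pick A (elt a) (inv z))) =
          (pick A (elt a) x * g * (pick A (elt a) z)⁻¹) * elt z * pick A (elt a) (inv z) := by
        group
      obtain ⟨k, hk⟩ : ∃ k, k = pick A (elt a) x * g * (pick A (elt a) z)⁻¹ := ⟨_, rfl⟩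
      have hg : pick A (elt a) x * g = k * pick A (elt a) z := by rw [hk]; group
      have hg' : g = (pick A (elt a) x)⁻¹ * k * pick A (elt a) z := by rw [hk]; group
      rw [e1, ← hk, hm, hg, hm, hs, hg']
      refine or_congr ?_ ?_
      · refine and_congr_left fun h => ?_
        subst h
        constructor
        · intro h
          have := congrArg (fun t => pick A (elt a) z * t * (pick A (elt a) z)⁻¹) h
          simpa [mul_assoc] using this
        · rintro rfl; group
      · refine and_congr_left fun h => ?_
        subst h
        constructor
        · intro h
          have := congrArg (fun t => pick A (elt a) (inv z) * t * (pick A (elt a) z)⁻¹) h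
          simpa [mul_assoc] using this
        · rintro rfl; group
  ext h
  rw [mem_act]
  conv_lhs => rw [key]
  simp [MulAut.inv_def]

end

theorem weight_act_H {N : ℕ} (α : MulAut (F N)) (g c : F N) (x : Letter N) :
    weight c (act α g (H x)) = weight c (act α 1 (H (x.1, true))) := by
  obtain ⟨i, b⟩ := x
  have h1 : ∀ g x, weight c (act α g (H x)) = weight c (act α 1 (H x)) := by
    intro g x; rw [weight_act, weight_act]
  cases b
  · rw [← weight_compl, compl_act_H, h1]
    rfl
  · exact h1 _ _

/-- The change of length under a Whitehead automorphism of the second kind. -/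
theorem len_wh {N : ℕ} (α : MulAut (F N)) (c : F N) {A : Set (Letter N)} {a : Letter N}
    (ha : a ∈ A) (ha' : inv a ∉ A) :
    (len ((α * wh A a)⁻¹ • cls c) : ℝ) + weight c (act α 1 (H (a.1, true))) =
      len (α⁻¹ • cls c) + weight c (act α 1 (HA A)) := by
  rw [← sum_weight_act, ← sum_weight_act, ← Finset.add_sum_erase _ _ (Finset.mem_univ a.1),
    ← Finset.add_sum_erase _ (fun i => weight c (act α 1 (H (i, true)))) (Finset.mem_univ a.1)]
  have h1 : weight c (act (α * wh A a) 1 (H (a.1, true))) = weight c (act α 1 (HA A)) := by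
    rw [← weight_act_H (α * wh A a) 1 c a, ← act_wh_H_self ha ha', act_act]
    simp
  have h2 : ∀ i ∈ Finset.univ.erase a.1, weight c (act (α * wh A a) 1 (H (i, true))) =
      weight c (act α 1 (H (i, true))) := by
    intro i hi
    have h3 := congrArg (fun S => weight c (act α 1 S))
      (act_wh_H (A := A) (a := a) (x := (i, true)) (Finset.ne_of_mem_erase hi))
    simp only [act_act] at h3
    rw [← h3]
    exact (weight_act_H _ _ c (i, true)).symm
  rw [h1, Finset.sum_congr rfl h2]
  ring

/-! ### Finiteness of crossings and innermost half-spaces -/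

/-- The vertices at the coboundary of a set. -/
def bdry {N : ℕ} (Q : Set (F N)) : Set (F N) := {h | ∃ z, h ∈ sepSet (elt z) Q}

theorem bdry_finite {N : ℕ} {Q : Set (F N)} (hQ : AI Q) : (bdry Q).Finite := by
  have : bdry Q = ⋃ z, sepSet (elt z) Q := by
    ext h; simp [bdry]
  rw [this]
  exact Set.finite_iUnion fun z => sepSet_finite hQ _

/-- A half-space that meets `Q` and its complement contains a vertex at the coboundary of `Q`,
because half-spaces are connected. -/
theorem exists_mem_bdry {N : ℕ} {Q : Set (F N)} (g : F N) (x : Letter N)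
    (h1 : ∃ h ∈ act 1 g (H x), h ∈ Q) (h2 : ∃ h ∈ act 1 g (H x), h ∉ Q) :
    ∃ h ∈ act 1 g (H x), h ∈ bdry Q := by
  by_contra! hcon
  have key : ∀ n, ∀ v : F N, v.norm = n → v ∉ H (inv x) →
      (g * (elt x * v) ∈ Q ↔ g * elt x ∈ Q) := by
    intro n
    induction n with
    | zero =>
      intro v hv _
      rw [FreeGroup.norm_eq_zero.1 hv, mul_one]
    | succ n ih =>
      intro v hv hvx
      have hv1 : v⁻¹ ≠ 1 := by
        intro h
        rw [inv_eq_one] at h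
        subst h
        simp at hv
      obtain ⟨y, hy⟩ := exists_mem_H hv1
      have hn : (v * elt y).norm = n := by
        have := norm_inv_elt_mul hy
        rw [← mul_inv_rev, FreeGroup.norm_inv_eq, FreeGroup.norm_inv_eq] at this
        omega
      have hvx' : v * elt y ∉ H (inv x) := by
        by_cases h : v * elt y = 1
        · rw [h]; exact one_notMem_H _
        · rwa [mul_elt_mem_H (fun h => hv1 (by rw [h, inv_one])) h]
      rw [← ih _ hn hvx']
      have hmem : g * (elt x * v) ∈ act 1 g (H x) := by
        have := elt_mul_mem_H hvx
        simpa [mem_act] using this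
      have := hcon _ hmem
      simp only [bdry, sepSet, Set.mem_ofPred_eq, not_exists, not_not] at this
      rw [this y]
      simp only [mul_assoc]
  obtain ⟨h, hh, hhQ⟩ := h1
  obtain ⟨h', hh', hhQ'⟩ := h2
  have e : ∀ h ∈ act 1 g (H x), (h ∈ Q ↔ g * elt x ∈ Q) := by
    intro h hh
    have := key _ ((elt x)⁻¹ * (g⁻¹ * h)) rfl (mem_H_iff.1 (by simpa [mem_act] using hh))
    rwa [mul_inv_cancel_left, mul_inv_cancel_left] at this
  exact hhQ' ((e _ hh').2 ((e _ hh).1 hhQ))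

theorem finite_cross_one {N : ℕ} {Q : Set (F N)} (hQ : AI Q) :
    {P | P ∈ half (1 : MulAut (F N)) ∧ Cross P Q}.Finite := by
  have hK := bdry_finite hQ
  refine Set.Finite.subset (s := ⋃ k₁ ∈ bdry Q, ⋃ k₂ ∈ bdry Q,
    ⋃ n ∈ Set.Iic (k₂⁻¹ * k₁).toWord.length, ⋃ x : Letter N,
      {act 1 (k₂ * FreeGroup.mk ((k₂⁻¹ * k₁).toWord.take n)) (H x)}) ?_ ?_
  · exact hK.biUnion fun k₁ _ => hK.biUnion fun k₂ _ => (Set.finite_Iic _).biUnion fun n _ =>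
      Set.finite_iUnion fun x => Set.finite_singleton _
  · rintro _ ⟨⟨g, x, rfl⟩, hc⟩
    obtain ⟨c1, c2, c3, c4⟩ := hc
    obtain ⟨k₁, hk₁, hk₁'⟩ := exists_mem_bdry g x c1.exists c2.exists
    have hcompl := compl_act_H 1 g x
    obtain ⟨k₂, hk₂, hk₂'⟩ := exists_mem_bdry (Q := Q) (g * (1 : MulAut (F N)) (elt x)) (inv x)
      (by rw [← hcompl]; exact c3.exists) (by rw [← hcompl]; exact c4.exists)
    rw [← hcompl] at hk₂
    have hu1 : g⁻¹ * k₁ ∈ H x := by simpa [mem_act] using hk₁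
    have hu2 : g⁻¹ * k₂ ∉ H x := by simpa [mem_act] using hk₂
    have hw := toWord_mul_of_H ((g⁻¹ * k₂)⁻¹) (g⁻¹ * k₁) (fun y hy hy' => hu2 (by
      rw [inv_inv] at hy
      rwa [H_disjoint hu1 hy']))
    have e1 : (g⁻¹ * k₂)⁻¹ * (g⁻¹ * k₁) = k₂⁻¹ * k₁ := by group
    rw [e1] at hw
    simp only [Set.mem_iUnion, Set.mem_Iic, Set.mem_singleton_iff]
    refine ⟨k₁, hk₁', k₂, hk₂', ((g⁻¹ * k₂)⁻¹).toWord.length, ?_, x, ?_⟩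
    · rw [hw, List.length_append]; omega
    · rw [hw, List.take_left, FreeGroup.mk_toWord]
      congr 1
      group

theorem half_act_inv {N : ℕ} {α : MulAut (F N)} {P : Set (F N)} (hP : P ∈ half α) :
    act α⁻¹ 1 P ∈ half (1 : MulAut (F N)) := by
  have := half_act hP α⁻¹ 1
  rwa [inv_mul_cancel] at this

theorem act_one_injective {N : ℕ} (α : MulAut (F N)) (g : F N) :
    Function.Injective (act α g) := fun S T h => by
  rw [← act_inv_act α g S, h, act_inv_act]

/-- Only finitely many half-spaces of a basis cross an almost invariant set. -/
theorem finite_cross {N : ℕ} (α : MulAut (F N)) {Q : Set (F N)} (hQ : AI Q) :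
    {P | P ∈ half α ∧ Cross P Q}.Finite := by
  refine Set.Finite.of_finite_image (f := act α⁻¹ 1) ?_ (act_one_injective _ _).injOn
  refine (finite_cross_one (hQ.act α⁻¹ 1)).subset ?_
  rintro _ ⟨P, ⟨hP, hc⟩, rfl⟩
  exact ⟨half_act_inv hP, (cross_act _ _).2 hc⟩

/-- `Q` splits `P` if it contains infinitely many elements of `P` and omits infinitely many. -/
def Splits {N : ℕ} (P Q : Set (F N)) : Prop :=
  (∃ᶠ h in cofinite, h ∈ P ∧ h ∈ Q) ∧ (∃ᶠ h in cofinite, h ∈ P ∧ h ∉ Q)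

theorem not_splits {N : ℕ} {P Q : Set (F N)} (h : ¬ Splits P Q) :
    (∀ᶠ h in cofinite, h ∈ P → h ∈ Q) ∨ (∀ᶠ h in cofinite, h ∈ P → h ∉ Q) := by
  rw [Splits, not_and_or, not_frequently, not_frequently] at h
  rcases h with h | h
  · exact Or.inr (h.mono fun _ => by tauto)
  · exact Or.inl (h.mono fun _ => by tauto)

/-- A half-space that is split by `Q` contains an innermost one: all further half-spaces behind
its first vertex are not split. -/
theorem exists_innermost {N : ℕ} {Q : Set (F N)} (hQ : AI Q) (g : F N) (b : Letter N)
    (hs : Splits (act 1 g (H b))ᶜ Q) :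
    ∃ g' b', (act 1 g' (H b'))ᶜ ⊆ (act 1 g (H b))ᶜ ∧ Splits (act 1 g' (H b'))ᶜ Q ∧
      ∀ x, x ≠ b' → ¬ Splits (act 1 g' (H x)) Q := by
  obtain ⟨n, hn⟩ : ∃ n, ∀ k ∈ bdry Q, (g⁻¹ * k).norm < n := by
    obtain ⟨n, hn⟩ := ((bdry_finite hQ).image fun k => (g⁻¹ * k).norm).bddAbove
    exact ⟨n + 1, fun k hk => Nat.lt_succ_of_le (hn ⟨k, hk, rfl⟩)⟩
  have hn' : ∀ k ∈ bdry Q, k ∉ act 1 g (H b) → (g⁻¹ * k).norm < n := fun k hk _ => hn k hk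
  clear hn
  induction n generalizing g b with
  | zero =>
    exfalso
    rw [compl_act_H] at hs
    obtain ⟨h, hh, hh'⟩ := exists_mem_bdry _ _ hs.1.exists hs.2.exists
    rw [← compl_act_H] at hh
    exact absurd (hn' h hh' hh) (by omega)
  | succ n ih =>
    by_cases hc : ∀ x, x ≠ b → ¬ Splits (act 1 g (H x)) Q
    · exact ⟨g, b, subset_rfl, hs, hc⟩
    push Not at hc
    obtain ⟨x, hxb, hx⟩ := hc
    have e := compl_act_H 1 g x
    have e' : (act 1 (g * (1 : MulAut (F N)) (elt x)) (H (inv x)))ᶜ = act 1 g (H x) := by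
      rw [← e, compl_compl]
    obtain ⟨g', b', hsub, hs', hin⟩ := ih (g * (1 : MulAut (F N)) (elt x)) (inv x)
      (by rwa [e']) (by
        intro k hk hk'
        rw [← e, Set.notMem_compl_iff] at hk'
        have hkx : g⁻¹ * k ∈ H x := by simpa [mem_act] using hk'
        have h1 : k ∉ act 1 g (H b) := by
          intro h
          have : g⁻¹ * k ∈ H b := by simpa [mem_act] using h
          exact hxb (H_disjoint hkx this)
        have h2 := hn' k hk h1
        have h3 := norm_inv_elt_mul hkx
        have e3 : (g * (1 : MulAut (F N)) (elt x))⁻¹ * k = (elt x)⁻¹ * (g⁻¹ * k) := by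
          simp only [MulAut.one_apply]; group
        rw [e3]
        omega)
    refine ⟨g', b', hsub.trans ?_, hs', hin⟩
    rw [e']
    intro h hh hh'
    have h1 : g⁻¹ * h ∈ H x := by simpa [mem_act] using hh
    have h2 : g⁻¹ * h ∈ H b := by simpa [mem_act] using hh'
    exact hxb (H_disjoint h1 h2)

theorem almostEq_act {N : ℕ} (α : MulAut (F N)) (g : F N) {P Q : Set (F N)} :
    (∀ᶠ h in cofinite, (h ∈ act α g P ↔ h ∈ act α g Q)) ↔
      ∀ᶠ h in cofinite, (h ∈ P ↔ h ∈ Q) :=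
  eventually_act (p := fun h => h ∈ P ↔ h ∈ Q) α g

theorem eventually_ne_one {N : ℕ} : ∀ᶠ h : F N in cofinite, h ≠ 1 :=
  (Set.finite_singleton (1 : F N)).compl_mem_cofinite

/-- Surgery along an innermost disc, standard basis. -/
theorem surgery_one {N : ℕ} {P Q : Set (F N)} (hQ : AI Q) (hP : P ∈ half (1 : MulAut (F N)))
    (hc : Cross P Q) :
    ∃ (g : F N) (a : Letter N) (A : Set (Letter N)) (Q' : Set (F N)), a ∈ A ∧ inv a ∉ A ∧
      (Q' = Q ∨ Q' = Qᶜ) ∧ (act 1 g (H (inv a)))ᶜ ⊆ P ∧ Cross (act 1 g (H (inv a)))ᶜ Q ∧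
      ∀ᶠ h in cofinite, (h ∈ act 1 g (HA A) ↔ h ∈ (act 1 g (H (inv a)))ᶜ ∩ Q') := by
  obtain ⟨g₀, b₀, hb₀⟩ : ∃ g b, P = (act 1 g (H b))ᶜ := by
    obtain ⟨g, x, h⟩ := half_compl hP
    exact ⟨g, x, by rw [← h, compl_compl]⟩
  subst hb₀
  obtain ⟨g, b, hsub, hs, hin⟩ := exists_innermost hQ g₀ b₀ ⟨hc.1, hc.2.1⟩
  have hcross : Cross (act 1 g (H b))ᶜ Q :=
    ⟨hs.1, hs.2, hc.2.2.1.mono fun h hh => ⟨fun h' => hh.1 (hsub h'), hh.2⟩,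
      hc.2.2.2.mono fun h hh => ⟨fun h' => hh.1 (hsub h'), hh.2⟩⟩
  obtain ⟨Q', hQ', haQ'⟩ : ∃ Q', (Q' = Q ∨ Q' = Qᶜ) ∧
      ∀ᶠ h in cofinite, h ∈ act 1 g (H (inv b)) → h ∈ Q' := by
    rcases not_splits (hin (inv b) (inv_ne b)) with h | h
    · exact ⟨Q, Or.inl rfl, h⟩
    · exact ⟨Qᶜ, Or.inr rfl, h⟩
  set A : Set (Letter N) := {x | x ≠ b ∧ ∀ᶠ h in cofinite, h ∈ act 1 g (H x) → h ∈ Q'} with hA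
  have hx : ∀ x, x ≠ b → x ∉ A → ∀ᶠ h in cofinite, h ∈ act 1 g (H x) → h ∉ Q' := by
    intro x hxb hxA
    have hn : ¬ ∀ᶠ h in cofinite, h ∈ act 1 g (H x) → h ∈ Q' := fun h => hxA ⟨hxb, h⟩
    rcases hQ' with rfl | rfl
    · exact (not_splits (hin x hxb)).resolve_left hn
    · have := (not_splits (hin x hxb)).resolve_right hn
      exact this.mono fun h h1 h2 => not_not_intro (h1 h2)
  refine ⟨g, inv b, A, Q', ⟨inv_ne b, haQ'⟩, ?_, hQ', ?_, ?_, ?_⟩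
  · rw [inv_inv']; exact fun h => h.1 rfl
  · rwa [inv_inv']
  · rwa [inv_inv']
  · rw [inv_inv']
    have h1 : ∀ᶠ h in cofinite, ∀ x, x ∈ A → h ∈ act 1 g (H x) → h ∈ Q' := by
      rw [eventually_all]
      intro x
      by_cases hxA : x ∈ A
      · exact hxA.2.mono fun _ h _ => h
      · exact Eventually.of_forall fun h hh => absurd hh hxA
    have h2 : ∀ᶠ h in cofinite, ∀ x, x ≠ b → x ∉ A → h ∈ act 1 g (H x) → h ∉ Q' := by
      rw [eventually_all]
      intro x
      by_cases hxA : x ≠ b ∧ x ∉ A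
      · exact (hx x hxA.1 hxA.2).mono fun _ h _ _ => h
      · exact Eventually.of_forall fun h h3 h4 => absurd ⟨h3, h4⟩ hxA
    have h3 : ∀ᶠ h in cofinite, g⁻¹ * h ≠ 1 :=
      (mul_right_injective g⁻¹).tendsto_cofinite.eventually eventually_ne_one
    filter_upwards [h1, h2, h3] with h h1 h2 h3
    obtain ⟨x, hx⟩ := exists_mem_H h3
    have hmem : ∀ y, h ∈ act 1 g (H y) ↔ y = x := by
      intro y
      constructor
      · intro hy
        have : g⁻¹ * h ∈ H y := by simpa [mem_act] using hy
        exact H_disjoint this hx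
      · rintro rfl; simpa [mem_act] using hx
    have hHA : h ∈ act 1 g (HA A) ↔ x ∈ A := by
      constructor
      · rintro ⟨y, hy, hy'⟩
        rwa [← (hmem y).1 hy']
      · exact fun hxA => ⟨x, hxA, (hmem x).2 rfl⟩
    rw [hHA, Set.mem_inter_iff, Set.mem_compl_iff, hmem]
    constructor
    · intro hxA
      exact ⟨fun hh => hxA.1 hh.symm, h1 x hxA ((hmem x).2 rfl)⟩
    · rintro ⟨hbx, hhQ⟩
      by_contra hxA
      exact h2 x (fun hh => hbx hh.symm) hxA ((hmem x).2 rfl) hhQ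

/-- Surgery along an innermost disc: a half-space of the basis `α(A)` inside `P` that crosses `Q`
can be replaced by its corner with `Q` or with the complement of `Q`. -/
theorem surgery {N : ℕ} (α : MulAut (F N)) {P Q : Set (F N)} (hQ : AI Q) (hP : P ∈ half α)
    (hc : Cross P Q) :
    ∃ (g : F N) (a : Letter N) (A : Set (Letter N)) (Q' : Set (F N)), a ∈ A ∧ inv a ∉ A ∧
      (Q' = Q ∨ Q' = Qᶜ) ∧ (act α g (H (inv a)))ᶜ ⊆ P ∧ Cross (act α g (H (inv a)))ᶜ Q ∧
      ∀ᶠ h in cofinite, (h ∈ act α g (HA A) ↔ h ∈ (act α g (H (inv a)))ᶜ ∩ Q') := by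
  have e : ∀ S : Set (F N), act α 1 (act α⁻¹ 1 S) = S := by
    intro S; rw [act_act]; simp [act_one]
  obtain ⟨g, a, A, Q', ha, ha', hQ', hsub, hcr, hal⟩ :=
    surgery_one (hQ.act α⁻¹ 1) (half_act_inv hP) ((cross_act _ _).2 hc)
  have e' : ∀ S : Set (F N), act α (α g) S = act α 1 (act 1 g S) := by
    intro S; rw [act_act]; simp
  refine ⟨α g, a, A, act α 1 Q', ha, ha', ?_, ?_, ?_, ?_⟩
  · rcases hQ' with rfl | rfl
    · exact Or.inl (e Q)
    · exact Or.inr (by rw [act_compl, e])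
  · rw [e', ← act_compl, ← e P]
    exact fun h hh => hsub hh
  · rw [e', ← act_compl, ← e Q]
    exact (cross_act _ _).2 hcr
  · rw [e', e', ← act_compl, ← act_inter, almostEq_act]
    exact hal

/-- A set that neither crosses nor almost equals a half-space of the standard basis is, up to a
finite set, a union of half-spaces at one vertex. -/
theorem exists_HA_one {N : ℕ} (hN : 2 ≤ N) {Q : Set (F N)} (hQ : AI Q)
    (h1 : ∃ᶠ h in cofinite, h ∈ Q) (h2 : ∃ᶠ h in cofinite, h ∉ Q)
    (hnc : ∀ P ∈ half (1 : MulAut (F N)), ¬ Cross P Q)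
    (hne : ∀ P ∈ half (1 : MulAut (F N)), ¬ ∀ᶠ h in cofinite, (h ∈ P ↔ h ∈ Q)) :
    ∃ g A, ∀ᶠ h in cofinite, (h ∈ act 1 g (HA A) ↔ h ∈ Q) := by
  obtain ⟨P, hP, hPs⟩ : ∃ P ∈ half (1 : MulAut (F N)), Splits P Q := by
    by_contra! hcon
    have hP : act 1 1 (H ((⟨0, by omega⟩, true) : Letter N)) ∈ half (1 : MulAut (F N)) :=
      act_H_mem_half _ _ _
    set P := act 1 1 (H ((⟨0, by omega⟩, true) : Letter N))
    have hPc := half_compl hP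
    rcases not_splits (hcon P hP) with h3 | h3 <;> rcases not_splits (hcon _ hPc) with h4 | h4
    · refine h2 ?_
      filter_upwards [h3, h4] with h h5 h6
      by_cases hh : h ∈ P
      · exact not_not_intro (h5 hh)
      · exact not_not_intro (h6 hh)
    · refine hne P hP ?_
      filter_upwards [h3, h4] with h h5 h6
      exact ⟨h5, fun h7 => by_contra fun h8 => h6 h8 h7⟩
    · refine hne _ hPc ?_
      filter_upwards [h3, h4] with h h5 h6
      exact ⟨h6, fun h7 h8 => h5 h8 h7⟩
    · refine h1 ?_
      filter_upwards [h3, h4] with h h5 h6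
      by_cases hh : h ∈ P
      · exact h5 hh
      · exact h6 hh
  obtain ⟨g₀, b₀, hb₀⟩ : ∃ g b, P = (act 1 g (H b))ᶜ := by
    obtain ⟨g, x, h⟩ := half_compl hP
    exact ⟨g, x, by rw [← h, compl_compl]⟩
  subst hb₀
  obtain ⟨g, b, -, hs, hin⟩ := exists_innermost hQ g₀ b₀ hPs
  have hall : ∀ x, ¬ Splits (act 1 g (H x)) Q := by
    intro x
    by_cases hxb : x = b
    · subst hxb
      intro hsx
      refine hnc _ (act_H_mem_half 1 g x) ⟨hsx.1, hsx.2, hs.1, hs.2⟩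
    · exact hin x hxb
  refine ⟨g, {x | ∀ᶠ h in cofinite, h ∈ act 1 g (H x) → h ∈ Q}, ?_⟩
  set A : Set (Letter N) := {x | ∀ᶠ h in cofinite, h ∈ act 1 g (H x) → h ∈ Q} with hA
  have h3 : ∀ᶠ h in cofinite, ∀ x, x ∈ A → h ∈ act 1 g (H x) → h ∈ Q := by
    rw [eventually_all]
    intro x
    by_cases hxA : x ∈ A
    · exact Eventually.mono hxA fun _ h _ => h
    · exact Eventually.of_forall fun h hh => absurd hh hxA
  have h4 : ∀ᶠ h in cofinite, ∀ x, x ∉ A → h ∈ act 1 g (H x) → h ∉ Q := by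
    rw [eventually_all]
    intro x
    by_cases hxA : x ∈ A
    · exact Eventually.of_forall fun h hh => absurd hxA hh
    · exact ((not_splits (hall x)).resolve_left hxA).mono fun _ h _ => h
  have h5 : ∀ᶠ h in cofinite, g⁻¹ * h ≠ 1 :=
    (mul_right_injective g⁻¹).tendsto_cofinite.eventually eventually_ne_one
  filter_upwards [h3, h4, h5] with h h3 h4 h5
  obtain ⟨x, hx⟩ := exists_mem_H h5
  have hx' : h ∈ act 1 g (H x) := by simpa [mem_act] using hx
  constructor
  · rintro ⟨y, hy, hy'⟩
    exact h3 y hy hy'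
  · intro hhQ
    by_contra hn
    refine h4 x (fun hxA => hn ⟨x, hxA, hx'⟩) hx' hhQ

theorem exists_HA {N : ℕ} (hN : 2 ≤ N) (α : MulAut (F N)) {Q : Set (F N)} (hQ : AI Q)
    (h1 : ∃ᶠ h in cofinite, h ∈ Q) (h2 : ∃ᶠ h in cofinite, h ∉ Q)
    (hnc : ∀ P ∈ half α, ¬ Cross P Q)
    (hne : ∀ P ∈ half α, ¬ ∀ᶠ h in cofinite, (h ∈ P ↔ h ∈ Q)) :
    ∃ g A, ∀ᶠ h in cofinite, (h ∈ act α g (HA A) ↔ h ∈ Q) := by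
  have e : ∀ S : Set (F N), act α 1 (act α⁻¹ 1 S) = S := by
    intro S; rw [act_act]; simp [act_one]
  have hP : ∀ P ∈ half (1 : MulAut (F N)), act α 1 P ∈ half α := by
    intro P hP
    have := half_act hP α 1
    rwa [mul_one] at this
  obtain ⟨g, A, hgA⟩ := exists_HA_one hN (hQ.act α⁻¹ 1)
    ((frequently_act (p := fun h => h ∈ Q) α⁻¹ 1).2 h1)
    ((frequently_act (p := fun h => h ∉ Q) α⁻¹ 1).2 h2)
    (fun P hP' hc => hnc _ (hP P hP') (by rw [← e Q]; exact (cross_act _ _).2 hc))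
    (fun P hP' hc => hne _ (hP P hP') (by rw [← e Q]; exact (almostEq_act _ _).2 hc))
  refine ⟨α g, A, ?_⟩
  have e' : ∀ S : Set (F N), act α (α g) S = act α 1 (act 1 g S) := by
    intro S; rw [act_act]; simp
  rw [e', ← e Q]
  exact (almostEq_act _ _).2 hgA

/-! ### Bases with the same half-spaces -/

/-- Two sets are almost equal if they differ by finitely many elements. -/
def AlmostEq {N : ℕ} (S T : Set (F N)) : Prop := ∀ᶠ h in cofinite, (h ∈ S ↔ h ∈ T)

theorem AlmostEq.symm {N : ℕ} {S T : Set (F N)} (h : AlmostEq S T) : AlmostEq T S :=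
  Eventually.mono h fun _ => Iff.symm

theorem AlmostEq.trans {N : ℕ} {S T R : Set (F N)} (h : AlmostEq S T) (h' : AlmostEq T R) :
    AlmostEq S R := by
  filter_upwards [h, h'] with x h1 h2
  exact h1.trans h2

theorem AlmostEq.compl {N : ℕ} {S T : Set (F N)} (h : AlmostEq S T) : AlmostEq Sᶜ Tᶜ :=
  Eventually.mono h fun _ hh => not_congr hh

theorem AlmostEq.act {N : ℕ} {S T : Set (F N)} (h : AlmostEq S T) (α : MulAut (F N)) (g : F N) :
    AlmostEq (act α g S) (act α g T) := (almostEq_act α g).2 h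

theorem AlmostEq.of_act {N : ℕ} {S T : Set (F N)} {α : MulAut (F N)} {g : F N}
    (h : AlmostEq (Whitehead.act α g S) (Whitehead.act α g T)) : AlmostEq S T :=
  (almostEq_act α g).1 h

theorem exists_third {N : ℕ} (hN : 2 ≤ N) (x y : Letter N) : ∃ z, z ≠ x ∧ z ≠ y := by
  by_contra! h
  have h1 : (Finset.univ : Finset (Letter N)) ⊆ {x, y} := by
    intro z _
    by_cases hz : z = x
    · simp [hz]
    · simp [h z hz]
  have h2 := Finset.card_le_card h1
  have h3 := Finset.card_le_two (a := x) (b := y)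
  rw [Finset.card_univ, Fintype.card_prod, Fintype.card_fin, Fintype.card_bool] at h2
  omega

theorem not_almostEq_H_compl {N : ℕ} (hN : 2 ≤ N) (x y : Letter N) :
    ¬ AlmostEq (H x) (H y)ᶜ := by
  intro h
  obtain ⟨z, hzx, hzy⟩ := exists_third hN x y
  obtain ⟨g, hg, hg'⟩ := ((frequently_H z).and_eventually h).exists
  exact hzx (H_disjoint hg (hg'.2 fun h => hzy (H_disjoint hg h)))

/-- Almost inclusion of one half-space at the root in another is equality. -/
theorem eq_of_almost_subset {N : ℕ} {x y : Letter N}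
    (h : ∀ᶠ h in cofinite, h ∈ H x → h ∈ H y) : x = y := by
  obtain ⟨g, hg, hg'⟩ := ((frequently_H x).and_eventually h).exists
  exact H_disjoint hg (hg' hg)

theorem one_notMem_of_almostEq {N : ℕ} (hN : 2 ≤ N) {P : Set (F N)}
    (hP : P ∈ half (1 : MulAut (F N))) {y : Letter N} (h : AlmostEq P (H y)) : (1 : F N) ∉ P := by
  intro h1
  obtain ⟨z, hz⟩ := half_subset_H (half_compl hP) (fun h => h h1)
  obtain ⟨w, hwz, hwy⟩ := exists_third hN z y
  obtain ⟨g, hg, hg'⟩ := ((frequently_H w).and_eventually h).exists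
  exact hwz (H_disjoint hg (hz fun h' => hwy (H_disjoint hg (hg'.1 h'))))

/-- A translate of a half-space at the root is almost equal to a half-space at the root only in the
trivial case. -/
theorem eq_one_of_almostEq {N : ℕ} (hN : 2 ≤ N) {q : F N} {x y : Letter N}
    (h : AlmostEq (act 1 q (H x)) (H y)) : q = 1 ∧ x = y := by
  have h1 := one_notMem_of_almostEq hN (act_H_mem_half 1 q x) h
  have h1' : q⁻¹ ∉ H x := by simpa [mem_act] using h1
  have h2 : AlmostEq (act 1 q⁻¹ (H y)) (H x) := by
    have := (h.act 1 q⁻¹).symm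
    rw [act_act] at this
    simpa [act_one] using this
  have h3 := one_notMem_of_almostEq hN (act_H_mem_half 1 q⁻¹ y) h2
  have h3' : q ∉ H y := by simpa [mem_act] using h3
  have hq : q = 1 := by
    by_contra hq
    obtain ⟨u, hu⟩ := exists_mem_H hq
    have h4 : ∃ᶠ h in cofinite, h ∈ act 1 q (H x) :=
      (frequently_act (p := fun h => h ∈ H x) 1 q).2 (frequently_H x)
    obtain ⟨g, hg, hg'⟩ := (h4.and_eventually h).exists
    have hg1 : q⁻¹ * g ∈ H x := by simpa [mem_act] using hg
    have := mul_mem_H (h := q⁻¹ * g) hu (fun z hz hz' => h1' (by rwa [H_disjoint hg1 hz']))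
    rw [mul_inv_cancel_left] at this
    exact h3' (by rwa [H_disjoint (hg'.1 hg) this])
  refine ⟨hq, eq_of_almost_subset ?_⟩
  subst hq
  rw [act_one] at h
  exact Eventually.mono h fun _ hh => hh.1

/-- The normalized case: one half-space at the root is mapped to a half-space at the root. -/
theorem exists_almostEq_H {N : ℕ} (hN : 2 ≤ N) (γ : MulAut (F N))
    (hγ : ∀ x, ∃ k y, AlmostEq (act γ 1 (H x)) (act 1 k (H y))) {a b : Letter N}
    (hab : AlmostEq (act γ 1 (H a)) (H b)) (y : Letter N) :
    ∃ x, AlmostEq (act γ 1 (H x)) (H y) := by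
  choose k π hk using hγ
  have hinj : Function.Injective π := by
    intro x x' hxx
    have h1 : AlmostEq (act γ 1 (H x')) (act γ 1 (act 1 (γ⁻¹ (k x' * (k x)⁻¹)) (H x))) := by
      have e : act γ 1 (act 1 (γ⁻¹ (k x' * (k x)⁻¹)) (H x)) =
          act 1 (k x' * (k x)⁻¹) (act γ 1 (H x)) := by
        rw [act_act, act_act]; simp [MulAut.inv_def]
      have e2 : act 1 (k x' * (k x)⁻¹) (act 1 (k x) (H (π x))) = act 1 (k x') (H (π x')) := by
        rw [act_act, hxx]; simp
      rw [e]
      refine (hk x').trans ?_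
      rw [← e2]
      exact ((hk x).act 1 _).symm
    exact (eq_one_of_almostEq hN h1.of_act.symm).2
  by_cases hyb : y = b
  · exact ⟨a, by rwa [hyb]⟩
  obtain ⟨x', hx'⟩ := (Finite.injective_iff_surjective.1 hinj) y
  have hdisj : ∀ᶠ h in cofinite, ¬ (h ∈ H y ∧ h ∈ H b) :=
    Eventually.of_forall fun h hh => hyb (H_disjoint hh.1 hh.2)
  obtain ⟨R, hR, hRy⟩ : ∃ R ∈ half (1 : MulAut (F N)), AlmostEq (act γ 1 R) (H y) := by
    refine ⟨act 1 (γ⁻¹ (k x')⁻¹) (H x'), act_H_mem_half _ _ _, ?_⟩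
    have e : act γ 1 (act 1 (γ⁻¹ (k x')⁻¹) (H x')) = act 1 (k x')⁻¹ (act γ 1 (H x')) := by
      rw [act_act, act_act]; simp [MulAut.inv_def]
    have e2 : act 1 (k x')⁻¹ (act 1 (k x') (H (π x'))) = H y := by
      rw [act_act, hx']; simp [act_one]
    rw [e, ← e2]
    exact (hk x').act 1 _
  have hRa : ∀ᶠ h in cofinite, ¬ (h ∈ R ∧ h ∈ H a) := by
    rw [← eventually_act (p := fun h => ¬ (h ∈ R ∧ h ∈ H a)) γ 1]
    filter_upwards [hRy, hab, hdisj] with h h1 h2 h3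
    rw [← h1, ← h2] at h3
    exact h3
  by_cases h1R : (1 : F N) ∈ R
  · exfalso
    obtain ⟨z, hz⟩ := half_subset_H (half_compl hR) (fun h => h h1R)
    have haz : a = z := eq_of_almost_subset
      (hRa.mono fun h hh hha => hz fun hhR => hh ⟨hhR, hha⟩)
    subst haz
    have hR' : AlmostEq R (H a)ᶜ := by
      filter_upwards [hRa] with h hh
      exact ⟨fun h1 h2 => hh ⟨h1, h2⟩, fun h1 => by_contra fun h2 => h1 (hz h2)⟩
    have := (hR'.act γ 1).trans (hab.compl)
    exact not_almostEq_H_compl hN y b (hRy.symm.trans this)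
  · obtain ⟨x₁, hx₁⟩ := half_subset_H hR h1R
    have hfR : ∃ᶠ h in cofinite, h ∈ R := by
      rw [← frequently_act (p := fun h => h ∈ R) γ 1]
      exact ((frequently_H y).and_eventually hRy).mono fun h hh => hh.2.2 hh.1
    have hx₁a : x₁ ≠ a := by
      rintro rfl
      obtain ⟨h, h1, h2⟩ := (hfR.and_eventually hRa).exists
      exact h2 ⟨h1, hx₁ h1⟩
    refine ⟨x₁, ?_⟩
    set T := act 1 (k x₁) (H (π x₁)) with hT
    have hT' : AlmostEq (act γ 1 (H x₁)) T := hk x₁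
    have hThalf : T ∈ half (1 : MulAut (F N)) := act_H_mem_half _ _ _
    have hyT : ∀ᶠ h in cofinite, h ∈ H y → h ∈ T := by
      filter_upwards [hRy, hT'] with h h1 h2 h3
      exact h2.1 (hx₁ (h1.2 h3))
    have hTb : ∀ᶠ h in cofinite, h ∈ T → h ∉ H b := by
      filter_upwards [hT', hab] with h h1 h2 h3 h4
      exact hx₁a (H_disjoint (h1.2 h3) (h2.2 h4))
    by_cases h1T : (1 : F N) ∈ T
    · exfalso
      obtain ⟨z, hz⟩ := half_subset_H (half_compl hThalf) (fun h => h h1T)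
      have hbz : b = z := eq_of_almost_subset
        (hTb.mono fun h hh hhb => hz fun hhT => hh hhT hhb)
      subst hbz
      have hT2 : AlmostEq T (H b)ᶜ := by
        filter_upwards [hTb] with h hh
        exact ⟨hh, fun h1 => by_contra fun h2 => h1 (hz h2)⟩
      have : AlmostEq (act γ 1 (H x₁)) (act γ 1 (H a)ᶜ) :=
        (hT'.trans hT2).trans hab.compl.symm
      exact not_almostEq_H_compl hN _ _ this.of_act
    · obtain ⟨z, hz⟩ := half_subset_H hThalf h1T
      have hyz : y = z := eq_of_almost_subset (hyT.mono fun h h1 h2 => hz (h1 h2))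
      subst hyz
      refine hT'.trans ?_
      filter_upwards [hyT] with h hh
      exact ⟨fun h1 => hz h1, hh⟩

/-- A basis all of whose half-spaces are half-spaces of the standard basis is obtained from it by a
permutation of the letters and a conjugation. -/
theorem exists_firstKind {N : ℕ} (hN : 2 ≤ N) (γ : MulAut (F N))
    (hγ : ∀ x, ∃ P ∈ half (1 : MulAut (F N)), AlmostEq P (act γ 1 (H x))) :
    ∃ (u : F N) (ρ : MulAut (F N)), IsFirstKind ρ ∧ γ = MulAut.conj u * ρ := by
  have hγ' : ∀ x, ∃ k y, AlmostEq (act γ 1 (H x)) (act 1 k (H y)) := by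
    intro x
    obtain ⟨_, ⟨k, y, rfl⟩, h⟩ := hγ x
    exact ⟨k, y, h.symm⟩
  choose k π hk using hγ'
  set a : Letter N := (⟨0, by omega⟩, true)
  set u := k a with hu
  set ρ := (MulAut.conj u)⁻¹ * γ with hρ
  have hconj : ∀ x, AlmostEq (act ρ 1 (H x)) (act 1 (u⁻¹ * k x) (H (π x))) := by
    intro x
    have h1 : AlmostEq (act ρ 1 (H x)) (act 1 u⁻¹ (act γ 1 (H x))) := by
      have h2 := (AI_H x).act γ 1 (u⁻¹)
      have h3 : ∀ᶠ h in cofinite, (u * h * u⁻¹ ∈ act γ 1 (H x) ↔ u * h ∈ act γ 1 (H x)) :=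
        (mul_right_injective u).tendsto_cofinite.eventually h2
      filter_upwards [h3] with h hh
      have e1 : h ∈ act ρ 1 (H x) ↔ u * h * u⁻¹ ∈ act γ 1 (H x) := by
        simp only [mem_act, hρ, mul_inv_rev, inv_inv, inv_one, one_mul, MulAut.mul_apply,
          MulAut.conj_apply]
      have e2 : h ∈ act 1 u⁻¹ (act γ 1 (H x)) ↔ u * h ∈ act γ 1 (H x) := by
        rw [mem_act]; simp
      rw [e1, e2, hh]
    refine h1.trans ?_
    have := (hk x).act 1 u⁻¹
    rw [act_act 1 1] at this
    simpa using this
  have hab : AlmostEq (act ρ 1 (H a)) (H (π a)) := by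
    have := hconj a
    rwa [← hu, inv_mul_cancel, act_one] at this
  have hsurj := exists_almostEq_H hN ρ (fun x => ⟨_, _, hconj x⟩) hab
  choose r hr using hsurj
  have hrinj : Function.Injective r := by
    intro y y' hyy
    have h1 := (hr y).symm.trans (hyy ▸ hr y')
    exact eq_of_almost_subset (Eventually.mono h1 fun _ hh => hh.1)
  have hall : ∀ x, ∃ y, AlmostEq (act ρ 1 (H x)) (H y) := by
    intro x
    obtain ⟨y, hy⟩ := Finite.injective_iff_surjective.1 hrinj x
    exact ⟨y, hy ▸ hr y⟩
  choose t ht using hall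
  have htinj : Function.Injective t := by
    intro x x' hxx
    have h1 : AlmostEq (act ρ 1 (H x)) (act ρ 1 (H x')) := (ht x).trans (hxx ▸ (ht x').symm)
    exact eq_of_almost_subset (Eventually.mono h1.of_act fun _ hh => hh.1)
  refine ⟨u, ρ, ⟨Equiv.ofBijective t (Finite.injective_iff_bijective.1 htinj), fun x => ?_⟩, ?_⟩
  · change ρ (elt x) = elt (t x)
    have h1 : AlmostEq (act 1 (ρ (elt x)) (H (t (inv x)))) (act 1 (elt (t x)) (H (inv (t x)))) := by
      have h2 := (ht x).compl
      have e1 : (act ρ 1 (H x))ᶜ = act 1 (ρ (elt x)) (act ρ 1 (H (inv x))) := by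
        rw [compl_act_H, act_act]; simp
      have e2 : (H (t x))ᶜ = act 1 (elt (t x)) (H (inv (t x))) := by
        have := compl_act_H 1 1 (t x)
        rwa [act_one, one_mul, MulAut.one_apply] at this
      rw [e1, e2] at h2
      exact ((ht (inv x)).act 1 _).symm.trans h2
    have h3 := h1.act 1 (elt (t x))⁻¹
    rw [act_act, act_act, MulAut.one_apply, MulAut.one_apply, inv_mul_cancel, mul_one,
      act_one] at h3
    exact (inv_mul_eq_one.1 (eq_one_of_almostEq hN h3).1).symm
  · rw [hρ, mul_inv_cancel_left]

/-! ### Parity of cuts -/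

open Classical in
theorem cut_cast_eq_sum {N : ℕ} (k : F N) {S : Set (F N)} {T : Finset (F N)}
    (hT : sepSet k S ⊆ T) : (cut k S : ZMod 2) =
      ∑ h ∈ T, ((if h ∈ S then 1 else 0) + (if h * k ∈ S then 1 else 0)) := by
  rw [cut_eq_sum k hT, Nat.cast_sum]
  refine Finset.sum_congr rfl fun h _ => ?_
  simp only [sepSet, Set.mem_ofPred_eq]
  by_cases h1 : h ∈ S <;> by_cases h2 : h * k ∈ S <;> simp [h1, h2]
  exact (CharTwo.add_self_eq_zero (1 : ZMod 2)).symm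

/-- The parity of the cut function ignores finite changes. -/
theorem cut_parity_congr {N : ℕ} (k : F N) {S S' : Set (F N)} (hS : AI S) (hS' : AI S')
    (h : AlmostEq S S') : (cut k S : ZMod 2) = cut k S' := by
  classical
  have hfin : {h | ¬ (h ∈ S ↔ h ∈ S')}.Finite := by
    have h' := h
    rwa [AlmostEq, eventually_cofinite] at h'
  set E := {h | ¬ (h ∈ S ↔ h ∈ S')} with hE
  have hfin' : {h | h * k ∈ E}.Finite := hfin.preimage (mul_left_injective k).injOn
  set T := (sepSet_finite hS k).toFinset ∪ (sepSet_finite hS' k).toFinset ∪ hfin.toFinset ∪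
    hfin'.toFinset with hT
  rw [cut_cast_eq_sum k (T := T) (by intro h hh; simp [hT, hh]),
    cut_cast_eq_sum k (T := T) (by intro h hh; simp [hT, hh]), ← sub_eq_zero,
    ← Finset.sum_sub_distrib]
  have e : ∀ h, ((((if h ∈ S then 1 else 0) + (if h * k ∈ S then 1 else 0)) -
      ((if h ∈ S' then 1 else 0) + (if h * k ∈ S' then 1 else 0)) : ZMod 2)) =
      (if h ∈ E then 1 else 0) + (if h * k ∈ E then 1 else 0) := by
    intro h
    simp only [hE, Set.mem_ofPred_eq]
    by_cases h1 : h ∈ S <;> by_cases h2 : h * k ∈ S <;> by_cases h3 : h ∈ S' <;>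
      by_cases h4 : h * k ∈ S' <;> simp [h1, h2, h3, h4] <;> decide
  simp only [e]
  rw [Finset.sum_add_distrib, Finset.sum_boole, Finset.sum_boole]
  have c1 : (T.filter fun h => h ∈ E).card = E.ncard := by
    rw [← Set.ncard_coe_finset]
    congr 1
    ext h
    simp only [Finset.coe_filter, Set.mem_ofPred_eq]
    refine ⟨fun hh => hh.2, fun hh => ⟨?_, hh⟩⟩
    simp [hT, hh]
  have c2 : (T.filter fun h => h * k ∈ E).card = E.ncard := by
    rw [← ncard_mul_right k E, ← Set.ncard_coe_finset]
    congr 1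
    ext h
    simp only [Finset.coe_filter, Set.mem_ofPred_eq]
    refine ⟨fun hh => hh.2, fun hh => ⟨?_, hh⟩⟩
    simp [hT, hh]
  rw [c1, c2]
  exact CharTwo.add_self_eq_zero _

theorem AI_HA {N : ℕ} (A : Set (Letter N)) : AI (HA A) := by
  intro k
  have : ∀ᶠ h in cofinite, ∀ x, (h * k ∈ H x ↔ h ∈ H x) := eventually_all.2 fun x => AI_H x k
  filter_upwards [this] with h hh
  exact ⟨fun ⟨x, hx, h'⟩ => ⟨x, hx, (hh x).1 h'⟩, fun ⟨x, hx, h'⟩ => ⟨x, hx, (hh x).2 h'⟩⟩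

open Classical in
theorem cut_HA_parity {N : ℕ} (k : F N) (A : Set (Letter N)) :
    (cut k (HA A) : ZMod 2) = ∑ x ∈ Finset.univ.filter (· ∈ A), (cut k (H x) : ZMod 2) := by
  set T := (sepSet_finite (AI_HA A) k).toFinset ∪
    Finset.univ.biUnion fun x => (sepSet_finite (AI_H x) k).toFinset with hT
  have h1 : ∀ x, sepSet k (H x) ⊆ T := by
    intro x h hh
    simp only [hT, Finset.coe_union, Set.mem_union, Finset.mem_coe, Finset.mem_biUnion]
    exact Or.inr ⟨x, Finset.mem_univ _, by simpa using hh⟩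
  rw [cut_cast_eq_sum k (T := T) (by intro h hh; simp [hT, hh])]
  simp only [fun x => cut_cast_eq_sum k (h1 x)]
  rw [Finset.sum_comm]
  have e : ∀ h, ((if h ∈ HA A then 1 else 0 : ZMod 2)) =
      ∑ x ∈ Finset.univ.filter (· ∈ A), if h ∈ H x then 1 else 0 := by
    intro h
    by_cases hh : h ∈ HA A
    · obtain ⟨x, hx, hhx⟩ := hh
      rw [if_pos ⟨x, hx, hhx⟩, Finset.sum_eq_single x]
      · rw [if_pos hhx]
      · intro y _ hyx
        rw [if_neg fun hhy => hyx (H_disjoint hhy hhx)]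
      · intro hn
        simp [hx] at hn
    · rw [if_neg hh, Finset.sum_eq_zero]
      intro x hx
      rw [if_neg fun hhx => hh ⟨x, by simpa using hx, hhx⟩]
  refine Finset.sum_congr rfl fun h _ => ?_
  rw [e, e, Finset.sum_add_distrib]

theorem cut_act_H {N : ℕ} (α : MulAut (F N)) (g k : F N) (x : Letter N) :
    cut k (act α g (H x)) = cut k (act α 1 (H (x.1, true))) := by
  obtain ⟨i, b⟩ := x
  have h1 : ∀ g x, cut k (act α g (H x)) = cut k (act α 1 (H x)) := by
    intro g x; rw [cut_act, cut_act]
  cases b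
  · rw [← cut_compl, compl_act_H, h1]
    rfl
  · exact h1 _ _

/-- If a union of half-spaces is cut an odd number of times, then so is one of them whose inverse
letter lies outside. -/
theorem exists_odd_letter {N : ℕ} (α : MulAut (F N)) (g k : F N) (A : Set (Letter N))
    (h : (cut k (act α g (HA A)) : ZMod 2) ≠ 0) :
    ∃ a ∈ A, inv a ∉ A ∧ (cut k (act α 1 (H (a.1, true))) : ZMod 2) ≠ 0 := by
  classical
  by_contra! hcon
  refine h ?_
  rw [cut_act, cut_HA_parity]
  have e : ∀ x, (cut (α⁻¹ k) (H x) : ZMod 2) = cut k (act α 1 (H (x.1, true))) := by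
    intro x
    rw [← cut_act_H α 1 k x, cut_act]
  refine Finset.sum_involution (fun x _ => if inv x ∈ A then inv x else x) ?_ ?_ ?_ ?_
  · intro x hx
    have hx' : x ∈ A := by simpa using hx
    split_ifs with hi
    · rw [e, e]
      exact CharTwo.add_self_eq_zero _
    · rw [e, hcon x hx' hi, add_zero]
  · intro x hx hne
    have hx' : x ∈ A := by simpa using hx
    split_ifs with hi
    · exact inv_ne x
    · exact absurd (by rw [e, hcon x hx' hi]) hne
  · intro x hx
    split_ifs with hi
    · simpa using hi
    · exact hx
  · intro x hx
    have hx' : x ∈ A := by simpa using hx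
    by_cases hi : inv x ∈ A
    · simp [hi, inv_inv', hx']
    · simp [hi]

/-! ### Comparing two bases -/

/-- The number of half-spaces of the basis `α(A)` that cross a set. -/
noncomputable def crossNum {N : ℕ} (α : MulAut (F N)) (S : Set (F N)) : ℕ :=
  {P | P ∈ half α ∧ Cross P S}.ncard

/-- `S` is almost equal to a half-space of the basis `α(A)`. -/
def Matched {N : ℕ} (α : MulAut (F N)) (S : Set (F N)) : Prop := ∃ P ∈ half α, AlmostEq P S

theorem half_translate {N : ℕ} {α : MulAut (F N)} {P : Set (F N)} (hP : P ∈ half α) (g : F N) :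
    act 1 g P ∈ half α := by
  have := half_act hP 1 g
  rwa [one_mul] at this

theorem translate_inv {N : ℕ} (g : F N) (S : Set (F N)) : act 1 g (act 1 g⁻¹ S) = S := by
  rw [act_act]; simp [act_one]

theorem translate_inv' {N : ℕ} (g : F N) (S : Set (F N)) : act 1 g⁻¹ (act 1 g S) = S := by
  rw [act_act]; simp [act_one]

theorem crossNum_translate {N : ℕ} (α : MulAut (F N)) (g : F N) (S : Set (F N)) :
    crossNum α (act 1 g S) = crossNum α S := by
  have : {P | P ∈ half α ∧ Cross P (act 1 g S)} = act 1 g '' {P | P ∈ half α ∧ Cross P S} := by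
    ext P
    constructor
    · rintro ⟨hP, hc⟩
      refine ⟨act 1 g⁻¹ P, ⟨half_translate hP _, ?_⟩, translate_inv g P⟩
      rw [← cross_act 1 g, translate_inv]
      exact hc
    · rintro ⟨P, ⟨hP, hc⟩, rfl⟩
      exact ⟨half_translate hP g, (cross_act _ _).2 hc⟩
  rw [crossNum, this, Set.ncard_image_of_injective _ (act_one_injective 1 g)]
  rfl

theorem crossNum_compl {N : ℕ} (α : MulAut (F N)) (S : Set (F N)) :
    crossNum α Sᶜ = crossNum α S := by
  have : ∀ P, Cross P Sᶜ ↔ Cross P S := fun P =>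
    ⟨fun h => by simpa using h.compl_right, fun h => h.compl_right⟩
  simp only [crossNum, this]

theorem Cross.congr_right {N : ℕ} {P Q Q' : Set (F N)} (h : Cross P Q) (hQ : AlmostEq Q Q') :
    Cross P Q' := (h.symm.congr hQ).symm

theorem crossNum_congr {N : ℕ} (α : MulAut (F N)) {S S' : Set (F N)} (h : AlmostEq S S') :
    crossNum α S = crossNum α S' := by
  have : ∀ P, Cross P S ↔ Cross P S' := fun P =>
    ⟨fun hc => hc.congr_right h, fun hc => hc.congr_right h.symm⟩
  simp only [crossNum, this]

theorem matched_translate {N : ℕ} (α : MulAut (F N)) (g : F N) (S : Set (F N)) :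
    Matched α (act 1 g S) = Matched α S := by
  refine propext ⟨?_, ?_⟩
  · rintro ⟨P, hP, h⟩
    refine ⟨act 1 g⁻¹ P, half_translate hP _, ?_⟩
    have := h.act 1 g⁻¹
    rwa [translate_inv'] at this
  · rintro ⟨P, hP, h⟩
    exact ⟨act 1 g P, half_translate hP g, h.act 1 g⟩

theorem matched_compl {N : ℕ} (α : MulAut (F N)) (S : Set (F N)) :
    Matched α Sᶜ = Matched α S := by
  refine propext ⟨?_, ?_⟩
  · rintro ⟨P, hP, h⟩
    exact ⟨Pᶜ, half_compl hP, by simpa using h.compl⟩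
  · rintro ⟨P, hP, h⟩
    exact ⟨Pᶜ, half_compl hP, h.compl⟩

/-- Invariants of sets under translation and complement depend only on the basis element. -/
theorem inv_act_H {N : ℕ} {X : Sort*} {f : Set (F N) → X} (h1 : ∀ g S, f (act 1 g S) = f S)
    (h2 : ∀ S, f Sᶜ = f S) (α : MulAut (F N)) (g : F N) (x : Letter N) :
    f (act α g (H x)) = f (act α 1 (H (x.1, true))) := by
  have h3 : ∀ g S, f (act α g S) = f (act α 1 S) := by
    intro g S
    have : act α g S = act 1 g (act α 1 S) := by rw [act_act]; simp
    rw [this, h1]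
  obtain ⟨i, b⟩ := x
  cases b
  · rw [← h2, compl_act_H, h3]
    rfl
  · exact h3 _ _

theorem inv_act_wh {N : ℕ} {X : Sort*} {f : Set (F N) → X} (h1 : ∀ g S, f (act 1 g S) = f S)
    (h2 : ∀ S, f Sᶜ = f S) (α : MulAut (F N)) {A : Set (Letter N)} {a : Letter N} (i : Fin N)
    (hi : i ≠ a.1) :
    f (act (α * wh A a) 1 (H (i, true))) = f (act α 1 (H (i, true))) := by
  have h3 := congrArg (fun S => f (act α 1 S)) (act_wh_H (A := A) (a := a) (x := (i, true)) hi)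
  simp only [act_act] at h3
  rw [← h3]
  exact (inv_act_H h1 h2 _ _ (i, true)).symm

theorem inv_act_wh_self {N : ℕ} {X : Sort*} {f : Set (F N) → X}
    (h1 : ∀ g S, f (act 1 g S) = f S) (h2 : ∀ S, f Sᶜ = f S) (α : MulAut (F N))
    {A : Set (Letter N)} {a : Letter N} (ha : a ∈ A) (ha' : inv a ∉ A) :
    f (act (α * wh A a) 1 (H (a.1, true))) = f (act α 1 (HA A)) := by
  rw [← inv_act_H h1 h2 (α * wh A a) 1 a, ← act_wh_H_self ha ha', act_act]
  simp

/-- The number of crossings between the half-spaces of two bases. -/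
noncomputable def totalCross {N : ℕ} (α β : MulAut (F N)) : ℕ :=
  ∑ i, crossNum α (act β 1 (H (i, true)))

open Classical in
/-- The number of elements of the basis `β(A)` whose half-spaces are not half-spaces of the basis
`α(A)`. -/
noncomputable def unmatched {N : ℕ} (α β : MulAut (F N)) : Finset (Fin N) :=
  Finset.univ.filter fun i => ¬ Matched α (act β 1 (H (i, true)))

theorem totalCross_wh_add {N : ℕ} (α β : MulAut (F N)) {A : Set (Letter N)} {a : Letter N}
    (ha : a ∈ A) (ha' : inv a ∉ A) :
    totalCross α (β * wh A a) + crossNum α (act β 1 (H (a.1, true))) =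
      totalCross α β + crossNum α (act β 1 (HA A)) := by
  rw [totalCross, totalCross, ← Finset.add_sum_erase _ _ (Finset.mem_univ a.1),
    ← Finset.add_sum_erase _ (fun i => crossNum α (act β 1 (H (i, true)))) (Finset.mem_univ a.1),
    inv_act_wh_self (crossNum_translate α) (crossNum_compl α) β ha ha',
    Finset.sum_congr rfl fun i hi => inv_act_wh (crossNum_translate α) (crossNum_compl α) β i
      (Finset.ne_of_mem_erase hi)]
  ring

/-- The corner of a half-space with a half-space of `α(A)` that crosses it has fewer crossings with
the half-spaces of `α(A)`. -/
theorem crossNum_corner_lt {N : ℕ} (α : MulAut (F N)) {R P : Set (F N)} (hR : AI R)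
    (hP : P ∈ half α) (hc : Cross R P) : crossNum α (R ∩ P) < crossNum α R := by
  refine Set.ncard_lt_ncard ?_ (finite_cross α hR)
  refine Set.ssubset_iff_subset_ne.2 ⟨?_, fun he => ?_⟩
  · have key : ∀ S, (∀ᶠ h in cofinite, h ∈ S → h ∈ P) → Cross S (R ∩ P) → Cross S R := by
      intro S hS ⟨c1, c2, c3, c4⟩
      refine ⟨c1.mono fun h hh => ⟨hh.1, hh.2.1⟩, ?_, c3.mono fun h hh => ⟨hh.1, hh.2.1⟩, ?_⟩
      · refine (c2.and_eventually hS).mono fun h hh => ⟨hh.1.1, fun hR => hh.1.2 ⟨hR, hh.2 hh.1.1⟩⟩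
      · exact (hc.2.2.2.and_eventually hS).mono fun h hh => ⟨fun h' => hh.1.2 (hh.2 h'), hh.1.1⟩
    rintro S ⟨hS, hcS⟩
    refine ⟨hS, ?_⟩
    have hn := not_cross_half hS hP
    simp only [Cross, not_and_or, not_frequently] at hn
    rcases hn with h | h | h | h
    · exfalso
      obtain ⟨x, hx, hx'⟩ := (hcS.1.and_eventually h).exists
      have := hx.2.2
      tauto
    · exact key S (h.mono fun x hx h' => by tauto) hcS
    · exfalso
      obtain ⟨x, hx, hx'⟩ := (hcS.2.2.1.and_eventually h).exists
      have := hx.2.2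
      tauto
    · have := key Sᶜ (h.mono fun x hx (h' : x ∉ S) => by tauto) hcS.compl_left
      simpa using this.compl_left
  · have h1 : P ∈ {P | P ∈ half α ∧ Cross P R} := ⟨hP, hc.symm⟩
    rw [← he] at h1
    obtain ⟨x, hx, hx'⟩ := h1.2.2.2.1.exists
    exact hx hx'.2

/-- Surgery when some half-spaces cross: a half-space of `β(A)` is replaced by its corner with a
half-space of `α(A)` along an innermost disc. The length grows at most by the weight of the new disc
minus the weight of the part that is cut off, and `m` bounds the latter from below. -/
theorem surgery_step {N : ℕ} (α β : MulAut (F N)) (c : F N) {P Q : Set (F N)} (hP : P ∈ half α)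
    (hQ : Q ∈ half β) (hc : Cross Q P) {m : ℝ}
    (hm : ∀ P' ∈ half α, ∀ R ∈ half β, Cross P' R → m ≤ sideWeight c P' R) :
    ∃ (A : Set (Letter N)) (a : Letter N),
      2 * (len ((β * wh A a)⁻¹ • cls c) : ℝ) ≤
        2 * len (β⁻¹ • cls c) + (sideWeight c Q P - m) ∧
      totalCross α (β * wh A a) < totalCross α β := by
  obtain ⟨g, a, A, P', ha, ha', hP', hsub, hcR, hal⟩ := surgery β (half_AI hP) hQ hc
  set R := (act β g (H (inv a)))ᶜ with hRdef
  have hRh : R ∈ half β := half_compl (act_H_mem_half _ _ _)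
  have hP'h : P' ∈ half α := by
    rcases hP' with rfl | rfl
    · exact hP
    · exact half_compl hP
  have hcR' : Cross R P' := by
    rcases hP' with rfl | rfl
    · exact hcR
    · exact hcR.compl_right
  have hsw : sideWeight c R P' = sideWeight c R P := by
    rcases hP' with rfl | rfl
    · rfl
    · exact sideWeight_compl_right c R P
  have hal' : AlmostEq (act β g (HA A)) (R ∩ P') := hal
  have hAIR := half_AI hRh
  have hAIP' := half_AI hP'h
  have hAIHA : AI (act β g (HA A)) := (AI_HA A).act β g
  have e1 : weight c (act β 1 (HA A)) = weight c (R ∩ P') := by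
    rw [← weight_congr c hAIHA (hAIR.inter hAIP') hal', weight_act, weight_act]
  have e2 : weight c R = weight c (act β 1 (H (a.1, true))) := by
    rw [hRdef, weight_compl, weight_act_H]
    rfl
  have e3 : crossNum α (act β 1 (HA A)) = crossNum α (R ∩ P') := by
    rw [← crossNum_congr α hal', ← crossNum_translate α g (act β 1 (HA A)), act_act]
    simp
  have e4 : crossNum α R = crossNum α (act β 1 (H (a.1, true))) := by
    rw [hRdef, crossNum_compl, inv_act_H (crossNum_translate α) (crossNum_compl α)]
    rfl
  refine ⟨A, a, ?_, ?_⟩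
  · have h1 := len_wh β c ha ha'
    have h2 := two_weight_inter_le c hAIR hAIP'
    have h3 := two_weight_eq c P' hAIR
    have h4 := sideWeight_mono c (half_AI hP) hsub
    have h5 := hm P'ᶜ (half_compl hP'h) R hRh hcR'.symm.compl_left
    rw [e1] at h1
    rw [← e2] at h1
    linarith
  · have h1 := totalCross_wh_add α β ha ha'
    have h2 := crossNum_corner_lt α hAIR hP'h hcR'
    omega

theorem frequently_act_H {N : ℕ} (α : MulAut (F N)) (g : F N) (x : Letter N) :
    ∃ᶠ h in cofinite, h ∈ act α g (H x) :=
  (frequently_act (p := fun h => h ∈ H x) α g).2 (frequently_H x)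

/-- Exchange when no half-spaces cross: a half-space of `α(A)` that is not a half-space of `β(A)` is
a union of half-spaces of `β(A)` at one vertex, and it can take the place of one of them. The parity
of the number of cuts by the dual generator selects one that is not a half-space of `α(A)`. -/
theorem exchange_step {N : ℕ} (hN : 2 ≤ N) (α β : MulAut (F N)) (c : F N)
    (hnc : ∀ P ∈ half α, ∀ Q ∈ half β, ¬ Cross P Q) {j : Fin N} (hj : j ∈ unmatched β α) :
    ∃ (A : Set (Letter N)) (a : Letter N), a.1 ∈ unmatched α β ∧
      (len ((β * wh A a)⁻¹ • cls c) : ℝ) + weight c (act β 1 (H (a.1, true))) =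
        len (β⁻¹ • cls c) + weight c (act α 1 (H (j, true))) ∧
      totalCross α (β * wh A a) ≤ totalCross α β ∧
      unmatched α (β * wh A a) ⊂ unmatched α β := by
  classical
  set Q := act α 1 (H (j, true)) with hQdef
  have hQh : Q ∈ half α := act_H_mem_half _ _ _
  have hjm : ¬ Matched β Q := by simpa [unmatched] using hj
  obtain ⟨g, A, hgA⟩ := exists_HA hN β (half_AI hQh) (frequently_act_H _ _ _)
    (by
      have := frequently_act_H α (1 * α (elt (j, true))) (inv (j, true))
      rw [← compl_act_H] at this
      exact this)
    (fun P hP hc => hnc Q hQh P hP hc.symm) (fun P hP h => hjm ⟨P, hP, h⟩)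
  have hgA' : AlmostEq (act β g (HA A)) Q := hgA
  have hAIHA : AI (act β g (HA A)) := (AI_HA A).act β g
  have hAIQ := half_AI hQh
  -- the generator dual to `Q` crosses `Q` exactly once
  set k := α (elt (j, true)) with hk
  have hkα : ∀ i, cut k (act α 1 (H (i, true))) = if i = j then 1 else 0 := by
    intro i
    rw [cut_act, hk, MulAut.inv_apply_self]
    have := cut_elt_mul_H (j, true) (i, true) (g := 1) (one_notMem_H _)
    rw [mul_one, cut_one, zero_add] at this
    rw [this]
    simp [eq_comm]
  have hodd : (cut k (act β g (HA A)) : ZMod 2) ≠ 0 := by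
    rw [cut_parity_congr k hAIHA hAIQ hgA', hQdef, hkα]
    simp
  obtain ⟨a, ha, ha', haodd⟩ := exists_odd_letter β g k A hodd
  have hum : ¬ Matched α (act β 1 (H (a.1, true))) := by
    rintro ⟨_, ⟨g', y, rfl⟩, hy⟩
    rw [← cut_parity_congr k (half_AI (act_H_mem_half _ _ _)) (half_AI (act_H_mem_half _ _ _)) hy,
      cut_act_H, hkα] at haodd
    have hyj : y.1 = j := by
      by_contra hne
      simp [hne] at haodd
    refine hjm ?_
    have h1 : Matched β (act α g' (H y)) := ⟨_, act_H_mem_half _ _ _, hy.symm⟩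
    rwa [inv_act_H (matched_translate β) (matched_compl β), hyj] at h1
  have e3 : crossNum α (act β 1 (HA A)) = 0 := by
    have : crossNum α (act β 1 (HA A)) = crossNum α Q := by
      rw [← crossNum_congr α hgA', ← crossNum_translate α g (act β 1 (HA A)), act_act]
      simp
    rw [this, crossNum, Set.ncard_eq_zero (finite_cross α hAIQ)]
    ext P
    simp only [Set.mem_ofPred_eq, Set.mem_empty_iff_false, iff_false]
    exact fun h => not_cross_half h.1 hQh h.2
  have e5 : Matched α (act β 1 (HA A)) := by
    rw [← matched_translate α g, act_act]
    simp only [one_mul, MulAut.one_apply, mul_one]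
    exact ⟨Q, hQh, hgA'.symm⟩
  have e1 : weight c (act β 1 (HA A)) = weight c Q := by
    rw [← weight_congr c hAIHA hAIQ hgA', weight_act, weight_act]
  refine ⟨A, a, by simpa [unmatched] using hum, ?_, ?_, ?_⟩
  · rw [← e1]
    exact len_wh β c ha ha'
  · have := totalCross_wh_add α β ha ha'
    omega
  · have hsame : ∀ i, i ≠ a.1 → (i ∈ unmatched α (β * wh A a) ↔ i ∈ unmatched α β) := by
      intro i hi
      simp only [unmatched, Finset.mem_filter, Finset.mem_univ, true_and]
      rw [inv_act_wh (matched_translate α) (matched_compl α) β i hi]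
    have ha1 : a.1 ∉ unmatched α (β * wh A a) := by
      simp only [unmatched, Finset.mem_filter, Finset.mem_univ, true_and, not_not]
      rw [inv_act_wh_self (matched_translate α) (matched_compl α) β ha ha']
      exact e5
    have ha2 : a.1 ∈ unmatched α β := by simpa [unmatched] using hum
    refine Finset.ssubset_iff_subset_ne.2 ⟨fun i hi => ?_, fun he => ha1 (he ▸ ha2)⟩
    by_cases hia : i = a.1
    · rw [hia]; exact ha2
    · exact (hsame i hia).1 hi

theorem sideWeight_translate {N : ℕ} (c g : F N) (P Q : Set (F N)) :
    sideWeight c (act 1 g P) (act 1 g Q) = sideWeight c P Q := by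
  rw [sideWeight_act]; simp

/-- Comparison of two bases with respect to a conjugacy class: either a Whitehead automorphism
makes the class shorter with respect to the first basis, or one brings the second basis closer to
the first one without making the class longer, or the bases agree up to conjugation and a
permutation of the letters. -/
theorem compare_bases {N : ℕ} (hN : 2 ≤ N) (α β : MulAut (F N)) (c : F N) :
    (∃ A a, len ((α * wh A a)⁻¹ • cls c) < len (α⁻¹ • cls c)) ∨
    (∃ A a, len ((β * wh A a)⁻¹ • cls c) ≤ len (β⁻¹ • cls c) ∧
      (totalCross α (β * wh A a) < totalCross α β ∨
        totalCross α (β * wh A a) ≤ totalCross α β ∧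
          (unmatched α (β * wh A a)).card < (unmatched α β).card)) ∨
    (∃ (u : F N) (ρ : MulAut (F N)), IsFirstKind ρ ∧ α⁻¹ * β = MulAut.conj u * ρ) := by
  by_cases hcr : ∃ P ∈ half α, ∃ Q ∈ half β, Cross P Q
  · -- representatives of the crossing pairs up to translation
    set Z : Set (Letter N × Set (F N)) :=
      {z | z.2 ∈ half β ∧ Cross z.2 (act α 1 (H z.1))} with hZ
    have hZfin : Z.Finite := by
      have : Z ⊆ ⋃ x : Letter N,
          (fun Q => (x, Q)) '' {Q | Q ∈ half β ∧ Cross Q (act α 1 (H x))} := by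
        rintro ⟨x, Q⟩ hz
        exact Set.mem_iUnion.2 ⟨x, Q, hz, rfl⟩
      exact (Set.finite_iUnion fun x =>
        (finite_cross β (half_AI (act_H_mem_half α 1 x))).image _).subset this
    have hrep : ∀ P ∈ half α, ∀ Q ∈ half β, Cross P Q → ∃ z ∈ Z,
        sideWeight c P Q = sideWeight c (act α 1 (H z.1)) z.2 ∧
        sideWeight c Q P = sideWeight c z.2 (act α 1 (H z.1)) := by
      rintro _ ⟨g, x, rfl⟩ Q hQ hc
      have e : act α 1 (H x) = act 1 g⁻¹ (act α g (H x)) := by rw [act_act]; simp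
      refine ⟨(x, act 1 g⁻¹ Q), ⟨half_translate hQ _, ?_⟩, ?_, ?_⟩
      · rw [e, cross_act]; exact hc.symm
      · rw [e, sideWeight_translate]
      · rw [e, sideWeight_translate]
    have hZne : Z.Nonempty := by
      obtain ⟨P, hP, Q, hQ, hc⟩ := hcr
      obtain ⟨z, hz, -⟩ := hrep P hP Q hQ hc
      exact ⟨z, hz⟩
    obtain ⟨z₁, hz₁, hm₁⟩ := Set.exists_min_image Z
      (fun z => sideWeight c (act α 1 (H z.1)) z.2) hZfin hZne
    obtain ⟨z₂, hz₂, hm₂⟩ := Set.exists_min_image Z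
      (fun z => sideWeight c z.2 (act α 1 (H z.1))) hZfin hZne
    rcases le_or_gt (sideWeight c z₂.2 (act α 1 (H z₂.1)))
      (sideWeight c (act α 1 (H z₁.1)) z₁.2) with hle | hlt
    · -- ties are broken in favour of surgery on the second basis
      right; left
      obtain ⟨A, a, h1, h2⟩ := surgery_step α β c (act_H_mem_half α 1 z₂.1) hz₂.1 hz₂.2
        (m := sideWeight c z₂.2 (act α 1 (H z₂.1))) (by
          intro P hP R hR hc
          obtain ⟨z, hz, e1, -⟩ := hrep P hP R hR hc
          rw [e1]
          exact hle.trans (hm₁ z hz))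
      refine ⟨A, a, ?_, Or.inl h2⟩
      have : (len ((β * wh A a)⁻¹ • cls c) : ℝ) ≤ len (β⁻¹ • cls c) := by linarith
      exact_mod_cast this
    · left
      obtain ⟨A, a, h1, -⟩ := surgery_step β α c hz₁.1 (act_H_mem_half α 1 z₁.1) hz₁.2.symm
        (m := sideWeight c z₂.2 (act α 1 (H z₂.1))) (by
          intro P hP R hR hc
          obtain ⟨z, hz, -, e1⟩ := hrep R hR P hP hc.symm
          rw [e1]
          exact hm₂ z hz)
      refine ⟨A, a, ?_⟩
      have : (len ((α * wh A a)⁻¹ • cls c) : ℝ) < len (α⁻¹ • cls c) := by linarith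
      exact_mod_cast this
  · push Not at hcr
    by_cases hβ : unmatched α β = ∅
    · right; right
      refine exists_firstKind hN _ fun x => ?_
      have h1 : Matched α (act β 1 (H (x.1, true))) := by
        by_contra hcon
        have : x.1 ∈ unmatched α β := by simpa [unmatched] using hcon
        rw [hβ] at this
        simp at this
      rw [← inv_act_H (matched_translate α) (matched_compl α) β 1 x] at h1
      obtain ⟨P, hP, h⟩ := h1
      refine ⟨act α⁻¹ 1 P, half_act_inv hP, ?_⟩
      have := h.act α⁻¹ 1
      rw [act_act (α⁻¹) β] at this
      simpa using this
    · have hβ' : (unmatched α β).Nonempty := Finset.nonempty_iff_ne_empty.2 hβ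
      have hcr' : ∀ Q ∈ half β, ∀ P ∈ half α, ¬ Cross Q P := fun Q hQ P hP hc =>
        hcr P hP Q hQ hc.symm
      have hα' : (unmatched β α).Nonempty := by
        obtain ⟨j, hj⟩ := hβ'
        obtain ⟨A, a, ha, -⟩ := exchange_step hN β α c hcr' hj
        exact ⟨_, ha⟩
      obtain ⟨i₀, hi₀, hmi⟩ := Finset.exists_min_image (unmatched β α)
        (fun i => weight c (act α 1 (H (i, true)))) hα'
      obtain ⟨j₀, hj₀, hmj⟩ := Finset.exists_min_image (unmatched α β)
        (fun i => weight c (act β 1 (H (i, true)))) hβ'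
      rcases le_or_gt (weight c (act α 1 (H (i₀, true)))) (weight c (act β 1 (H (j₀, true))))
        with hle | hlt
      · right; left
        obtain ⟨A, a, ha, h1, h2, h3⟩ := exchange_step hN α β c hcr hi₀
        refine ⟨A, a, ?_, Or.inr ⟨h2, Finset.card_lt_card h3⟩⟩
        have h4 := hmj _ ha
        have : (len ((β * wh A a)⁻¹ • cls c) : ℝ) ≤ len (β⁻¹ • cls c) := by linarith
        exact_mod_cast this
      · left
        obtain ⟨A, a, ha, h1, -, -⟩ := exchange_step hN β α c hcr' hj₀
        refine ⟨A, a, ?_⟩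
        have h4 := hmi _ ha
        have : (len ((α * wh A a)⁻¹ • cls c) : ℝ) < len (α⁻¹ • cls c) := by linarith
        exact_mod_cast this

/-! ### Whitehead's theorem -/

theorem conj_smul_cls {N : ℕ} (u : F N) (c : Cls N) : MulAut.conj u • c = c := by
  refine Quotient.inductionOn c fun x => ?_
  change ConjClasses.mk (u * x * u⁻¹) = ConjClasses.mk x
  exact (ConjClasses.mk_eq_mk_iff_isConj.2 (isConj_iff.2 ⟨u, rfl⟩)).symm

theorem IsFirstKind.inv {N : ℕ} {ρ : MulAut (F N)} (h : IsFirstKind ρ) : IsFirstKind ρ⁻¹ := by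
  obtain ⟨t, ht⟩ := h
  refine ⟨t.symm, fun x => ?_⟩
  have := ht (t.symm x)
  rw [Equiv.apply_symm_apply] at this
  rw [← this, MulAut.inv_apply_self]

/-- Well-founded induction on the distance between two bases. -/
theorem basis_induction {N : ℕ} {p : MulAut (F N) → Prop}
    (h : ∀ β, (∀ β', (totalCross 1 β' < totalCross 1 β ∨ totalCross 1 β' ≤ totalCross 1 β ∧
      (unmatched 1 β').card < (unmatched 1 β).card) → p β') → p β) (β : MulAut (F N)) : p β := by
  have key : ∀ m n, ∀ β : MulAut (F N), totalCross 1 β = m → (unmatched 1 β).card = n → p β := by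
    intro m
    induction m using Nat.strong_induction_on with
    | _ m ihm =>
      intro n
      induction n using Nat.strong_induction_on with
      | _ n ihn =>
        intro β h1 h2
        refine h β fun β' hβ' => ?_
        rcases lt_or_ge (totalCross 1 β') m with hlt | hge
        · exact ihm _ hlt _ β' rfl rfl
        · rcases hβ' with h3 | ⟨h3, h4⟩
          · omega
          · exact ihn _ (h2 ▸ h4) β' (by omega) rfl
  exact key _ _ β rfl rfl

/-- If no Whitehead automorphism makes a conjugacy class shorter, then it is shortest in its
orbit. -/
theorem len_le_of_forall_whitehead {N : ℕ} (hN : 2 ≤ N) {c : Cls N}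
    (hc : ∀ τ : MulAut (F N), IsWhitehead τ → len c ≤ len (τ • c)) (φ : MulAut (F N)) :
    len c ≤ len (φ • c) := by
  induction c using Quotient.inductionOn with
  | h g =>
  change ∀ τ : MulAut (F N), IsWhitehead τ → len (cls g) ≤ len (τ • cls g) at hc
  change len (cls g) ≤ len (φ • cls g)
  suffices ∀ β : MulAut (F N), len (cls g) ≤ len (β⁻¹ • cls g) by simpa using this φ⁻¹
  intro β
  induction β using basis_induction with
  | h β ih =>
  rcases compare_bases hN 1 β g with ⟨A, a, h⟩ | ⟨A, a, h, hlt⟩ | ⟨u, ρ, hρ, h⟩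
  · rw [one_mul, inv_one, one_smul] at h
    exact absurd (hc _ (isWhitehead_wh_inv A a)) (by omega)
  · exact (ih _ hlt).trans h
  · rw [inv_one, one_mul] at h
    rw [h, mul_inv_rev, mul_smul, ← map_inv, conj_smul_cls]
    exact hc _ (Or.inl hρ.inv)

/-- One step of the stabilization process. -/
def LevelStep {N : ℕ} (c d : Cls N) : Prop :=
  len d = len c ∧ ∃ τ : MulAut (F N), IsWhitehead τ ∧ d = τ • c

/-- Any two shortest classes of an orbit are connected by Whitehead automorphisms that preserve
the length. -/
theorem exists_level_path {N : ℕ} (hN : 2 ≤ N) {c : Cls N}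
    (hc : ∀ φ : MulAut (F N), len c ≤ len (φ • c)) (φ : MulAut (F N))
    (hφ : len (φ • c) = len c) : Relation.ReflTransGen LevelStep c (φ • c) := by
  induction c using Quotient.inductionOn with
  | h g =>
  change ∀ φ : MulAut (F N), len (cls g) ≤ len (φ • cls g) at hc
  change len (φ • cls g) = len (cls g) at hφ
  change Relation.ReflTransGen LevelStep (cls g) (φ • cls g)
  suffices ∀ β : MulAut (F N), len (β⁻¹ • cls g) = len (cls g) →
      Relation.ReflTransGen LevelStep (cls g) (β⁻¹ • cls g) by
    simpa using this φ⁻¹ (by simpa using hφ)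
  intro β
  induction β using basis_induction with
  | h β ih =>
  intro hβ
  rcases compare_bases hN 1 β g with ⟨A, a, h⟩ | ⟨A, a, h, hlt⟩ | ⟨u, ρ, hρ, h⟩
  · rw [one_mul, inv_one, one_smul] at h
    exact absurd (hc (wh A a)⁻¹) (by omega)
  · have h1 : len ((β * wh A a)⁻¹ • cls g) = len (cls g) := le_antisymm (by omega) (hc _)
    refine (ih _ hlt h1).tail ⟨by omega, wh A a, isWhitehead_wh A a, ?_⟩
    rw [mul_inv_rev, mul_smul, smul_inv_smul]
  · rw [inv_one, one_mul] at h
    refine Relation.ReflTransGen.single ⟨hβ, ρ⁻¹, Or.inl hρ.inv, ?_⟩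
    rw [h, mul_inv_rev, mul_smul, ← map_inv, conj_smul_cls]

/-! ### Values and running times of the programs on words -/

@[simp] theorem tick_val {α : Type} (m : Timed α) : (tick m).val = m.val := rfl

@[simp] theorem tick_time {α : Type} (m : Timed α) : (tick m).time = m.time + 1 := rfl

@[simp] theorem timed_pure_val {α : Type} (a : α) : (pure a : Timed α).val = a := rfl

@[simp] theorem timed_pure_time {α : Type} (a : α) : (pure a : Timed α).time = 0 := rfl

@[simp] theorem timed_bind_val {α β : Type} (m : Timed α) (f : α → Timed β) :
    (m >>= f).val = (f m.val).val := rfl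

@[simp] theorem timed_bind_time {α β : Type} (m : Timed α) (f : α → Timed β) :
    (m >>= f).time = m.time + (f m.val).time := rfl

section
variable {N : ℕ}

theorem rev_val (w acc : Word N) : (rev w acc).val = w.reverse ++ acc := by
  induction w generalizing acc with
  | nil => simp [rev]
  | cons x w ih => simp [rev, ih]

theorem rev_time (w acc : Word N) : (rev w acc).time = w.length + 1 := by
  induction w generalizing acc with
  | nil => simp [rev]
  | cons x w ih => simp [rev, ih]

theorem mk_cons (x : Letter N) (w : Word N) :
    FreeGroup.mk (x :: w) = elt x * FreeGroup.mk w := by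
  rw [elt, FreeGroup.mul_mk]; rfl

theorem mk_append (u v : Word N) :
    FreeGroup.mk (u ++ v) = FreeGroup.mk u * FreeGroup.mk v := FreeGroup.mul_mk.symm

theorem push_spec (x : Letter N) {acc : Word N} (h : FreeGroup.IsReduced acc.reverse) :
    FreeGroup.IsReduced (push x acc).val.reverse ∧
      FreeGroup.mk (push x acc).val.reverse = FreeGroup.mk acc.reverse * elt x ∧
      (push x acc).val.length ≤ acc.length + 1 ∧ (push x acc).time = 1 := by
  cases acc with
  | nil =>
    refine ⟨?_, ?_, ?_, ?_⟩
    · simp [push, FreeGroup.IsReduced]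
    · simp only [push, tick_val, timed_pure_val, List.reverse_singleton, List.reverse_nil]
      rw [← FreeGroup.one_eq_mk, one_mul]
    · simp [push]
    · simp [push]
  | cons y acc =>
    simp only [push, tick_val, timed_pure_val, tick_time, timed_pure_time, and_true]
    rw [List.reverse_cons] at h
    split_ifs with hy
    · refine ⟨h.infix ⟨[], [y], by simp⟩, ?_, by simp only [List.length_cons]; omega⟩
      rw [List.reverse_cons, mk_append, hy]
      change _ = _ * elt (inv x) * elt x
      rw [elt_inv, inv_mul_cancel_right]
    · refine ⟨?_, ?_, by simp⟩
      · rw [List.reverse_cons, List.reverse_cons]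
        refine isReduced_append.2 ⟨h, by simp [FreeGroup.IsReduced], ?_⟩
        intro z hz t ht
        simp only [List.getLast?_append, List.getLast?_singleton, Option.some_or, Option.mem_def,
          Option.some.injEq] at hz
        simp only [List.head?_cons, Option.mem_def, Option.some.injEq] at ht
        subst hz; subst ht
        exact fun he => hy (by rw [he, inv_inv'])
      · rw [List.reverse_cons (a := x), mk_append]

theorem pushWord_spec (v : Word N) {acc : Word N} (h : FreeGroup.IsReduced acc.reverse) :
    FreeGroup.IsReduced (pushWord v acc).val.reverse ∧
      FreeGroup.mk (pushWord v acc).val.reverse = FreeGroup.mk acc.reverse * FreeGroup.mk v ∧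
      (pushWord v acc).val.length ≤ acc.length + v.length ∧
      (pushWord v acc).time = 2 * v.length + 1 := by
  induction v generalizing acc with
  | nil =>
    refine ⟨by simpa [pushWord] using h, ?_, by simp [pushWord], by simp [pushWord]⟩
    simp only [pushWord, tick_val, timed_pure_val]
    rw [← FreeGroup.one_eq_mk, mul_one]
  | cons x v ih =>
    obtain ⟨h1, h2, h3, h4⟩ := push_spec x h
    obtain ⟨i1, i2, i3, i4⟩ := ih h1
    simp only [pushWord, tick_val, timed_bind_val, tick_time, timed_bind_time, List.length_cons]
    refine ⟨i1, ?_, by omega, by omega⟩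
    rw [i2, h2, mk_cons, mul_assoc]

theorem mk_table (τ : MulAut (F N)) (x : Letter N) : FreeGroup.mk (table τ x) = τ (elt x) :=
  FreeGroup.mk_toWord

theorem subst_spec (τ : MulAut (F N)) {B : ℕ} (hB : ∀ x, (table τ x).length ≤ B) (w : Word N)
    {acc : Word N} (h : FreeGroup.IsReduced acc.reverse) :
    FreeGroup.IsReduced (subst (table τ) w acc).val.reverse ∧
      FreeGroup.mk (subst (table τ) w acc).val.reverse =
        FreeGroup.mk acc.reverse * τ (FreeGroup.mk w) ∧
      (subst (table τ) w acc).val.length ≤ acc.length + B * w.length ∧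
      (subst (table τ) w acc).time ≤ (2 * B + 2) * w.length + 1 := by
  induction w generalizing acc with
  | nil =>
    refine ⟨by simpa [subst] using h, ?_, by simp [subst], by simp [subst]⟩
    simp only [subst, tick_val, timed_pure_val]
    rw [← FreeGroup.one_eq_mk, map_one, mul_one]
  | cons x w ih =>
    obtain ⟨h1, h2, h3, h4⟩ := pushWord_spec (table τ x) h
    obtain ⟨i1, i2, i3, i4⟩ := ih h1
    have hx := hB x
    simp only [subst, tick_val, timed_bind_val, tick_time, timed_bind_time, List.length_cons]
    refine ⟨i1, ?_, ?_, ?_⟩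
    · rw [i2, h2, mk_table, mk_cons, map_mul, mul_assoc]
    · rw [mul_add]; omega
    · rw [mul_add]; omega

theorem strip_spec (w r d : Word N) :
    ∃ s rest r', w = s ++ rest ∧ r = s.map inv ++ r' ∧
      (strip w r d).val = (rest, s.reverse ++ d) ∧ (strip w r d).time ≤ w.length + 1 ∧
      ∀ x ∈ rest.head?, ∀ y ∈ r'.head?, y ≠ inv x := by
  induction w generalizing r d with
  | nil => exact ⟨[], [], r, by simp, by simp, by simp [strip], by simp [strip], by simp⟩
  | cons x w ih =>
    cases r with
    | nil => exact ⟨[], x :: w, [], by simp, by simp, by simp [strip], by simp [strip], by simp⟩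
    | cons y r =>
      by_cases hy : y = inv x
      · obtain ⟨s, rest, r', h1, h2, h3, h4, h5⟩ := ih r (x :: d)
        refine ⟨x :: s, rest, r', by simp [h1], by simp [h2, hy], ?_, ?_, h5⟩
        · simp only [strip, if_pos hy, tick_val, h3]
          simp
        · simp only [strip, if_pos hy, tick_time, List.length_cons]
          omega
      · refine ⟨[], x :: w, y :: r, by simp, by simp, by simp [strip, hy], by simp [strip, hy], ?_⟩
        simpa using hy

theorem dropLen_val (d r : Word N) : (dropLen d r).val = r.drop d.length := by
  induction d generalizing r with
  | nil => simp [dropLen]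
  | cons x d ih => cases r <;> simp [dropLen, ih]

theorem dropLen_time (d r : Word N) : (dropLen d r).time ≤ d.length + 1 := by
  induction d generalizing r with
  | nil => simp [dropLen]
  | cons x d ih =>
    cases r with
    | nil => simp [dropLen]
    | cons y r => have := ih r; simp only [dropLen, tick_time, List.length_cons]; omega

/-- A prefix of a reduced word that cancels against the end of the word fills at most half of
it. -/
theorem two_mul_length_le {w s rest r' : Word N} (hw : FreeGroup.IsReduced w)
    (h1 : w = s ++ rest) (h2 : w.reverse = s.map inv ++ r') : 2 * s.length ≤ w.length := by
  by_contra! hlt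
  have hs : s.length ≤ w.length := by rw [h1]; simp
  -- letters at opposite positions are inverse to each other
  have key : ∀ i (hi : i < s.length), w[w.length - 1 - i]'(by omega) = inv (w[i]'(by omega)) := by
    intro i hi
    have e1 : w.reverse[i]'(by simp; omega) = w[w.length - 1 - i]'(by omega) := by
      rw [List.getElem_reverse]
    have e2 : w.reverse[i]'(by simp; omega) = inv (s[i]) := by
      simp only [h2]
      rw [List.getElem_append_left (by simpa using hi), List.getElem_map]
    have e3 : w[i]'(by omega) = s[i] := by
      simp only [h1]
      rw [List.getElem_append_left hi]
    rw [← e1, e2, e3]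
  rcases Nat.even_or_odd' w.length with ⟨m, hm | hm⟩
  · have h3 := key (m - 1) (by omega)
    have e : w.length - 1 - (m - 1) = m - 1 + 1 := by omega
    simp only [e] at h3
    have h4 := List.isChain_iff_getElem.1 hw (m - 1) (by omega)
    exact (ne_inv_iff (x := w[m-1]'(by omega)) (y := w[m-1+1]'(by omega))).2 h4 h3
  · have h3 := key m (by omega)
    have e : w.length - 1 - m = m := by omega
    simp only [e] at h3
    exact inv_ne _ h3.symm

theorem cycReduce_spec {w : Word N} (hw : FreeGroup.IsReduced w) :
    FreeGroup.IsCyclicallyReduced (cycReduce w).val ∧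
      cls (FreeGroup.mk (cycReduce w).val) = cls (FreeGroup.mk w) ∧
      (cycReduce w).val.length ≤ w.length ∧ (cycReduce w).time ≤ 5 * w.length + 6 := by
  obtain ⟨s, rest, r', h1, h2, h3, h4, h5⟩ := strip_spec w w.reverse []
  have hlen := two_mul_length_le hw h1 h2
  -- the word is `s core s⁻¹`
  have h6 : w = r'.reverse ++ FreeGroup.invRev s := by
    have := congrArg List.reverse h2
    rw [List.reverse_reverse, List.reverse_append] at this
    exact this
  have hsr : s.length ≤ r'.reverse.length := by
    have := congrArg List.length h6
    simp at this ⊢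
    omega
  obtain ⟨core, hcore⟩ : ∃ core, r'.reverse = s ++ core := by
    have hp1 : s <+: w := ⟨rest, h1.symm⟩
    have hp2 : r'.reverse <+: w := ⟨_, h6.symm⟩
    obtain ⟨c, hc⟩ := List.prefix_of_prefix_length_le hp1 hp2 hsr
    exact ⟨c, hc.symm⟩
  have hw' : w = s ++ (core ++ FreeGroup.invRev s) := by
    rw [h6, hcore, List.append_assoc]
  have hrest : rest = core ++ FreeGroup.invRev s := by
    have := h1.symm.trans hw'
    exact List.append_cancel_left this
  have hval : (cycReduce w).val = core := by
    simp only [cycReduce, tick_val, timed_bind_val, rev_val, List.append_nil, h3, dropLen_val]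
    rw [hrest, List.reverse_append, List.drop_left' (by simp [FreeGroup.invRev])]
    simp
  rw [hval]
  refine ⟨⟨hw.infix ⟨s, FreeGroup.invRev s, by rw [hw', List.append_assoc]⟩, ?_⟩, ?_, ?_, ?_⟩
  · intro y hy x hx
    rw [Option.mem_def] at hx hy
    have hx' : x ∈ rest.head? := by
      rw [hrest, List.head?_append, hx]; rfl
    have hy' : y ∈ r'.head? := by
      have : r' = core.reverse ++ s.reverse := by
        rw [← List.reverse_reverse r', hcore, List.reverse_append]
      rw [this, List.head?_append, List.head?_reverse, hy]; rfl
    exact ne_inv_iff.1 fun he => h5 x hx' y hy' (by rw [he, inv_inv'])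
  · rw [hw', mk_append, mk_append, ← FreeGroup.inv_mk, ← mul_assoc]
    exact ConjClasses.mk_eq_mk_iff_isConj.2 (isConj_iff.2 ⟨_, rfl⟩)
  · rw [hw']; simp; omega
  · simp only [cycReduce, tick_time, timed_bind_time, rev_val, rev_time, List.append_nil, h3]
    have e1 := dropLen_time s.reverse rest.reverse
    have e2 : (dropLen s.reverse rest.reverse).val.length ≤ w.length := by
      rw [dropLen_val, List.length_drop, h1]; simp; omega
    have e3 : rest.length ≤ w.length := by rw [h1]; simp
    simp only [List.length_reverse] at *
    omega

theorem image_spec (τ : MulAut (F N)) {B : ℕ} (hB : ∀ x, (table τ x).length ≤ B) (w : Word N) :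
    FreeGroup.IsCyclicallyReduced (image (table τ) w).val ∧
      cls (FreeGroup.mk (image (table τ) w).val) = τ • cls (FreeGroup.mk w) ∧
      (image (table τ) w).val.length ≤ B * w.length ∧
      (image (table τ) w).time ≤ (8 * B + 9) * (w.length + 1) := by
  obtain ⟨h1, h2, h3, h4⟩ := subst_spec τ hB w (acc := []) (by simp [FreeGroup.IsReduced])
  obtain ⟨c1, c2, c3, c4⟩ := cycReduce_spec h1
  have hv : (image (table τ) w).val = (cycReduce (subst (table τ) w []).val.reverse).val := by
    simp [image, rev_val]
  rw [hv]
  refine ⟨c1, ?_, ?_, ?_⟩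
  · rw [c2, h2, List.reverse_nil, ← FreeGroup.one_eq_mk, one_mul]
    rfl
  · simp only [List.length_reverse, List.length_nil, zero_add] at c3 h3
    omega
  · simp only [image, tick_time, timed_bind_time, rev_time, rev_val, List.append_nil]
    simp only [List.length_reverse, List.length_nil, zero_add] at c3 c4 h3
    nlinarith

theorem shorter_val (u v : Word N) : (shorter u v).val = decide (u.length < v.length) := by
  induction u generalizing v with
  | nil => cases v <;> simp [shorter]
  | cons x u ih => cases v <;> simp [shorter, ih]

theorem shorter_time (u v : Word N) : (shorter u v).time ≤ v.length + 1 := by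
  induction u generalizing v with
  | nil => cases v <;> simp [shorter]
  | cons x u ih =>
    cases v with
    | nil => simp [shorter]
    | cons y v => have := ih v; simp only [shorter, tick_time, List.length_cons]; omega

theorem sameLen_val (u v : Word N) : (sameLen u v).val = decide (u.length = v.length) := by
  induction u generalizing v with
  | nil => cases v <;> simp [sameLen]
  | cons x u ih => cases v <;> simp [sameLen, ih]

theorem sameLen_time (u v : Word N) :
    (sameLen u v).time ≤ u.length + 1 ∧ (sameLen u v).time ≤ v.length + 1 := by
  induction u generalizing v with
  | nil => cases v <;> simp [sameLen]
  | cons x u ih =>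
    cases v with
    | nil => simp [sameLen]
    | cons y v => have := ih v; simp only [sameLen, tick_time, List.length_cons]; omega

theorem append_val (u v : Word N) : (append u v).val = u ++ v := by
  induction u with
  | nil => simp [append]
  | cons x u ih => simp [append, ih]

theorem append_time (u v : Word N) : (append u v).time = u.length + 1 := by
  induction u with
  | nil => simp [append]
  | cons x u ih => simp [append, ih]

/-! ### Cyclically reduced words and conjugacy -/

theorem len_mk {w : Word N} (hw : FreeGroup.IsCyclicallyReduced w) :
    len (cls (FreeGroup.mk w)) = w.length := by
  rw [len_cls, cycNorm, FreeGroup.toWord_mk, hw.isReduced.reduce_eq]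
  congr 1
  induction w using List.bidirectionalRec with
  | nil => simp
  | singleton x => simp
  | cons_append a l b _ =>
    rw [FreeGroup.reduceCyclically.cons_append, if_neg]
    · rfl
    · rintro ⟨h1, h2⟩
      have := (FreeGroup.isCyclicallyReduced_cons_append_iff.1 hw).2 h1
      rw [this] at h2
      simp at h2

theorem toWord_mk_of_reduced {w : Word N} (hw : FreeGroup.IsReduced w) :
    (FreeGroup.mk w).toWord = w := by
  rw [FreeGroup.toWord_mk, hw.reduce_eq]

theorem cls_rotate (w : Word N) (n : ℕ) :
    cls (FreeGroup.mk (w.rotate n)) = cls (FreeGroup.mk w) := by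
  have h : cls (FreeGroup.mk (w.rotate (n % w.length))) = cls (FreeGroup.mk w) := by
    rcases Nat.eq_zero_or_pos w.length with h0 | h0
    · rw [List.length_eq_zero_iff] at h0
      simp [h0]
    · rw [List.rotate_eq_drop_append_take (Nat.mod_lt _ h0).le, mk_append]
      conv_rhs => rw [← List.take_append_drop (n % w.length) w, mk_append]
      refine ConjClasses.mk_eq_mk_iff_isConj.2 (isConj_iff.2
        ⟨FreeGroup.mk (w.take (n % w.length)), ?_⟩)
      group
  rwa [List.rotate_mod] at h

theorem cycReduced_rotate_one {x : Letter N} {w : Word N}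
    (h : FreeGroup.IsCyclicallyReduced (x :: w)) : FreeGroup.IsCyclicallyReduced (w ++ [x]) := by
  rcases List.eq_nil_or_concat w with rfl | ⟨w', y, rfl⟩
  · simp
  · have h1 : FreeGroup.IsReduced ([x] ++ (w' ++ [y])) := by simpa using h.1
    rw [isReduced_append] at h1
    have h2 := h.2 y (by simp [List.getLast?_cons]) x (by simp)
    have h3 : FreeGroup.IsReduced (w' ++ [y] ++ [x]) := by
      refine isReduced_append.2 ⟨h1.2.1, by simp [FreeGroup.IsReduced], ?_⟩
      intro a ha b hb
      simp only [List.getLast?_append, List.getLast?_singleton, Option.some_or, Option.mem_def,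
        Option.some.injEq] at ha
      simp only [List.head?_cons, Option.mem_def, Option.some.injEq] at hb
      subst ha; subst hb
      exact ne_inv_iff.2 h2
    rw [List.concat_eq_append]
    refine ⟨h3, ?_⟩
    intro a ha b hb
    simp only [List.getLast?_append, List.getLast?_singleton, Option.some_or, Option.mem_def,
      Option.some.injEq] at ha
    subst ha
    refine ne_inv_iff.1 (h1.2.2 x (by simp) b ?_)
    rw [Option.mem_def] at hb ⊢
    rw [← hb]
    cases w' <;> simp

theorem cycReduced_rotate {w : Word N} (h : FreeGroup.IsCyclicallyReduced w) (n : ℕ) :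
    FreeGroup.IsCyclicallyReduced (w.rotate n) := by
  induction n generalizing w with
  | zero => simpa using h
  | succ n ih =>
    cases w with
    | nil => simp
    | cons x w =>
      rw [List.rotate_cons_succ]
      exact ih (cycReduced_rotate_one h)

/-- Conjugate cyclically reduced words are cyclic permutations of each other. -/
theorem isRotated_of_conj {u v : Word N} (hu : FreeGroup.IsCyclicallyReduced u)
    (hv : FreeGroup.IsCyclicallyReduced v)
    (h : cls (FreeGroup.mk u) = cls (FreeGroup.mk v)) : u ~r v := by
  obtain ⟨g, hg⟩ := isConj_iff.1 (ConjClasses.mk_eq_mk_iff_isConj.1 h)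
  have hlen : u.length = v.length := by rw [← len_mk hu, ← len_mk hv, h]
  suffices ∀ n, ∀ (g : F N) (u' : Word N), g.norm = n → FreeGroup.IsCyclicallyReduced u' →
      u'.length = v.length → g * FreeGroup.mk u' * g⁻¹ = FreeGroup.mk v → u' ~r v from
    this _ g u rfl hu hlen hg
  intro n
  induction n with
  | zero =>
    intro g u' hn hu' _ hg
    rw [FreeGroup.norm_eq_zero.1 hn] at hg
    have := congrArg FreeGroup.toWord hg
    rw [one_mul, inv_one, mul_one, toWord_mk_of_reduced hu'.1, toWord_mk_of_reduced hv.1] at this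
    rw [this]
  | succ n ih =>
    intro g u' hn hu' hlen' hg
    have hg1 : g⁻¹ ≠ 1 := by
      intro h
      rw [inv_eq_one] at h
      subst h
      simp at hn
    obtain ⟨y, hy⟩ := exists_mem_H hg1
    have hn' : (g * elt y).norm = n := by
      have := norm_inv_elt_mul hy
      rw [← mul_inv_rev, FreeGroup.norm_inv_eq, FreeGroup.norm_inv_eq] at this
      omega
    cases u' with
    | nil =>
      rw [List.length_nil, eq_comm, List.length_eq_zero_iff] at hlen'
      rw [hlen']
    | cons x w =>
      by_cases hxy : x = y
      · -- the first letter cancels: rotate it to the end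
        subst hxy
        have h1 := ih (g * elt x) (w ++ [x]) hn' (cycReduced_rotate_one hu') (by simpa using hlen')
          (by
            rw [← hg, mk_append, mk_cons x w]
            change g * elt x * (FreeGroup.mk w * elt x) * (g * elt x)⁻¹ = _
            generalize elt x = t
            group)
        exact (List.IsRotated.symm ⟨1, by simp⟩ : (w ++ [x]) ~r (x :: w)).symm.trans h1
      · obtain ⟨w', z, hw'⟩ : ∃ w' z, x :: w = w' ++ [z] := by
          rcases List.eq_nil_or_concat (x :: w) with h | ⟨w', z, h⟩
          · simp at h
          · exact ⟨w', z, by simpa using h⟩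
        by_cases hzy : z = inv y
        · -- the last letter cancels: rotate it to the front
          have hrot : (z :: w') ~r (x :: w) := by
            rw [hw']; exact ⟨1, by simp⟩
          obtain ⟨m, hm⟩ := hrot.symm
          have hred : FreeGroup.IsCyclicallyReduced (z :: w') := hm ▸ cycReduced_rotate hu' m
          have h1 := ih (g * elt y) (z :: w') hn' hred
            (by rw [← hlen', hw']; simp)
            (by
              rw [← hg, hw', mk_append, mk_cons, hzy, elt_inv]
              change _ = g * (FreeGroup.mk w' * elt (inv y)) * g⁻¹
              rw [elt_inv]
              group)
          exact hrot.symm.trans h1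
        · -- no cancellation: the product would be a reduced word that is not cyclically reduced
          exfalso
          have hw0 : (FreeGroup.mk (x :: w)).toWord = x :: w := toWord_mk_of_reduced hu'.1
          have e1 : (FreeGroup.mk (x :: w) * g⁻¹).toWord = (x :: w) ++ (g⁻¹).toWord := by
            rw [toWord_mul_of, hw0]
            intro a ha b hb
            rw [hw0, hw'] at ha
            simp only [List.getLast?_append, List.getLast?_singleton, Option.some_or,
              Option.mem_def, Option.some.injEq] at ha
            rw [mem_H] at hy
            rw [Option.mem_def, hy, Option.some.injEq] at hb
            subst ha; subst hb
            exact fun he => hzy (by rw [he, inv_inv'])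
          have e2 : (g * (FreeGroup.mk (x :: w) * g⁻¹)).toWord =
              g.toWord ++ ((x :: w) ++ (g⁻¹).toWord) := by
            rw [toWord_mul_of, e1]
            intro a ha b hb
            rw [e1] at hb
            simp only [List.cons_append, List.head?_cons, Option.mem_def, Option.some.injEq] at hb
            rw [Option.mem_def, getLast?_toWord_inv] at ha
            rw [mem_H] at hy
            rw [hy, Option.some.injEq] at ha
            subst hb
            exact fun he => hxy (he.trans ha.symm)
          have e3 := congrArg (fun g : F N => g.toWord.length) hg
          simp only [mul_assoc, e2, toWord_mk_of_reduced hv.1] at e3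
          rw [← hlen'] at e3
          simp only [List.length_append, List.length_cons] at e3
          rw [FreeGroup.norm] at hn
          omega

theorem cls_eq_iff_isRotated {u v : Word N} (hu : FreeGroup.IsCyclicallyReduced u)
    (hv : FreeGroup.IsCyclicallyReduced v) :
    cls (FreeGroup.mk u) = cls (FreeGroup.mk v) ↔ u ~r v := by
  refine ⟨isRotated_of_conj hu hv, ?_⟩
  rintro ⟨n, rfl⟩
  exact (cls_rotate u n).symm

end

/-! ### Comparing cyclic words -/

section
variable {N : ℕ}

/-- The position of a letter in the order of the alphabet. -/
def rank (x : Letter N) : ℕ := 2 * x.1 + x.2.toNat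

theorem rank_injective : Function.Injective (rank : Letter N → ℕ) := by
  rintro ⟨i, a⟩ ⟨j, b⟩ h
  simp only [rank] at h
  have h1 : (i : ℕ) = j := by cases a <;> cases b <;> simp at h <;> omega
  have h2 : i = j := Fin.ext h1
  subst h2
  cases a <;> cases b <;> simp at h ⊢

theorem before_iff (x y : Letter N) : before x y = true ↔ rank x < rank y := by
  obtain ⟨i, a⟩ := x
  obtain ⟨j, b⟩ := y
  simp only [before, rank, Bool.or_eq_true, decide_eq_true_eq, Bool.and_eq_true, beq_iff_eq,
    Fin.lt_def, Fin.ext_iff]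
  cases a <;> cases b <;> simp <;> omega

/-- The sequence read from position `a` on, with the lexicographic order. -/
def reading (U : ℕ → Letter N) (a : ℕ) : Lex (ℕ → ℕ) := toLex fun t => rank (U (a + t))

theorem reading_lt {U V : ℕ → Letter N} {a b k : ℕ} (h : ∀ t < k, U (a + t) = V (b + t))
    (hk : rank (U (a + k)) < rank (V (b + k))) : reading U a < reading V b :=
  ⟨k, fun t ht => by change rank _ = rank _; rw [h t ht], hk⟩

theorem reading_eq_iff {U V : ℕ → Letter N} {a b : ℕ} :
    reading U a = reading V b ↔ ∀ t, U (a + t) = V (b + t) := by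
  constructor
  · intro h t
    exact rank_injective (congrFun (toLex.injective h) t)
  · intro h
    unfold reading
    congr 1
    funext t
    rw [h]

theorem apply_add_mul {U : ℕ → Letter N} {n : ℕ} (hU : ∀ t, U (t + n) = U t) (m t : ℕ) :
    U (t + n * m) = U t := by
  induction m generalizing t with
  | zero => simp
  | succ m ih => rw [Nat.mul_succ, ← add_assoc, hU, ih]

theorem apply_add_mod {U : ℕ → Letter N} {n : ℕ} (hU : ∀ t, U (t + n) = U t) (a t : ℕ) :
    U (a + t % n) = U (a + t) := by
  rw [← apply_add_mul hU (t / n) (a + t % n), add_assoc, Nat.mod_add_div]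

/-- If all rotations that start before `i` are undercut by rotations of the other word and the two
cyclic words agree, then some rotation is left. -/
theorem lt_of_discarded {U V : ℕ → Letter N} {n : ℕ} (hn : 0 < n) (hU : ∀ t, U (t + n) = U t)
    (hV : ∀ t, V (t + n) = V t) {i₀ j₀ : ℕ} (hrot : ∀ t, U (i₀ + t) = V (j₀ + t)) {i : ℕ}
    (hi : ∀ a < i, ∃ b, reading V b < reading U a) : i < n := by
  obtain ⟨a₀, ha₀, hmin⟩ := Finset.exists_min_image (Finset.range n) (reading U)
    ⟨0, by simpa using hn⟩
  by_contra! hge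
  obtain ⟨b, hb⟩ := hi a₀ (by have := Finset.mem_range.1 ha₀; omega)
  -- the rotation of `V` is a rotation of `U`
  have hj : j₀ ≤ b + n * j₀ := (Nat.le_mul_of_pos_left j₀ hn).trans (Nat.le_add_left _ _)
  obtain ⟨s, hs⟩ := Nat.exists_eq_add_of_le hj
  have h1 : reading V b = reading U ((i₀ + s) % n) := by
    rw [eq_comm, reading_eq_iff]
    intro t
    have h2 := apply_add_mul hU ((i₀ + s) / n) ((i₀ + s) % n + t)
    have h3 : (i₀ + s) % n + t + n * ((i₀ + s) / n) = i₀ + (s + t) := by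
      have := Nat.mod_add_div (i₀ + s) n
      omega
    rw [h3, hrot] at h2
    rw [← h2, ← add_assoc, ← hs]
    have h4 := apply_add_mul hV j₀ (b + t)
    rw [← h4]
    congr 1
    omega
  have := hmin ((i₀ + s) % n) (Finset.mem_range.2 (Nat.mod_lt _ hn))
  rw [← h1] at this
  exact absurd hb (not_lt.2 this)

/-- The loop finds out whether two cyclic words agree, which are given by the periodic sequences `U`
and `V`. The rotations under comparison start at `i` and `j` and agree in their first `k` letters.
A rotation is discarded only when some rotation of the other word is lexicographically smaller; if
the cyclic words agree, then the least rotation is therefore never discarded on either side. -/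
theorem cycEqLoop_spec {u v full uu vv : Word N} {U V : ℕ → Letter N} {n : ℕ} (hn : 0 < n)
    (hU : ∀ t, U (t + n) = U t) (hV : ∀ t, V (t + n) = V t)
    (hu : u.length = n) (hv : v.length = n) (hfull : full.length = n)
    (huu : ∀ t < 2 * n, uu[t]? = some (U t)) (hvv : ∀ t < 2 * n, vv[t]? = some (V t))
    (fuel left : Word N) (i j k : ℕ) (p q : Cursor N)
    (hp : p = ⟨uu.drop i, uu.drop (i + k), u.drop i, u.drop (i + k)⟩)
    (hq : q = ⟨vv.drop j, vv.drop (j + k), v.drop j, v.drop (j + k)⟩)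
    (hleft : left.length + k = n) (hagree : ∀ t < k, U (i + t) = V (j + t))
    (hfuel : 3 * n ≤ fuel.length + (i + j + k))
    (hi : ∀ a < i, ∃ b, reading V b < reading U a)
    (hj : ∀ b < j, ∃ a, reading U a < reading V b) :
    (cycEqLoop full fuel left p q).val = true ↔ ∃ i₀ j₀, ∀ t, U (i₀ + t) = V (j₀ + t) := by
  -- agreement on a whole period
  have hdone : left = [] → ∃ i₀ j₀, ∀ t, U (i₀ + t) = V (j₀ + t) := by
    intro hl
    have hk : k = n := by rw [hl] at hleft; simpa using hleft
    refine ⟨i, j, fun t => ?_⟩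
    rw [← apply_add_mod hU, ← apply_add_mod hV]
    exact hagree _ (by rw [hk]; exact Nat.mod_lt _ hn)
  have hlt : (∃ i₀ j₀, ∀ t, U (i₀ + t) = V (j₀ + t)) → i < n ∧ j < n := by
    rintro ⟨i₀, j₀, hrot⟩
    exact ⟨lt_of_discarded hn hU hV hrot hi,
      lt_of_discarded hn hV hU (fun t => (hrot t).symm) hj⟩
  induction fuel generalizing left i j k p q with
  | nil =>
    simp only [cycEqLoop, tick_val, timed_pure_val, List.isEmpty_iff]
    refine ⟨hdone, fun h => ?_⟩
    have := hlt h
    simp only [List.length_nil] at hfuel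
    omega
  | cons z fuel ih =>
    rw [cycEqLoop, tick_val]
    by_cases hl : left = []
    · simp only [hl, List.isEmpty_nil, if_true, timed_pure_val, true_iff]
      exact hdone hl
    have hl' : left.isEmpty = false := by simpa using hl
    simp only [hl', Bool.false_eq_true, if_false]
    by_cases hij : i < n ∧ j < n
    · obtain ⟨hin, hjn⟩ := hij
      have hkn : k < n := by
        have := List.length_pos_iff.2 hl
        omega
      have hpb : p.baseLeft.isEmpty = false := by
        rw [hp]; simp [List.drop_eq_nil_iff]; omega
      have hqb : q.baseLeft.isEmpty = false := by
        rw [hq]; simp [List.drop_eq_nil_iff]; omega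
      have hps : p.scan = U (i + k) :: uu.drop (i + k + 1) := by
        have h1 := huu (i + k) (by omega)
        obtain ⟨h2, h3⟩ := List.getElem?_eq_some_iff.1 h1
        rw [hp]
        simp only
        rw [List.drop_eq_getElem_cons h2, h3]
      have hqs : q.scan = V (j + k) :: vv.drop (j + k + 1) := by
        have h1 := hvv (j + k) (by omega)
        obtain ⟨h2, h3⟩ := List.getElem?_eq_some_iff.1 h1
        rw [hq]
        simp only
        rw [List.drop_eq_getElem_cons h2, h3]
      simp only [hpb, hqb, Bool.or_self, Bool.false_eq_true, if_false, hps, hqs]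
      by_cases hxy : U (i + k) = V (j + k)
      · rw [if_pos hxy]
        have hagree' : ∀ t < k + 1, U (i + t) = V (j + t) := by
          intro t ht
          rcases Nat.lt_succ_iff_lt_or_eq.1 ht with h | rfl
          · exact hagree t h
          · exact hxy
        refine ih left.tail i j (k + 1) p.read q.read ?_ ?_ ?_ hagree' ?_ hi hj ?_ hlt
        · rw [hp]; simp [Cursor.read, List.tail_drop, add_assoc]
        · rw [hq]; simp [Cursor.read, List.tail_drop, add_assoc]
        · rw [List.length_tail]; omega
        · simp only [List.length_cons] at hfuel; omega
        · intro hl2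
          have hk : k + 1 = n := by
            have : left.length = 1 := by
              have := congrArg List.length hl2
              rw [List.length_tail, List.length_nil] at this
              have := List.length_pos_iff.2 hl
              omega
            omega
          refine ⟨i, j, fun t => ?_⟩
          rw [← apply_add_mod hU, ← apply_add_mod hV]
          exact hagree' _ (by rw [hk]; exact Nat.mod_lt _ hn)
      · rw [if_neg hxy]
        have hrk : rank (U (i + k)) ≠ rank (V (j + k)) := fun h => hxy (rank_injective h)
        have hne : full ≠ [] := by
          intro h; rw [h] at hfull; simp at hfull; omega
        by_cases hb : before (V (j + k)) (U (i + k)) = true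
        · rw [if_pos hb]
          rw [before_iff] at hb
          have hi' : ∀ a < i + k + 1, ∃ b, reading V b < reading U a := by
            intro a ha
            rcases lt_or_ge a i with h | h
            · exact hi a h
            · obtain ⟨s, rfl⟩ := Nat.exists_eq_add_of_le h
              refine ⟨j + s, reading_lt (k := k - s) (fun t ht => ?_) ?_⟩
              · rw [add_assoc, add_assoc]
                exact (hagree (s + t) (by omega)).symm
              · have e : s + (k - s) = k := by omega
                rwa [add_assoc, add_assoc, e]
          refine ih full (i + k + 1) j 0 p.skip q.reset ?_ ?_ (by omega) (by simp) ?_ hi' hj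
            (fun h => absurd h hne) ?_
          · rw [hp]; simp [Cursor.skip, List.tail_drop]
          · rw [hq]; simp [Cursor.reset]
          · simp only [List.length_cons] at hfuel; omega
          · rintro ⟨i₀, j₀, hrot⟩
            exact ⟨lt_of_discarded hn hU hV hrot hi', hjn⟩
        · rw [if_neg hb]
          rw [before_iff] at hb
          have hb' : rank (U (i + k)) < rank (V (j + k)) := by omega
          have hj' : ∀ b < j + k + 1, ∃ a, reading U a < reading V b := by
            intro b hb
            rcases lt_or_ge b j with h | h
            · exact hj b h
            · obtain ⟨s, rfl⟩ := Nat.exists_eq_add_of_le h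
              refine ⟨i + s, reading_lt (k := k - s) (fun t ht => ?_) ?_⟩
              · rw [add_assoc, add_assoc]
                exact hagree (s + t) (by omega)
              · have e : s + (k - s) = k := by omega
                rwa [add_assoc, add_assoc, e]
          refine ih full i (j + k + 1) 0 p.reset q.skip ?_ ?_ (by omega) (by simp) ?_ hi hj'
            (fun h => absurd h hne) ?_
          · rw [hp]; simp [Cursor.reset]
          · rw [hq]; simp [Cursor.skip, List.tail_drop]
          · simp only [List.length_cons] at hfuel; omega
          · rintro ⟨i₀, j₀, hrot⟩
            exact ⟨hin, lt_of_discarded hn hV hU (fun t => (hrot t).symm) hj'⟩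
    · have hfalse : (p.baseLeft.isEmpty || q.baseLeft.isEmpty) = true := by
        rw [hp, hq]
        simp only [Bool.or_eq_true, List.isEmpty_iff, List.drop_eq_nil_iff]
        omega
      simp only [hfalse, if_true, timed_pure_val, Bool.false_eq_true, false_iff]
      exact fun h => hij (hlt h)

theorem cycEqLoop_time (full fuel left : Word N) (p q : Cursor N) :
    (cycEqLoop full fuel left p q).time ≤ fuel.length + 1 := by
  induction fuel generalizing left p q with
  | nil => simp [cycEqLoop]
  | cons z fuel ih =>
    rw [cycEqLoop, tick_time, List.length_cons]
    refine Nat.add_le_add_right ?_ 1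
    by_cases h1 : left.isEmpty = true
    · rw [if_pos h1]; simp
    rw [if_neg h1]
    by_cases h2 : (p.baseLeft.isEmpty || q.baseLeft.isEmpty) = true
    · rw [if_pos h2]; simp
    rw [if_neg h2]
    cases p.scan with
    | nil => simp
    | cons x _ =>
      cases q.scan with
      | nil => simp
      | cons y _ =>
        simp only
        split_ifs
        · exact ih _ _ _
        · exact ih _ _ _
        · exact ih _ _ _

theorem cycEq_time (u v : Word N) (h : u.length = v.length) :
    (cycEq u v).time ≤ 6 * u.length + 5 := by
  simp only [cycEq, tick_time, timed_bind_time, append_time, append_val]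
  have := cycEqLoop_time u (u ++ (u ++ u)) u ⟨u ++ u, u ++ u, u, u⟩ ⟨v ++ v, v ++ v, v, v⟩
  simp only [List.length_append] at this
  omega

theorem cycEq_val (u v : Word N) (h : u.length = v.length) : (cycEq u v).val = true ↔ u ~r v := by
  simp only [cycEq, tick_val, timed_bind_val, append_val]
  rcases Nat.eq_zero_or_pos u.length with h0 | h0
  · have hu : u = [] := List.length_eq_zero_iff.1 h0
    have hv : v = [] := List.length_eq_zero_iff.1 (h ▸ h0)
    subst hu; subst hv
    simp [cycEqLoop]
  have hper : ∀ w : Word N, w.length = u.length → ∃ W : ℕ → Letter N,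
      (∀ t, w[t % u.length]? = some (W t)) ∧ (∀ t, W (t + u.length) = W t) := by
    intro w hw
    refine ⟨fun t => w[t % u.length]'(by rw [hw]; exact Nat.mod_lt _ h0), fun t => ?_, fun t => ?_⟩
    · simp
    · simp
  have hdbl : ∀ (w : Word N) (W : ℕ → Letter N), w.length = u.length →
      (∀ t, w[t % u.length]? = some (W t)) → ∀ t < 2 * u.length, (w ++ w)[t]? = some (W t) := by
    intro w W hw hW t ht
    rw [← hW]
    rcases lt_or_ge t u.length with hlt | hge
    · rw [List.getElem?_append_left (by omega), Nat.mod_eq_of_lt hlt]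
    · rw [List.getElem?_append_right (by omega), hw, Nat.mod_eq_sub_mod hge,
        Nat.mod_eq_of_lt (by omega)]
  obtain ⟨U, hU, hU'⟩ := hper u rfl
  obtain ⟨V, hV, hV'⟩ := hper v h.symm
  rw [cycEqLoop_spec (u := u) (v := v) (full := u) (uu := u ++ u) (vv := v ++ v) (U := U) (V := V)
    (n := u.length) h0 hU' hV' rfl h.symm rfl (hdbl u U rfl hU) (hdbl v V h.symm hV)
    _ _ 0 0 0 _ _ (by simp) (by simp) (by simp) (by simp)
    (by simp only [List.length_append]; omega) (by simp) (by simp)]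
  have hget : ∀ (w : Word N) (W : ℕ → Letter N), w.length = u.length →
      (∀ t, w[t % u.length]? = some (W t)) → ∀ a t, t < u.length →
      (w.rotate a)[t]? = some (W (a + t)) := by
    intro w W hw hW a t ht
    rw [List.getElem?_rotate (by omega), hw, ← hW, add_comm]
  constructor
  · rintro ⟨i₀, j₀, hrot⟩
    have : u.rotate i₀ = v.rotate j₀ := by
      apply List.ext_getElem?
      intro t
      rcases lt_or_ge t u.length with hlt | hge
      · rw [hget u U rfl hU _ _ hlt, hget v V h.symm hV _ _ hlt, hrot]
      · rw [List.getElem?_eq_none (by simpa using hge),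
          List.getElem?_eq_none (by rw [List.length_rotate]; omega)]
    have h1 : u ~r u.rotate i₀ := ⟨i₀, rfl⟩
    have h2 : v ~r v.rotate j₀ := ⟨j₀, rfl⟩
    rw [this] at h1
    exact h1.trans h2.symm
  · rintro ⟨m, hm⟩
    refine ⟨m, 0, fun t => ?_⟩
    have h1 := hget u U rfl hU m (t % u.length) (Nat.mod_lt _ h0)
    rw [hm] at h1
    have h2 := hV (t % u.length)
    rw [Nat.mod_mod] at h2
    have h3 := hV t
    have h4 := hU (m + t % u.length)
    have h5 := hU (m + t)
    rw [Nat.add_mod_mod] at h4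
    have h6 : U (m + t % u.length) = U (m + t) := Option.some.inj (h4.symm.trans h5)
    rw [zero_add, ← h6]
    exact Option.some.inj (h1.symm.trans h3)

theorem mem_time (v : Word N) (T : List (Word N)) (hT : ∀ u ∈ T, u.length = v.length) :
    (mem v T).time ≤ T.length * (6 * v.length + 6) + 1 := by
  induction T with
  | nil => simp [mem]
  | cons u T ih =>
    have h1 := cycEq_time u v (hT u (by simp))
    rw [hT u (by simp)] at h1
    have h2 := ih fun u hu => hT u (by simp [hu])
    simp only [mem, tick_time, timed_bind_time, List.length_cons]
    have h3 : (if (cycEq u v).val = true then (pure true : Timed Bool) else mem v T).time ≤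
        T.length * (6 * v.length + 6) + 1 := by
      split_ifs
      · simp
      · exact h2
    rw [Nat.succ_mul]
    omega

theorem mem_val (v : Word N) (T : List (Word N)) (hT : ∀ u ∈ T, u.length = v.length) :
    (mem v T).val = true ↔ ∃ u ∈ T, u ~r v := by
  induction T with
  | nil => simp [mem]
  | cons u T ih =>
    have h1 := cycEq_val u v (hT u (by simp))
    have h2 := ih fun u hu => hT u (by simp [hu])
    simp only [mem, tick_val, timed_bind_val, List.mem_cons, exists_eq_or_imp, ← h1, ← h2]
    split_ifs with h
    · simp [h]
    · simp [h]

end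

/-! ### Moves and minimal classes -/

section
variable {N : ℕ}

theorem toOut_smul (φ : MulAut (F N)) (c : Cls N) : toOut φ • c = φ • c := rfl

theorem exists_toOut (ω : Out N) : ∃ φ : MulAut (F N), toOut φ = ω :=
  QuotientGroup.mk'_surjective _ ω

theorem isOutMinimal_iff {c : Cls N} :
    IsOutMinimal c ↔ ∀ φ : MulAut (F N), len c ≤ len (φ • c) := by
  refine ⟨fun h φ => h (toOut φ), fun h ω => ?_⟩
  obtain ⟨φ, rfl⟩ := exists_toOut ω
  exact h φ

theorem mem_orbit_iff {c d : Cls N} :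
    d ∈ MulAction.orbit (Out N) c ↔ ∃ φ : MulAut (F N), φ • c = d := by
  constructor
  · rintro ⟨ω, rfl⟩
    obtain ⟨φ, rfl⟩ := exists_toOut ω
    exact ⟨φ, rfl⟩
  · rintro ⟨φ, rfl⟩
    exact ⟨toOut φ, rfl⟩

theorem smul_mem_orbit (φ : MulAut (F N)) (c : Cls N) : φ • c ∈ MulAction.orbit (Out N) c :=
  mem_orbit_iff.2 ⟨φ, rfl⟩

/-- A Whitehead automorphism that is trivial in `Out` fixes all classes, and every other one acts
like one from the list. -/
theorem Enumerates.smul_eq {moves : List (MulAut (F N))} (h : Enumerates moves) {σ : MulAut (F N)}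
    (hσ : IsWhitehead σ) (c : Cls N) : σ • c = c ∨ ∃ τ ∈ moves, σ • c = τ • c := by
  by_cases h1 : toOut σ = 1
  · left
    rw [← toOut_smul, h1, one_smul]
  · right
    have h2 : toOut σ ∈ {ω | ∃ τ ∈ moves, toOut τ = ω} := by
      rw [h.2]
      exact ⟨h1, σ, hσ, rfl⟩
    obtain ⟨τ, hτ, he⟩ := h2
    exact ⟨τ, hτ, by rw [← toOut_smul, ← he, toOut_smul]⟩

theorem Enumerates.isOutMinimal {moves : List (MulAut (F N))} (h : Enumerates moves) (hN : 2 ≤ N)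
    {c : Cls N} (hc : ∀ τ ∈ moves, len c ≤ len (τ • c)) : IsOutMinimal c := by
  rw [isOutMinimal_iff]
  refine len_le_of_forall_whitehead hN fun σ hσ => ?_
  rcases h.smul_eq hσ c with he | ⟨τ, hτ, he⟩
  · rw [he]
  · rw [he]; exact hc τ hτ

/-- A set that is closed under length-preserving moves from the list contains, with one minimal
class, all minimal classes of the orbit. -/
theorem Enumerates.mem_of_closed {moves : List (MulAut (F N))} (h : Enumerates moves) (hN : 2 ≤ N)
    {c d : Cls N} (hc : IsOutMinimal c) (hd : d ∈ MulAction.orbit (Out N) c)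
    (hcd : len d = len c) {L : Set (Cls N)} (hcL : c ∈ L)
    (hL : ∀ a ∈ L, ∀ τ ∈ moves, len (τ • a) = len c → τ • a ∈ L) : d ∈ L := by
  obtain ⟨φ, rfl⟩ := mem_orbit_iff.1 hd
  have key : ∀ b, Relation.ReflTransGen LevelStep c b → len b = len c ∧ b ∈ L := by
    intro b hb
    induction hb with
    | refl => exact ⟨rfl, hcL⟩
    | tail _ hs ih =>
      obtain ⟨hlen, σ, hσ, rfl⟩ := hs
      refine ⟨hlen.trans ih.1, ?_⟩
      rcases h.smul_eq hσ _ with he | ⟨τ, hτ, he⟩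
      · rw [he]; exact ih.2
      · rw [he] at hlen ⊢
        exact hL _ ih.2 τ hτ (hlen.trans ih.1)
  exact (key _ (exists_level_path hN (isOutMinimal_iff.1 hc) φ hcd)).2

theorem len_eq_of_minimal {c d : Cls N} (hc : IsOutMinimal c) (hd : IsOutMinimal d)
    (h : d ∈ MulAction.orbit (Out N) c) : len d = len c := by
  obtain ⟨φ, rfl⟩ := h
  exact le_antisymm (by simpa using hd φ⁻¹) (hc φ)

theorem exists_cycReduced (c : Cls N) :
    ∃ w : Word N, FreeGroup.IsCyclicallyReduced w ∧ cls (FreeGroup.mk w) = c := by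
  induction c using Quotient.inductionOn with
  | h g =>
  obtain ⟨h1, h2, -⟩ := cycReduce_spec (FreeGroup.isReduced_toWord (x := g))
  exact ⟨_, h1, by rw [h2, FreeGroup.mk_toWord]; rfl⟩

theorem len_pos {c : Cls N} (hc : c ≠ cls 1) : 0 < len c := by
  obtain ⟨w, hw, rfl⟩ := exists_cycReduced c
  rw [len_mk hw, List.length_pos_iff]
  rintro rfl
  exact hc (by rw [FreeGroup.one_eq_mk])

theorem len_cls_le {w : Word N} (hw : FreeGroup.IsReduced w) :
    len (cls (FreeGroup.mk w)) ≤ w.length := by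
  obtain ⟨h1, h2, h3, -⟩ := cycReduce_spec hw
  rwa [← h2, len_mk h1]

/-! ### Minimizing sets -/

/-- By the gap, a class that is not longer than a member of a minimizing set and lies in the same
orbit is also a member. -/
theorem IsMinimizing.smul_mem {M : ℕ} {lam eps : ℝ} {S : Finset (Cls N)}
    (hS : IsMinimizing M lam eps S) (hlam : 1 < lam) {c : Cls N} (hc : c ∈ S) {φ : MulAut (F N)}
    (h : len (φ • c) ≤ len c) : φ • c ∈ S := by
  by_contra hn
  have h1 := hS.gap c hc (toOut φ) hn
  have h2 : (0 : ℝ) < len c := by exact_mod_cast len_pos (hS.nontrivial c hc)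
  rw [le_div_iff₀ h2, toOut_smul] at h1
  have h3 : (len (φ • c) : ℝ) ≤ len c := by exact_mod_cast h
  nlinarith

/-- All minimal classes of the orbit belong to the minimizing set. -/
theorem IsMinimizing.mem_of_minimal {M : ℕ} {lam eps : ℝ} {S : Finset (Cls N)}
    (hS : IsMinimizing M lam eps S) (hlam : 1 < lam) {c d : Cls N} (hc : c ∈ S)
    (hd : d ∈ MulAction.orbit (Out N) c) (hm : IsOutMinimal d) : d ∈ S := by
  obtain ⟨φ, rfl⟩ := mem_orbit_iff.1 hd
  refine hS.smul_mem hlam hc ?_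
  simpa using isOutMinimal_iff.1 hm φ⁻¹

/-- Every sequence of successive length-decreasing moves that starts at a given class has at most
`k` members. -/
def DescentBound (moves : List (MulAut (F N))) : ℕ → Cls N → Prop
  | 0, c => ∀ τ ∈ moves, len c ≤ len (τ • c)
  | k + 1, c => ∀ τ ∈ moves, len (τ • c) < len c → DescentBound moves k (τ • c)

theorem descentBound_len (moves : List (MulAut (F N))) {k : ℕ} {c : Cls N} (h : len c ≤ k) :
    DescentBound moves k c := by
  induction k generalizing c with
  | zero => intro τ _; omega
  | succ k ih => intro τ _ hlt; exact ih (by omega)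

theorem IsMinimizing.descentBound {M : ℕ} {lam eps : ℝ} {S : Finset (Cls N)}
    (hS : IsMinimizing M lam eps S) (hlam : 1 < lam) (moves : List (MulAut (F N))) {c : Cls N}
    (hc : c ∈ S) : DescentBound moves M c := by
  suffices ∀ k, ∀ c ∈ S, (S.filter fun d => len d < len c).card ≤ k → DescentBound moves k c from
    this M c hc ((Finset.card_filter_le _ _).trans hS.card_le)
  intro k
  induction k with
  | zero =>
    intro c hc hk τ _
    by_contra! hlt
    have h1 : τ • c ∈ S.filter fun d => len d < len c :=
      Finset.mem_filter.2 ⟨hS.smul_mem hlam hc hlt.le, hlt⟩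
    have := Finset.card_pos.2 ⟨_, h1⟩
    omega
  | succ k ih =>
    intro c hc hk τ _ hlt
    have h0 := hS.smul_mem hlam hc hlt.le
    refine ih _ h0 ?_
    have h1 : (S.filter fun d => len d < len (τ • c)) ⊂ S.filter fun d => len d < len c := by
      refine Finset.ssubset_iff_subset_ne.2 ⟨fun d hd => ?_, fun he => ?_⟩
      · rw [Finset.mem_filter] at hd ⊢
        exact ⟨hd.1, hd.2.trans hlt⟩
      · have h2 : τ • c ∈ S.filter fun d => len d < len (τ • c) := by
          rw [he]; exact Finset.mem_filter.2 ⟨h0, hlt⟩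
        exact lt_irrefl _ (Finset.mem_filter.1 h2).2
    have := Finset.card_lt_card h1
    omega

/-! ### Terminating computations -/

theorem TerminatesWithin.mono {α : Type} {m : Comp α} {T T' : ℕ} {P Q : α → Prop}
    (h : TerminatesWithin m T P) (hT : T ≤ T') (hPQ : ∀ a, P a → Q a) :
    TerminatesWithin m T' Q := by
  obtain ⟨a, t, h1, h2, h3⟩ := h
  exact ⟨a, t, h1, h2.trans hT, hPQ a h3⟩

theorem TerminatesWithin.bind {α β : Type} {m : Comp α} {f : α → Comp β} {T T' : ℕ}
    {P : α → Prop} {Q : β → Prop} (h : TerminatesWithin m T P)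
    (hf : ∀ a, P a → TerminatesWithin (f a) T' Q) : TerminatesWithin (m >>= f) (T + T') Q := by
  obtain ⟨a, t, h1, h2, h3⟩ := h
  obtain ⟨b, s, k1, k2, k3⟩ := hf a h3
  exact ⟨b, t + s, ⟨a, t, s, h1, k1, rfl⟩, by omega, k3⟩

theorem terminatesWithin_run {α : Type} {m : Timed α} {T : ℕ} {P : α → Prop} (h : m.time ≤ T)
    (hP : P m.val) : TerminatesWithin m.run T P := ⟨m.val, m.time, ⟨rfl, rfl⟩, h, hP⟩

theorem terminatesWithin_pure {α : Type} {a : α} {T : ℕ} {P : α → Prop} (hP : P a) :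
    TerminatesWithin (pure a : Comp α) T P := ⟨a, 0, ⟨rfl, rfl⟩, T.zero_le, hP⟩

/-- A loop terminates if there is an invariant `I k s` for states `s` from which at most `k`
rounds lead to further states. -/
theorem loop_terminates {σ ρ : Type} {body : σ → Timed (σ ⊕ ρ)} {I : ℕ → σ → Prop} {C : ℕ}
    {P : ρ → Prop} (htime : ∀ k s, I k s → (body s).time ≤ C)
    (hnext : ∀ k s s', I k s → (body s).val = Sum.inl s' → ∃ j < k, I j s')
    (hexit : ∀ k s a, I k s → (body s).val = Sum.inr a → P a) {k : ℕ} {s : σ} (hs : I k s) :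
    TerminatesWithin (loop body s) ((k + 1) * (C + 1)) P := by
  induction k using Nat.strong_induction_on generalizing s with
  | _ k ih =>
    have h1 := htime k s hs
    rcases hb : (body s).val with s' | a
    · obtain ⟨j, hj, hs'⟩ := hnext k s s' hs hb
      obtain ⟨a, t, h2, h3, h4⟩ := ih j hj hs'
      refine ⟨a, _, Loop.next s s' a t hb h2, ?_, h4⟩
      have : (j + 2) * (C + 1) ≤ (k + 1) * (C + 1) := Nat.mul_le_mul_right _ (by omega)
      have e : (j + 2) * (C + 1) = (j + 1) * (C + 1) + (C + 1) := by ring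
      omega
    · refine ⟨a, _, Loop.exit s a hb, ?_, hexit k s a hs hb⟩
      have : 1 * (C + 1) ≤ (k + 1) * (C + 1) := Nat.mul_le_mul_right _ (by omega)
      omega

/-! ### The minimization process -/

theorem exists_table_bound (l : List (MulAut (F N))) :
    ∃ B, 1 ≤ B ∧ ∀ τ ∈ l, ∀ x, (table τ x).length ≤ B := by
  induction l with
  | nil => exact ⟨1, le_rfl, by simp⟩
  | cons σ l ih =>
    obtain ⟨B, h1, h2⟩ := ih
    refine ⟨B + ∑ x : Letter N, (table σ x).length, by omega, ?_⟩
    intro τ hτ x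
    rcases List.mem_cons.1 hτ with rfl | hτ
    · have := Finset.single_le_sum (f := fun x : Letter N => (table τ x).length)
        (fun _ _ => Nat.zero_le _) (Finset.mem_univ x)
      omega
    · have := h2 τ hτ x
      omega

theorem findShorter_time {l : List (MulAut (F N))} {B : ℕ}
    (hB : ∀ τ ∈ l, ∀ x, (table τ x).length ≤ B) (w : Word N) :
    (findShorter w (l.map table)).time ≤ (l.length + 1) * ((8 * B + 11) * (w.length + 1)) := by
  induction l with
  | nil =>
    simp only [List.map_nil, findShorter, tick_time, timed_pure_time]
    exact Nat.succ_le_of_lt (by positivity)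
  | cons τ l ih =>
    obtain ⟨-, -, -, h1⟩ := image_spec τ (hB τ (by simp)) w
    have h2 := shorter_time (image (table τ) w).val w
    have h3 := ih fun σ hσ => hB σ (by simp [hσ])
    simp only [List.map_cons, findShorter, tick_time, timed_bind_time, List.length_cons]
    have h4 : (if (shorter (image (table τ) w).val w).val = true then
        (pure (some (image (table τ) w).val) : Timed (Option (Word N)))
        else findShorter w (l.map table)).time ≤
          (l.length + 1) * ((8 * B + 11) * (w.length + 1)) := by
      split_ifs
      · simp
      · exact h3
    have e : (l.length + 1 + 1) * ((8 * B + 11) * (w.length + 1)) =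
        (l.length + 1) * ((8 * B + 11) * (w.length + 1)) + (8 * B + 9) * (w.length + 1) +
          2 * (w.length + 1) := by ring
    omega

theorem findShorter_none {l : List (MulAut (F N))} {w : Word N}
    (hw : FreeGroup.IsCyclicallyReduced w) (h : (findShorter w (l.map table)).val = none) :
    ∀ τ ∈ l, len (cls (FreeGroup.mk w)) ≤ len (τ • cls (FreeGroup.mk w)) := by
  induction l with
  | nil => simp
  | cons τ l ih =>
    obtain ⟨B, -, hB⟩ := exists_table_bound [τ]
    obtain ⟨h1, h2, -⟩ := image_spec τ (hB τ (by simp)) w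
    simp only [List.map_cons, findShorter, tick_val, timed_bind_val, shorter_val,
      decide_eq_true_eq] at h
    split_ifs at h with hlt
    intro σ hσ
    rcases List.mem_cons.1 hσ with rfl | hσ
    · rw [← h2, len_mk hw, len_mk h1]; omega
    · exact ih h σ hσ

theorem findShorter_some {l : List (MulAut (F N))} {w v : Word N}
    (h : (findShorter w (l.map table)).val = some v) :
    FreeGroup.IsCyclicallyReduced v ∧ v.length < w.length ∧
      ∃ τ ∈ l, cls (FreeGroup.mk v) = τ • cls (FreeGroup.mk w) := by
  induction l with
  | nil => simp [findShorter] at h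
  | cons τ l ih =>
    obtain ⟨B, -, hB⟩ := exists_table_bound [τ]
    obtain ⟨h1, h2, -⟩ := image_spec τ (hB τ (by simp)) w
    simp only [List.map_cons, findShorter, tick_val, timed_bind_val, shorter_val,
      decide_eq_true_eq] at h
    split_ifs at h with hlt
    · simp only [timed_pure_val, Option.some.injEq] at h
      subst h
      exact ⟨h1, hlt, τ, by simp, h2⟩
    · obtain ⟨k1, k2, σ, hσ, k3⟩ := ih h
      exact ⟨k1, k2, σ, by simp [hσ], k3⟩

/-- A step found by `findShorter` uses up one of the remaining descents. -/
theorem DescentBound.of_findShorter {moves : List (MulAut (F N))} {k : ℕ} {w v : Word N}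
    (hw : FreeGroup.IsCyclicallyReduced w) (hk : DescentBound moves k (cls (FreeGroup.mk w)))
    (h : (findShorter w (moves.map table)).val = some v) :
    ∃ j < k, DescentBound moves j (cls (FreeGroup.mk v)) := by
  obtain ⟨h1, h2, τ, hτ, h3⟩ := findShorter_some h
  have h4 : len (τ • cls (FreeGroup.mk w)) < len (cls (FreeGroup.mk w)) := by
    rw [← h3, len_mk hw, len_mk h1]; exact h2
  cases k with
  | zero => have := hk τ hτ; omega
  | succ k => exact ⟨k, by omega, by rw [h3]; exact hk τ hτ h4⟩

theorem smul_orbit_subset {c d : Cls N} {τ : MulAut (F N)} (h : c ∈ MulAction.orbit (Out N) d) :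
    τ • c ∈ MulAction.orbit (Out N) d := by
  rw [← MulAction.orbit_eq_iff.2 h]
  exact smul_mem_orbit τ c

/-- The minimization process reaches a minimal class; its running time is the number of rounds
times a linear function of the length of the input. -/
theorem minimization_terminates (hN : 2 ≤ N) {moves : List (MulAut (F N))}
    (h : Enumerates moves) :
    ∃ C, ∀ (k : ℕ) (w : Word N), FreeGroup.IsReduced w →
      DescentBound moves k (cls (FreeGroup.mk w)) →
      TerminatesWithin (minimization (moves.map table) w) (C * (k + 1) * (w.length + 1))
        (fun v => FreeGroup.IsCyclicallyReduced v ∧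
          cls (FreeGroup.mk v) ∈ minimalSet (cls (FreeGroup.mk w))) := by
  obtain ⟨B, -, hB⟩ := exists_table_bound moves
  set D := (moves.length + 1) * (8 * B + 11) with hD
  refine ⟨D + 8, fun k w hw hk => ?_⟩
  obtain ⟨c1, c2, c3, c4⟩ := cycReduce_spec hw
  have key : TerminatesWithin (loop (minStep (moves.map table)) (cycReduce w).val)
      ((k + 1) * (D * (w.length + 1) + 1 + 1))
      (fun v => FreeGroup.IsCyclicallyReduced v ∧
        cls (FreeGroup.mk v) ∈ minimalSet (cls (FreeGroup.mk w))) := by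
    refine loop_terminates (I := fun j v => FreeGroup.IsCyclicallyReduced v ∧
      v.length ≤ w.length ∧ cls (FreeGroup.mk v) ∈ MulAction.orbit (Out N) (cls (FreeGroup.mk w)) ∧
      DescentBound moves j (cls (FreeGroup.mk v))) ?_ ?_ ?_
      ⟨c1, c3, by rw [c2]; exact MulAction.mem_orbit_self _, by rwa [c2]⟩
    · rintro j v ⟨-, hv, -⟩
      have h1 := findShorter_time hB v
      have h2 : D * (v.length + 1) ≤ D * (w.length + 1) := Nat.mul_le_mul_left _ (by omega)
      rw [← mul_assoc, ← hD] at h1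
      simp only [minStep, tick_time, timed_bind_time]
      cases (findShorter v (moves.map table)).val <;> simp <;> omega
    · rintro j v v' ⟨hv1, hv2, hv3, hv4⟩ hnext
      simp only [minStep, tick_val, timed_bind_val] at hnext
      cases hf : (findShorter v (moves.map table)).val with
      | none => rw [hf] at hnext; simp at hnext
      | some v'' =>
        rw [hf] at hnext
        simp only [timed_pure_val, Sum.inl.injEq] at hnext
        subst hnext
        obtain ⟨i, hi, hd⟩ := hv4.of_findShorter hv1 hf
        obtain ⟨k1, k2, τ, -, k3⟩ := findShorter_some hf
        exact ⟨i, hi, k1, by omega, by rw [k3]; exact smul_orbit_subset hv3, hd⟩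
    · rintro j v a ⟨hv1, hv2, hv3, hv4⟩ hexit
      simp only [minStep, tick_val, timed_bind_val] at hexit
      cases hf : (findShorter v (moves.map table)).val with
      | some v'' => rw [hf] at hexit; simp at hexit
      | none =>
        rw [hf] at hexit
        simp only [timed_pure_val, Sum.inr.injEq] at hexit
        subst hexit
        exact ⟨hv1, hv3, h.isOutMinimal hN (findShorter_none hv1 hf)⟩
  refine ((terminatesWithin_run (P := fun v => v = (cycReduce w).val) c4 rfl).bind
    (T' := (k + 1) * (D * (w.length + 1) + 1 + 1)) ?_).mono ?_ fun _ h => h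
  · rintro _ rfl
    exact key
  · nlinarith [Nat.zero_le (k * w.length)]

/-- In the accelerated process, a bound on the descents of either of the two words that are
processed in parallel suffices. -/
theorem minimizationSpeedUp_terminates (hN : 2 ≤ N) {moves : List (MulAut (F N))}
    (h : Enumerates moves) (Ψ : MulAut (F N)) :
    ∃ C, ∀ (k : ℕ) (w : Word N), FreeGroup.IsReduced w →
      (DescentBound moves k (cls (FreeGroup.mk w)) ∨
        DescentBound moves k (Ψ • cls (FreeGroup.mk w))) →
      TerminatesWithin (minimizationSpeedUp (moves.map table) [table Ψ] w)
        (C * (k + 1) * (w.length + 1))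
        (fun v => FreeGroup.IsCyclicallyReduced v ∧
          cls (FreeGroup.mk v) ∈ minimalSet (cls (FreeGroup.mk w))) := by
  obtain ⟨B, hB1, hB⟩ := exists_table_bound (Ψ :: moves)
  have hB' : ∀ τ ∈ moves, ∀ x, (table τ x).length ≤ B := fun τ hτ => hB τ (by simp [hτ])
  set D := (moves.length + 1) * (8 * B + 11) with hD
  refine ⟨2 * D * B + 8 * B + 24, fun k w hw hk => ?_⟩
  obtain ⟨c1, c2, c3, c4⟩ := cycReduce_spec hw
  obtain ⟨i1, i2, i3, i4⟩ := image_spec Ψ (hB Ψ (by simp)) (cycReduce w).val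
  have i3' : (image (table Ψ) (cycReduce w).val).val.length ≤ B * w.length :=
    i3.trans (Nat.mul_le_mul_left _ c3)
  have i4' : (image (table Ψ) (cycReduce w).val).time ≤ (8 * B + 9) * (w.length + 1) :=
    i4.trans (Nat.mul_le_mul_left _ (by omega))
  have hwB : w.length ≤ B * w.length := Nat.le_mul_of_pos_left _ hB1
  have key : TerminatesWithin (loop (parRound (moves.map table))
      [(cycReduce w).val, (image (table Ψ) (cycReduce w).val).val])
      ((k + 1) * (2 * (D * (B * w.length + 1)) + 3 + 1))
      (fun v => FreeGroup.IsCyclicallyReduced v ∧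
        cls (FreeGroup.mk v) ∈ minimalSet (cls (FreeGroup.mk w))) := by
    refine loop_terminates (I := fun j s => ∃ p q, s = [p, q] ∧
      (∀ v ∈ [p, q], FreeGroup.IsCyclicallyReduced v ∧ v.length ≤ B * w.length ∧
        cls (FreeGroup.mk v) ∈ MulAction.orbit (Out N) (cls (FreeGroup.mk w))) ∧
      (DescentBound moves j (cls (FreeGroup.mk p)) ∨ DescentBound moves j (cls (FreeGroup.mk q))))
      ?_ ?_ ?_ ⟨_, _, rfl, ?_, ?_⟩
    · rintro j _ ⟨p, q, rfl, hv, -⟩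
      have hf : ∀ v ∈ [p, q], (findShorter v (moves.map table)).time ≤
          D * (B * w.length + 1) := by
        intro v hv'
        have h1 := findShorter_time hB' v
        rw [← mul_assoc, ← hD] at h1
        exact h1.trans (Nat.mul_le_mul_left _ (by have := (hv v hv').2.1; omega))
      have hp := hf p (by simp)
      have hq := hf q (by simp)
      simp only [parRound, tick_time, timed_bind_time]
      cases (findShorter p (moves.map table)).val with
      | none => simp; omega
      | some p' =>
        simp only [timed_bind_time, tick_time, tick_val, timed_bind_val]
        cases (findShorter q (moves.map table)).val with
        | none => simp; omega
        | some q' => simp; omega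
    · rintro j _ s' ⟨p, q, rfl, hv, hd⟩ hnext
      simp only [parRound, tick_val, timed_bind_val] at hnext
      cases hp : (findShorter p (moves.map table)).val with
      | none => simp [hp] at hnext
      | some p' =>
        cases hq : (findShorter q (moves.map table)).val with
        | none => simp [hp, hq] at hnext
        | some q' =>
          simp only [hp, hq, timed_bind_val, tick_val, timed_pure_val, Sum.inl.injEq] at hnext
          subst hnext
          have hvp := hv p (by simp)
          have hvq := hv q (by simp)
          have step : ∀ v ∈ [p', q'], FreeGroup.IsCyclicallyReduced v ∧
              v.length ≤ B * w.length ∧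
              cls (FreeGroup.mk v) ∈ MulAction.orbit (Out N) (cls (FreeGroup.mk w)) := by
            intro v hv'
            simp only [List.mem_cons, List.not_mem_nil, or_false] at hv'
            rcases hv' with rfl | rfl
            · obtain ⟨k1, k2, τ, -, k3⟩ := findShorter_some hp
              exact ⟨k1, by omega, by rw [k3]; exact smul_orbit_subset hvp.2.2⟩
            · obtain ⟨k1, k2, τ, -, k3⟩ := findShorter_some hq
              exact ⟨k1, by omega, by rw [k3]; exact smul_orbit_subset hvq.2.2⟩
          rcases hd with hd | hd
          · obtain ⟨i, hi, hd'⟩ := hd.of_findShorter hvp.1 hp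
            exact ⟨i, hi, p', q', rfl, step, Or.inl hd'⟩
          · obtain ⟨i, hi, hd'⟩ := hd.of_findShorter hvq.1 hq
            exact ⟨i, hi, p', q', rfl, step, Or.inr hd'⟩
    · rintro j _ a ⟨p, q, rfl, hv, -⟩ hexit
      have fin : ∀ v ∈ [p, q], (findShorter v (moves.map table)).val = none →
          FreeGroup.IsCyclicallyReduced v ∧
            cls (FreeGroup.mk v) ∈ minimalSet (cls (FreeGroup.mk w)) := fun v hv' hf =>
        ⟨(hv v hv').1, (hv v hv').2.2, h.isOutMinimal hN (findShorter_none (hv v hv').1 hf)⟩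
      simp only [parRound, tick_val, timed_bind_val] at hexit
      cases hp : (findShorter p (moves.map table)).val with
      | none =>
        rw [hp] at hexit
        simp only [timed_pure_val, Sum.inr.injEq] at hexit
        subst hexit
        exact fin p (by simp) hp
      | some p' =>
        cases hq : (findShorter q (moves.map table)).val with
        | none =>
          simp only [hp, hq, timed_bind_val, tick_val, timed_pure_val, Sum.inr.injEq] at hexit
          subst hexit
          exact fin q (by simp) hq
        | some q' => simp [hp, hq] at hexit
    · intro v hv
      simp only [List.mem_cons, List.not_mem_nil, or_false] at hv
      rcases hv with rfl | rfl
      · exact ⟨c1, by omega, by rw [c2]; exact MulAction.mem_orbit_self _⟩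
      · exact ⟨i1, i3', by rw [i2, c2]; exact smul_mem_orbit _ _⟩
    · rwa [i2, c2]
  refine ((terminatesWithin_run (P := fun v => v = (cycReduce w).val) c4 rfl).bind
    (T' := (8 * B + 9) * (w.length + 1) + 2 + (k + 1) * (2 * (D * (B * w.length + 1)) + 3 + 1))
    ?_).mono ?_ fun _ h => h
  · rintro _ rfl
    refine (terminatesWithin_run
      (P := fun vs => vs = [(image (table Ψ) (cycReduce w).val).val]) ?_ ?_).bind ?_
    · simp only [images, tick_time, timed_bind_time, timed_pure_time]
      omega
    · simp [images]
    · rintro _ rfl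
      exact key
  · have e1 : D * (B * w.length + 1) ≤ D * B * (w.length + 1) := by
      have : D * 1 ≤ D * B := Nat.mul_le_mul_left _ hB1
      nlinarith
    have e2 : (k + 1) * (2 * (D * (B * w.length + 1)) + 3 + 1) ≤
        (2 * D * B + 4) * (k + 1) * (w.length + 1) := by
      calc (k + 1) * (2 * (D * (B * w.length + 1)) + 3 + 1)
          ≤ (k + 1) * ((2 * D * B + 4) * (w.length + 1)) := by
            refine Nat.mul_le_mul_left _ ?_
            nlinarith
        _ = _ := by ring
    have e3 : (8 * B + 20) * (w.length + 1) ≤ (8 * B + 20) * (k + 1) * (w.length + 1) :=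
      Nat.mul_le_mul_right _ (Nat.le_mul_of_pos_right _ (by omega))
    nlinarith

end

/-! ### The stabilization process -/

section
variable {N : ℕ}

/-- The lists that occur in the stabilization process: they represent pairwise different classes
from `S` by cyclically reduced words of length `n`. -/
def IsLevelList (S : Finset (Cls N)) (n : ℕ) (T : List (Word N)) : Prop :=
  (T.map fun v => cls (FreeGroup.mk v)).Nodup ∧
    ∀ v ∈ T, FreeGroup.IsCyclicallyReduced v ∧ v.length = n ∧ cls (FreeGroup.mk v) ∈ S

theorem IsLevelList.length_le {S : Finset (Cls N)} {n : ℕ} {T : List (Word N)}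
    (h : IsLevelList S n T) : T.length ≤ S.card := by
  classical
  rw [← List.length_map (f := fun v => cls (FreeGroup.mk v)), ← List.toFinset_card_of_nodup h.1]
  refine Finset.card_le_card fun c hc => ?_
  rw [List.mem_toFinset, List.mem_map] at hc
  obtain ⟨v, hv, rfl⟩ := hc
  exact (h.2 v hv).2.2

theorem IsLevelList.mem_val_iff {S : Finset (Cls N)} {n : ℕ} {T : List (Word N)}
    (h : IsLevelList S n T) {v : Word N} (hv : FreeGroup.IsCyclicallyReduced v)
    (hn : v.length = n) :
    (mem v T).val = true ↔ cls (FreeGroup.mk v) ∈ T.map fun u => cls (FreeGroup.mk u) := by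
  rw [mem_val v T fun u hu => by rw [(h.2 u hu).2.1, hn], List.mem_map]
  refine exists_congr fun u => and_congr_right fun hu => ?_
  rw [cls_eq_iff_isRotated (h.2 u hu).1 hv]

theorem IsLevelList.mem_time_le {S : Finset (Cls N)} {n : ℕ} {T : List (Word N)}
    (h : IsLevelList S n T) {v : Word N} (hn : v.length = n) :
    (mem v T).time ≤ (6 * S.card + 1) * (n + 1) := by
  have h1 := mem_time v T fun u hu => by rw [(h.2 u hu).2.1, hn]
  have h2 : T.length * (6 * v.length + 6) ≤ S.card * (6 * v.length + 6) :=
    Nat.mul_le_mul_right _ h.length_le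
  rw [hn] at h1 h2
  nlinarith

/-- The set `S` is closed under length-preserving moves. -/
def LevelClosed (l : List (MulAut (F N))) (S : Set (Cls N)) : Prop :=
  ∀ c ∈ S, ∀ τ ∈ l, len (τ • c) = len c → τ • c ∈ S

theorem expandWord_time {l : List (MulAut (F N))} {B n : ℕ}
    (hB : ∀ τ ∈ l, ∀ x, (table τ x).length ≤ B) {S : Finset (Cls N)}
    (hS : LevelClosed l S) {u : Word N} (hu : FreeGroup.IsCyclicallyReduced u)
    (hun : u.length = n) (huS : cls (FreeGroup.mk u) ∈ S) {T : List (Word N)}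
    (hT : IsLevelList S n T) (g : Bool) :
    (expandWord u (l.map table) T g).time ≤
        (l.length + 1) * ((8 * B + 6 * S.card + 12) * (n + 1)) ∧
      IsLevelList S n (expandWord u (l.map table) T g).val.1 := by
  induction l generalizing T g with
  | nil =>
    refine ⟨?_, hT⟩
    simp only [List.map_nil, expandWord, tick_time, timed_pure_time]
    exact Nat.succ_le_of_lt (by positivity)
  | cons τ l ih =>
    obtain ⟨h1, h2, -, h3⟩ := image_spec τ (hB τ (by simp)) u
    have h4 := (sameLen_time (image (table τ) u).val u).2
    have ih' := fun {T} => ih (fun σ hσ => hB σ (by simp [hσ]))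
      (fun c hc σ hσ => hS c hc σ (by simp [hσ])) (T := T)
    simp only [List.map_cons, expandWord, tick_time, tick_val, timed_bind_time, timed_bind_val,
      List.length_cons, sameLen_val, decide_eq_true_eq]
    rw [hun] at h3 h4
    have e : (l.length + 1 + 1) * ((8 * B + 6 * S.card + 12) * (n + 1)) =
        (l.length + 1) * ((8 * B + 6 * S.card + 12) * (n + 1)) + (8 * B + 9) * (n + 1) +
          (6 * S.card + 1) * (n + 1) + 2 * (n + 1) := by ring
    split_ifs with h5
    · have h6 := hT.mem_time_le (h5.trans hun)
      simp only [timed_bind_time, timed_bind_val]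
      split_ifs with h7
      · obtain ⟨k1, k2⟩ := ih' hT g
        exact ⟨by omega, k2⟩
      · rw [hT.mem_val_iff h1 (h5.trans hun)] at h7
        have hT' : IsLevelList S n ((image (table τ) u).val :: T) := by
          refine ⟨?_, ?_⟩
          · rw [List.map_cons, List.nodup_cons]
            exact ⟨h7, hT.1⟩
          · intro v hv
            rcases List.mem_cons.1 hv with rfl | hv
            · refine ⟨h1, h5.trans hun, ?_⟩
              rw [h2]
              refine hS _ huS τ (by simp) ?_
              rw [← h2, len_mk h1, len_mk hu, h5]
            · exact hT.2 v hv
        obtain ⟨k1, k2⟩ := ih' hT' true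
        exact ⟨by omega, k2⟩
    · obtain ⟨k1, k2⟩ := ih' hT g
      exact ⟨by omega, k2⟩

/-- The list only grows, and the flag says whether it has grown. -/
theorem expandWord_suffix (l : List (MulAut (F N))) (u : Word N) (T : List (Word N)) (g : Bool) :
    T <:+ (expandWord u (l.map table) T g).val.1 ∧
      ((expandWord u (l.map table) T g).val.2 = true →
        g = true ∨ T.length < (expandWord u (l.map table) T g).val.1.length) := by
  induction l generalizing T g with
  | nil => simp [expandWord]
  | cons τ l ih =>
    simp only [List.map_cons, expandWord, tick_val, timed_bind_val]
    split_ifs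
    · simp only [timed_bind_val]
      split_ifs
      · exact ih T g
      · have h1 := (ih ((image (table τ) u).val :: T) true).1
        refine ⟨(List.suffix_cons _ _).trans h1, fun _ => Or.inr ?_⟩
        have := h1.length_le
        rw [List.length_cons] at this
        omega
    · exact ih T g

theorem expandWord_true (l : List (MulAut (F N))) (u : Word N) (T : List (Word N)) :
    (expandWord u (l.map table) T true).val.2 = true := by
  induction l generalizing T with
  | nil => rfl
  | cons τ l ih =>
    simp only [List.map_cons, expandWord, tick_val, timed_bind_val]
    split_ifs
    · simp only [timed_bind_val]
      split_ifs <;> exact ih _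
    · exact ih _

/-- If nothing new is found, then all classes of the same length that one move makes are in the
list. -/
theorem expandWord_false {l : List (MulAut (F N))} {n : ℕ} {S : Finset (Cls N)} {u : Word N}
    (hun : u.length = n) {T : List (Word N)} (hT : IsLevelList S n T) {g : Bool}
    (h : (expandWord u (l.map table) T g).val.2 = false) :
    (expandWord u (l.map table) T g).val.1 = T ∧ g = false ∧
      ∀ τ ∈ l, len (τ • cls (FreeGroup.mk u)) = n →
        τ • cls (FreeGroup.mk u) ∈ T.map fun v => cls (FreeGroup.mk v) := by
  induction l with
  | nil => exact ⟨rfl, h, by simp⟩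
  | cons τ l ih =>
    obtain ⟨B, -, hB⟩ := exists_table_bound [τ]
    obtain ⟨h1, h2, -⟩ := image_spec τ (hB τ (by simp)) u
    simp only [List.map_cons, expandWord, tick_val, timed_bind_val, sameLen_val,
      decide_eq_true_eq] at h ⊢
    split_ifs at h ⊢ with h3
    · simp only [timed_bind_val] at h ⊢
      split_ifs at h ⊢ with h4
      · obtain ⟨k1, k2, k3⟩ := ih h
        refine ⟨k1, k2, fun σ hσ => ?_⟩
        rcases List.mem_cons.1 hσ with rfl | hσ
        · intro _
          rw [← h2]
          exact (hT.mem_val_iff h1 (h3.trans hun)).1 h4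
        · exact k3 σ hσ
      · rw [expandWord_true] at h
        exact absurd h (by simp)
    · obtain ⟨k1, k2, k3⟩ := ih h
      refine ⟨k1, k2, fun σ hσ => ?_⟩
      rcases List.mem_cons.1 hσ with rfl | hσ
      · intro hl
        rw [← h2, len_mk h1] at hl
        exact absurd (hl.trans hun.symm) h3
      · exact k3 σ hσ

theorem expand_time {l : List (MulAut (F N))} {B n : ℕ}
    (hB : ∀ τ ∈ l, ∀ x, (table τ x).length ≤ B) {S : Finset (Cls N)}
    (hS : LevelClosed l S) (us : List (Word N))
    (hus : ∀ u ∈ us, FreeGroup.IsCyclicallyReduced u ∧ u.length = n ∧ cls (FreeGroup.mk u) ∈ S)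
    {T : List (Word N)} (hT : IsLevelList S n T) (g : Bool) :
    (expand (l.map table) us T g).time ≤
        us.length * ((l.length + 1) * ((8 * B + 6 * S.card + 12) * (n + 1)) + 1) + 1 ∧
      IsLevelList S n (expand (l.map table) us T g).val.1 := by
  induction us generalizing T g with
  | nil => exact ⟨by simp [expand], hT⟩
  | cons u us ih =>
    obtain ⟨h1, h2, h3⟩ := hus u (by simp)
    obtain ⟨k1, k2⟩ := expandWord_time hB hS h1 h2 h3 hT g
    obtain ⟨i1, i2⟩ := ih (fun v hv => hus v (by simp [hv])) k2
      (expandWord u (l.map table) T g).val.2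
    simp only [expand, tick_time, tick_val, timed_bind_time, timed_bind_val, List.length_cons]
    refine ⟨?_, i2⟩
    rw [Nat.succ_mul]
    omega

theorem expand_suffix (l : List (MulAut (F N))) (us T : List (Word N)) (g : Bool) :
    T <:+ (expand (l.map table) us T g).val.1 ∧
      ((expand (l.map table) us T g).val.2 = true →
        g = true ∨ T.length < (expand (l.map table) us T g).val.1.length) := by
  induction us generalizing T g with
  | nil => simp [expand]
  | cons u us ih =>
    obtain ⟨h1, h2⟩ := expandWord_suffix l u T g
    obtain ⟨i1, i2⟩ := ih (expandWord u (l.map table) T g).val.1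
      (expandWord u (l.map table) T g).val.2
    simp only [expand, tick_val, timed_bind_val]
    refine ⟨h1.trans i1, fun h => ?_⟩
    have := i1.length_le
    have := h1.length_le
    rcases i2 h with h | h
    · rcases h2 h with h | h
      · exact Or.inl h
      · exact Or.inr (by omega)
    · exact Or.inr (by omega)

theorem expand_true (l : List (MulAut (F N))) (us T : List (Word N)) :
    (expand (l.map table) us T true).val.2 = true := by
  induction us generalizing T with
  | nil => rfl
  | cons u us ih =>
    simp only [expand, tick_val, timed_bind_val, expandWord_true]
    exact ih _

theorem expand_false {l : List (MulAut (F N))} {n : ℕ} {S : Finset (Cls N)} {us : List (Word N)}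
    (hus : ∀ u ∈ us, u.length = n) {T : List (Word N)} (hT : IsLevelList S n T) {g : Bool}
    (h : (expand (l.map table) us T g).val.2 = false) :
    g = false ∧ ∀ u ∈ us, ∀ τ ∈ l, len (τ • cls (FreeGroup.mk u)) = n →
      τ • cls (FreeGroup.mk u) ∈ T.map fun v => cls (FreeGroup.mk v) := by
  induction us generalizing T g with
  | nil => exact ⟨h, by simp⟩
  | cons u us ih =>
    simp only [expand, tick_val, timed_bind_val] at h
    have hg : (expandWord u (l.map table) T g).val.2 = false := by
      by_contra hne
      rw [Bool.not_eq_false] at hne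
      rw [hne, expand_true] at h
      exact absurd h (by simp)
    obtain ⟨k1, k2, k3⟩ := expandWord_false (hus u (by simp)) hT hg
    rw [k1] at h
    obtain ⟨-, i2⟩ := ih (fun v hv => hus v (by simp [hv])) hT h
    refine ⟨k2, fun v hv => ?_⟩
    rcases List.mem_cons.1 hv with rfl | hv
    · exact k3
    · exact i2 v hv

/-- If `S` is closed under length-preserving moves, then the stabilization process stays in `S`,
and it ends with a list that is closed under length-preserving moves. -/
theorem stabilization_terminates (moves : List (MulAut (F N))) (m : ℕ) :
    ∃ C, ∀ (S : Finset (Cls N)) (u : Word N), S.card ≤ m → LevelClosed moves (S : Set (Cls N)) →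
      FreeGroup.IsCyclicallyReduced u → cls (FreeGroup.mk u) ∈ S →
      TerminatesWithin (stabilization (moves.map table) u) (C * (u.length + 1))
        (fun T => IsLevelList S u.length T ∧
          cls (FreeGroup.mk u) ∈ T.map (fun v => cls (FreeGroup.mk v)) ∧
          ∀ v ∈ T, ∀ τ ∈ moves, len (τ • cls (FreeGroup.mk v)) = u.length →
            τ • cls (FreeGroup.mk v) ∈ T.map fun v => cls (FreeGroup.mk v)) := by
  obtain ⟨B, -, hB⟩ := exists_table_bound moves
  set D := (moves.length + 1) * (8 * B + 6 * m + 12) with hD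
  refine ⟨(m + 1) * (m * (D + 1) + 3), fun S u hm hS hu huS => ?_⟩
  have hstep : ∀ T, IsLevelList S u.length T →
      (expand (moves.map table) T T false).time ≤ m * ((D + 1) * (u.length + 1)) + 1 ∧
        IsLevelList S u.length (expand (moves.map table) T T false).val.1 := by
    intro T hT
    obtain ⟨h1, h2⟩ := expand_time hB hS T hT.2 hT false
    refine ⟨h1.trans (Nat.add_le_add_right (Nat.mul_le_mul (hT.length_le.trans hm) ?_) 1), h2⟩
    have h3 : (moves.length + 1) * ((8 * B + 6 * S.card + 12) * (u.length + 1)) ≤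
        D * (u.length + 1) := by
      rw [hD, mul_assoc]
      refine Nat.mul_le_mul_left _ (Nat.mul_le_mul_right _ ?_)
      omega
    have e : (D + 1) * (u.length + 1) = D * (u.length + 1) + (u.length + 1) := by ring
    omega
  have key := loop_terminates (body := stabStep (moves.map table))
    (I := fun k T => IsLevelList S u.length T ∧
      cls (FreeGroup.mk u) ∈ T.map (fun v => cls (FreeGroup.mk v)) ∧ m ≤ T.length + k)
    (C := m * ((D + 1) * (u.length + 1)) + 2)
    (P := fun T => IsLevelList S u.length T ∧
      cls (FreeGroup.mk u) ∈ T.map (fun v => cls (FreeGroup.mk v)) ∧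
      ∀ v ∈ T, ∀ τ ∈ moves, len (τ • cls (FreeGroup.mk v)) = u.length →
        τ • cls (FreeGroup.mk v) ∈ T.map fun v => cls (FreeGroup.mk v))
    ?_ ?_ ?_ (k := m) (s := [u]) ⟨⟨by simp, by simpa using ⟨hu, huS⟩⟩, by simp, by omega⟩
  · refine key.mono ?_ fun _ h => h
    rw [mul_assoc]
    refine Nat.mul_le_mul_left _ ?_
    nlinarith
  · rintro k T ⟨hT, -⟩
    have h1 := (hstep T hT).1
    simp only [stabStep, tick_time, timed_bind_time]
    split_ifs <;> simp <;> omega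
  · rintro k T T' ⟨hT, huT, hk⟩ hnext
    simp only [stabStep, tick_val, timed_bind_val] at hnext
    split_ifs at hnext with hg
    · simp only [timed_pure_val, Sum.inl.injEq] at hnext
      subst hnext
      obtain ⟨h1, h2⟩ := expand_suffix moves T T false
      have h3 := (hstep T hT).2
      have h4 := h3.length_le
      have h5 := (h2 hg).resolve_left (by simp)
      refine ⟨k - 1, by omega, h3, (h1.map _).subset huT, by omega⟩
  · rintro k T T' ⟨hT, huT, -⟩ hexit
    simp only [stabStep, tick_val, timed_bind_val] at hexit
    split_ifs at hexit with hg
    · simp only [timed_pure_val, Sum.inr.injEq] at hexit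
      subst hexit
      rw [Bool.not_eq_true] at hg
      exact ⟨hT, huT, (expand_false (fun v hv => (hT.2 v hv).2.1) hT hg).2⟩

/-! ### Deciding whether two elements lie in one orbit -/

/-- On two minimal classes, the second half of the algorithm decides whether they lie in one orbit;
its running time is linear if the first one lies in the orbit of a minimizing set. -/
theorem compareMinimal_terminates (hN : 2 ≤ N) {moves : List (MulAut (F N))}
    (h : Enumerates moves) (m : ℕ) :
    ∃ C, ∀ (S : Finset (Cls N)) (u u' : Word N), S.card ≤ m →
      FreeGroup.IsCyclicallyReduced u → FreeGroup.IsCyclicallyReduced u' →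
      IsOutMinimal (cls (FreeGroup.mk u)) → IsOutMinimal (cls (FreeGroup.mk u')) →
      minimalSet (cls (FreeGroup.mk u)) ⊆ S →
      TerminatesWithin (compareMinimal (moves.map table) u u') (C * (u.length + 1))
        (fun b => b = true ↔ SameOrbit (FreeGroup.mk u) (FreeGroup.mk u')) := by
  classical
  obtain ⟨C, hC⟩ := stabilization_terminates moves m
  refine ⟨C + 6 * m + 2, fun S u u' hm hu hu' humin hu'min hS => ?_⟩
  -- the minimal classes of the orbit
  set L := S.filter fun c => c ∈ minimalSet (cls (FreeGroup.mk u)) with hL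
  have hmemL : ∀ c, c ∈ L ↔ c ∈ minimalSet (cls (FreeGroup.mk u)) := fun c => by
    rw [hL, Finset.mem_filter]
    exact ⟨fun hc => hc.2, fun hc => ⟨hS hc, hc⟩⟩
  have hLm : L.card ≤ m := (Finset.card_filter_le _ _).trans hm
  have hclosed : LevelClosed moves (L : Set (Cls N)) := by
    intro c hc τ _ hlen
    rw [Finset.mem_coe, hmemL] at hc ⊢
    refine ⟨smul_orbit_subset hc.1, fun ω => ?_⟩
    rw [hlen, ← toOut_smul, ← mul_smul]
    exact hc.2 _
  have huL : cls (FreeGroup.mk u) ∈ L := (hmemL _).2 ⟨MulAction.mem_orbit_self _, humin⟩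
  refine ((terminatesWithin_run (P := fun b => b = decide (u.length = u'.length))
    (sameLen_time u u').1 (sameLen_val u u')).bind
    (T' := C * (u.length + 1) + (6 * m + 1) * (u.length + 1)) ?_).mono (by nlinarith)
    fun _ h => h
  rintro _ rfl
  have hsame : SameOrbit (FreeGroup.mk u) (FreeGroup.mk u') ↔
      cls (FreeGroup.mk u') ∈ MulAction.orbit (Out N) (cls (FreeGroup.mk u)) := by
    rw [SameOrbit, eq_comm, MulAction.orbit_eq_iff]
  by_cases hlen : u.length = u'.length
  · rw [if_pos (by simpa using hlen)]
    refine (hC L u hLm hclosed hu huL).bind ?_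
    rintro T ⟨hT, huT, hTc⟩
    refine terminatesWithin_run ((hT.mem_time_le hlen.symm).trans ?_) ?_
    · exact Nat.mul_le_mul_right _ (by omega)
    · rw [hT.mem_val_iff hu' hlen.symm, hsame]
      constructor
      · intro hmem
        obtain ⟨v, hv, he⟩ := List.mem_map.1 hmem
        have := (hmemL _).1 (hT.2 v hv).2.2
        rw [he] at this
        exact this.1
      · intro hmem
        refine h.mem_of_closed hN (L := {c | c ∈ T.map fun v => cls (FreeGroup.mk v)}) humin hmem
          (len_eq_of_minimal humin hu'min hmem) huT ?_
        intro c hc τ hτ hl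
        obtain ⟨v, hv, rfl⟩ := List.mem_map.1 hc
        exact hTc v hv τ hτ (by rw [hl, len_mk hu])
  · rw [if_neg (by simpa using hlen)]
    refine terminatesWithin_pure ?_
    rw [hsame]
    refine iff_of_false (by simp) fun hmem => hlen ?_
    rw [← len_mk hu, ← len_mk hu', len_eq_of_minimal humin hu'min hmem]

end

section
variable {N : ℕ}

/-- Two minimization processes followed by the comparison of their results decide whether two
elements lie in one orbit, if the orbit of the first one contains a minimizing set. -/
theorem bind_compareMinimal_terminates (hN : 2 ≤ N) {moves : List (MulAut (F N))}
    (h : Enumerates moves) (M : ℕ) {lam : ℝ} (eps : ℝ) (hlam : 1 < lam) :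
    ∃ C, ∀ (m₁ m₂ : Comp (Word N)) (T₁ T₂ : ℕ) (u₁ u₂ : F N),
      (∃ c ∈ MulAction.orbit (Out N) (cls u₁), IsMLEMinimal M lam eps c) →
      TerminatesWithin m₁ T₁ (fun v => FreeGroup.IsCyclicallyReduced v ∧
        cls (FreeGroup.mk v) ∈ minimalSet (cls u₁)) →
      TerminatesWithin m₂ T₂ (fun v => FreeGroup.IsCyclicallyReduced v ∧
        cls (FreeGroup.mk v) ∈ minimalSet (cls u₂)) →
      TerminatesWithin
        (do let u ← m₁
            let u' ← m₂
            compareMinimal (moves.map table) u u')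
        (T₁ + (T₂ + C * (u₁.norm + 1))) (fun b => b = true ↔ SameOrbit u₁ u₂) := by
  obtain ⟨C, hC⟩ := compareMinimal_terminates hN h M
  refine ⟨C, fun m₁ m₂ T₁ T₂ u₁ u₂ ⟨c, hc, S, hS, hcS⟩ h₁ h₂ => h₁.bind ?_⟩
  rintro v₁ ⟨hv₁, ho₁, hm₁⟩
  refine h₂.bind ?_
  rintro v₂ ⟨hv₂, ho₂, hm₂⟩
  have e₁ := MulAction.orbit_eq_iff.2 ho₁
  have e₂ := MulAction.orbit_eq_iff.2 ho₂
  refine (hC S v₁ v₂ hS.card_le hv₁ hv₂ hm₁ hm₂ ?_).mono (Nat.mul_le_mul_left _ ?_) ?_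
  · rintro d ⟨hd, hdm⟩
    rw [e₁, ← MulAction.orbit_eq_iff.2 hc] at hd
    exact hS.mem_of_minimal hlam hcS hd hdm
  · -- the minimal class is not longer than `u₁`
    obtain ⟨φ, hφ⟩ := mem_orbit_iff.1 ho₁
    have h1 := isOutMinimal_iff.1 hm₁ φ⁻¹
    rw [← hφ, inv_smul_smul, hφ, len_mk hv₁] at h1
    have h2 := len_cls_le (FreeGroup.isReduced_toWord (x := u₁))
    rw [FreeGroup.mk_toWord] at h2
    have h3 : u₁.toWord.length = u₁.norm := rfl
    omega
  · intro b hb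
    rw [hb, SameOrbit, SameOrbit, e₁, e₂]

theorem IsMLEMinimal.descentBound {M : ℕ} {lam eps : ℝ} {c : Cls N}
    (hc : IsMLEMinimal M lam eps c) (hlam : 1 < lam) (moves : List (MulAut (F N))) :
    DescentBound moves M c := by
  obtain ⟨S, hS, hcS⟩ := hc
  exact hS.descentBound hlam moves hcS

theorem descentBound_norm (moves : List (MulAut (F N))) (u : F N) :
    DescentBound moves u.norm (cls u) := by
  refine descentBound_len moves ?_
  have h := len_cls_le (FreeGroup.isReduced_toWord (x := u))
  rwa [FreeGroup.mk_toWord] at h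

theorem norm_pos_of_ne_one {u : F N} (hu : u ≠ 1) : 1 ≤ u.norm :=
  Nat.one_le_iff_ne_zero.2 fun h => hu (FreeGroup.norm_eq_zero.1 h)

theorem linear_time_le (C k : ℕ) {n : ℕ} (hn : 1 ≤ n) :
    C * (k + 1) * (n + 1) ≤ 4 * C * (k + 1) * n := by
  have : C * (k + 1) * (n + 1) ≤ C * (k + 1) * (4 * n) := Nat.mul_le_mul_left _ (by omega)
  linarith

theorem quadratic_time_le (C k : ℕ) {n : ℕ} (hn : 1 ≤ n) :
    C * (n + 1) * (n + 1) ≤ 4 * C * (k + 1) * n ^ 2 := by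
  have h1 : C * (n + 1) * (n + 1) ≤ C * (2 * n) * (2 * n) :=
    Nat.mul_le_mul (Nat.mul_le_mul_left _ (by omega)) (by omega)
  have h2 : 4 * C * n ^ 2 * 1 ≤ 4 * C * n ^ 2 * (k + 1) := Nat.mul_le_mul_left _ (by omega)
  linarith

theorem total_time_le {a C n x y : ℕ} (hn : 1 ≤ n) (hx : n ≤ x) :
    a * x + (a * y + C * (n + 1)) ≤ (2 * a + 2 * C + 1) * max x y := by
  have h1 : a * x ≤ a * max x y := Nat.mul_le_mul_left _ (le_max_left _ _)
  have h2 : a * y ≤ a * max x y := Nat.mul_le_mul_left _ (le_max_right _ _)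
  have h3 : C * (n + 1) ≤ C * (2 * max x y) :=
    Nat.mul_le_mul_left _ (by have := le_max_left x y; omega)
  have h4 := Nat.zero_le (max x y)
  linarith

end

end Whitehead

open Whitehead

theorem theoremt (N : ℕ) (hN : 2 ≤ N)
    (moves : List (MulAut (Whitehead.F N))) (hmoves : Whitehead.Enumerates moves)
    (M : ℕ) (hM : 1 ≤ M) (lam eps : ℝ) (hlam : 1 < lam) (heps : 0 ≤ eps) (hgap : eps < lam - 1) :
    ∃ K : ℕ, 1 ≤ K ∧
      -- (a)
      (∀ u ∈ Whitehead.U N M lam eps,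
        Whitehead.TerminatesWithin
          (Whitehead.minimization (moves.map Whitehead.table) u.toWord) (K * u.norm)
          (fun v => Whitehead.cls (FreeGroup.mk v) ∈ Whitehead.minimalSet (Whitehead.cls u))) ∧
      -- (b)
      (∀ u₁ ∈ Whitehead.U N M lam eps, ∀ u₂ ∈ Whitehead.U N M lam eps,
        Whitehead.TerminatesWithin
          (Whitehead.whitehead (moves.map Whitehead.table) u₁.toWord u₂.toWord)
          (K * max u₁.norm u₂.norm)
          (fun b => b = true ↔ Whitehead.SameOrbit u₁ u₂)) ∧
      -- (c)
      (∀ u₁ ∈ Whitehead.Y N M lam eps, ∀ u₂ : Whitehead.F N, u₂ ≠ 1 →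
        Whitehead.TerminatesWithin
          (Whitehead.whitehead (moves.map Whitehead.table) u₁.toWord u₂.toWord)
          (K * max (u₁.norm ^ 2) (u₂.norm ^ 2))
          (fun b => b = true ↔ Whitehead.SameOrbit u₁ u₂)) ∧
      -- (d)
      (∀ u₁ ∈ Whitehead.U N M lam eps, ∀ u₂ : Whitehead.F N, u₂ ≠ 1 →
        Whitehead.TerminatesWithin
          (Whitehead.whitehead (moves.map Whitehead.table) u₁.toWord u₂.toWord)
          (K * max u₁.norm (u₂.norm ^ 2))
          (fun b => b = true ↔ Whitehead.SameOrbit u₁ u₂)) ∧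
      -- (e)
      (∀ (ψ : Whitehead.Out N) (Ψ : MulAut (Whitehead.F N)), Whitehead.toOut Ψ = ψ →
        ∃ K' : ℕ, 1 ≤ K' ∧
          ∀ u₁ ∈ Whitehead.UPsi N M lam eps ψ, ∀ u₂ ∈ Whitehead.UPsi N M lam eps ψ,
            Whitehead.TerminatesWithin
              (Whitehead.whiteheadSpeedUp (moves.map Whitehead.table) [Whitehead.table Ψ]
                u₁.toWord u₂.toWord)
              (K' * max u₁.norm u₂.norm)
              (fun b => b = true ↔ Whitehead.SameOrbit u₁ u₂)) ∧
      -- (f)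
      (∀ (ψ : Whitehead.Out N) (Ψ : MulAut (Whitehead.F N)), Whitehead.toOut Ψ = ψ →
        ∃ K' : ℕ, 1 ≤ K' ∧
          ∀ u₁ ∈ Whitehead.UPsi N M lam eps ψ, ∀ u₂ : Whitehead.F N, u₂ ≠ 1 →
            Whitehead.TerminatesWithin
              (Whitehead.whiteheadSpeedUp (moves.map Whitehead.table) [Whitehead.table Ψ]
                u₁.toWord u₂.toWord)
              (K' * max u₁.norm (u₂.norm ^ 2))
              (fun b => b = true ↔ Whitehead.SameOrbit u₁ u₂)) := by
  obtain ⟨C₀, hC₀⟩ := minimization_terminates hN hmoves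
  obtain ⟨C₁, hC₁⟩ := bind_compareMinimal_terminates hN hmoves M eps hlam
  -- the minimization process takes linear time on `U` and quadratic time in general
  have hlin : ∀ u ∈ U N M lam eps, TerminatesWithin (minimization (moves.map table) u.toWord)
      (4 * C₀ * (M + 1) * u.norm) (fun v => FreeGroup.IsCyclicallyReduced v ∧
        cls (FreeGroup.mk v) ∈ minimalSet (cls u)) := by
    rintro u ⟨hu, hmin⟩
    have := hC₀ M u.toWord FreeGroup.isReduced_toWord
      (by rw [FreeGroup.mk_toWord]; exact hmin.descentBound hlam moves)
    rw [FreeGroup.mk_toWord] at this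
    exact this.mono (linear_time_le _ _ (norm_pos_of_ne_one hu)) fun _ h => h
  have hquad : ∀ u : F N, u ≠ 1 → TerminatesWithin (minimization (moves.map table) u.toWord)
      (4 * C₀ * (M + 1) * u.norm ^ 2) (fun v => FreeGroup.IsCyclicallyReduced v ∧
        cls (FreeGroup.mk v) ∈ minimalSet (cls u)) := by
    intro u hu
    have := hC₀ u.norm u.toWord FreeGroup.isReduced_toWord
      (by rw [FreeGroup.mk_toWord]; exact descentBound_norm moves u)
    rw [FreeGroup.mk_toWord] at this
    exact this.mono (quadratic_time_le _ _ (norm_pos_of_ne_one hu)) fun _ h => h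
  have hU : ∀ u ∈ U N M lam eps,
      ∃ c ∈ MulAction.orbit (Out N) (cls u), IsMLEMinimal M lam eps c :=
    fun u hu => ⟨cls u, MulAction.mem_orbit_self _, hu.2⟩
  refine ⟨2 * (4 * C₀ * (M + 1)) + 2 * C₁ + 1, by omega, fun u hu => ?_, fun u₁ hu₁ u₂ hu₂ => ?_,
    fun u₁ hu₁ u₂ hu₂ => ?_, fun u₁ hu₁ u₂ hu₂ => ?_, ?_⟩
  · exact (hlin u hu).mono (Nat.mul_le_mul_right _ (by omega)) fun _ h => h.2
  · exact (hC₁ _ _ _ _ u₁ u₂ (hU u₁ hu₁) (hlin u₁ hu₁) (hlin u₂ hu₂)).mono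
      (total_time_le (norm_pos_of_ne_one hu₁.1) le_rfl) fun _ h => h
  · exact (hC₁ _ _ _ _ u₁ u₂ hu₁.2 (hquad u₁ hu₁.1) (hquad u₂ hu₂)).mono
      (total_time_le (norm_pos_of_ne_one hu₁.1) (Nat.le_self_pow two_ne_zero _)) fun _ h => h
  · exact (hC₁ _ _ _ _ u₁ u₂ (hU u₁ hu₁) (hlin u₁ hu₁) (hquad u₂ hu₂)).mono
      (total_time_le (norm_pos_of_ne_one hu₁.1) le_rfl) fun _ h => h
  -- the speed-up: one of the two parallel processes takes boundedly many rounds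
  have hspeed : ∀ (ψ : Out N) (Ψ : MulAut (F N)), toOut Ψ = ψ → ∃ C₂ : ℕ,
      (∀ u ∈ UPsi N M lam eps ψ, TerminatesWithin
        (minimizationSpeedUp (moves.map table) [table Ψ] u.toWord)
        (4 * C₂ * (M + 1) * u.norm) (fun v => FreeGroup.IsCyclicallyReduced v ∧
          cls (FreeGroup.mk v) ∈ minimalSet (cls u))) ∧
      (∀ u : F N, u ≠ 1 → TerminatesWithin
        (minimizationSpeedUp (moves.map table) [table Ψ] u.toWord)
        (4 * C₂ * (M + 1) * u.norm ^ 2) (fun v => FreeGroup.IsCyclicallyReduced v ∧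
          cls (FreeGroup.mk v) ∈ minimalSet (cls u))) := by
    rintro _ Ψ rfl
    obtain ⟨C₂, hC₂⟩ := minimizationSpeedUp_terminates hN hmoves Ψ
    refine ⟨C₂, ?_, ?_⟩
    · rintro u ⟨hu, hmin⟩
      have := hC₂ M u.toWord FreeGroup.isReduced_toWord
        (by rw [FreeGroup.mk_toWord]; exact Or.inr (hmin.descentBound hlam moves))
      rw [FreeGroup.mk_toWord] at this
      exact this.mono (linear_time_le _ _ (norm_pos_of_ne_one hu)) fun _ h => h
    · intro u hu
      have := hC₂ u.norm u.toWord FreeGroup.isReduced_toWord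
        (by rw [FreeGroup.mk_toWord]; exact Or.inl (descentBound_norm moves u))
      rw [FreeGroup.mk_toWord] at this
      exact this.mono (quadratic_time_le _ _ (norm_pos_of_ne_one hu)) fun _ h => h
  have hUPsi : ∀ ψ, ∀ u ∈ UPsi N M lam eps ψ,
      ∃ c ∈ MulAction.orbit (Out N) (cls u), IsMLEMinimal M lam eps c :=
    fun ψ u hu => ⟨ψ • cls u, MulAction.mem_orbit _ _, hu.2⟩
  refine ⟨fun ψ Ψ hΨ => ?_, fun ψ Ψ hΨ => ?_⟩
  · obtain ⟨C₂, h₁, -⟩ := hspeed ψ Ψ hΨ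
    refine ⟨2 * (4 * C₂ * (M + 1)) + 2 * C₁ + 1, by omega, fun u₁ hu₁ u₂ hu₂ => ?_⟩
    exact (hC₁ _ _ _ _ u₁ u₂ (hUPsi ψ u₁ hu₁) (h₁ u₁ hu₁) (h₁ u₂ hu₂)).mono
      (total_time_le (norm_pos_of_ne_one hu₁.1) le_rfl) fun _ h => h
  · obtain ⟨C₂, h₁, h₂⟩ := hspeed ψ Ψ hΨ
    refine ⟨2 * (4 * C₂ * (M + 1)) + 2 * C₁ + 1, by omega, fun u₁ hu₁ u₂ hu₂ => ?_⟩
    exact (hC₁ _ _ _ _ u₁ u₂ (hUPsi ψ u₁ hu₁) (h₁ u₁ hu₁) (h₂ u₂ hu₂)).mono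
      (total_time_le (norm_pos_of_ne_one hu₁.1) le_rfl) fun _ h => h
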